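/- Let $M$ be a complex manifold of dimension $n$, and let $\pi:E\to M$ be a holomorphic Lie algebroid of rank $m$: a holomorphic vector bundle with a holomorphic anchor $\rho:E\to T'M$ and a Lie bracket on its (local) holomorphic sections satisfying $[s_1,fs_2]=f[s_1,s_2]+\rho(s_1)(f)s_2$. Let $F:E\to\mathbb R$ be a convex complex Finsler structure: $F$ is $C^\infty$ on $\widetilde E=\{u\in E: u\neq 0\}$, $F\ge 0$ with $F(u)=0$ iff $u=0$, $F(\lambda u)=|\lambda|^2F(u)$ for $\lambda\in\mathbb C$, and on $\widetilde E$ the matrix $h_{\alpha\bar\beta}=\dot\partial_\alpha\dot\partial_{\bar\beta}F$ is positive definite, with inverse $h^{\bar\sigma\gamma}$, $h^{\bar\sigma\gamma}h_{\gamma\bar\varepsilon}=\delta^{\bar\sigma}_{\bar\varepsilon}$. Here $(z^k)$ are local holomorphic coordinates on $M$, $(e_\alpha)$ is a local holomorphic frame of $E$, $(z^k,u^\alpha)$ are the induced coordinates of the point $u^\alpha e_\alpha(z)$ of $E$, $\partial_k=\partial/\partial z^k$, $\dot\partial_\alpha=\partial/\partial u^\alpha$, $\dot\partial_{\bar\alpha}=\partial/\partial\bar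 u^\alpha$, $\rho(e_\alpha)=\rho_\alpha^k\,\partial/\partial z^k$ and $\partial_\alpha=\rho^k_\alpha\partial_k$. The complexified prolongation is the complex vector bundle over $E$ with fibre $$(\mathcal T_{\mathbb C}E)_u=\{(e,v)\in (E_{\pi(u)})_{\mathbb C}\times (T_uE)_{\mathbb C} : \rho(e)=\pi_*(v)\},$$ with anchor $\rho_{\mathcal T}(e,v)=v$; $\mathcal T'E$ is its $(1,0)$-part and $V\mathcal T'E=\{(0,v)\in\mathcal T'E\}$. It has the local frame $\mathcal Z_\alpha=(e_\alpha,\partial_\alpha)$, $\mathcal V_\alpha=(0,\dot\partial_\alpha)$ and the conjugates $\mathcal Z_{\bar\alpha},\mathcal V_{\bar\alpha}$. Put $$N^\beta_k=h^{\bar\sigma\beta}\partial_k\dot\partial_{\bar\sigma}F,\quad \delta_k=\partial_k-N^\beta_k\dot\partial_\beta,\quad N^\beta_\alpha=h^{\bar\sigma\beta}\partial_\alpha\dot\partial_{\bar\sigma}F,\quad \mathcal X_\alpha=\mathcal Z_\alpha-N^\beta_\alpha\mathcal V_\beta,\quad \delta_\alpha=\rho_{\mathcal T}(\mathcal X_\alpha),$$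 $$L^\gamma_{\alpha k}=h^{\bar\sigma\gamma}\delta_kh_{\alpha\bar\sigma},\qquad C^\gamma_{\alpha\beta}=h^{\bar\sigma\gamma}\dot\partial_\beta h_{\alpha\bar\sigma},\qquad L^\gamma_{\alpha\beta}=\rho^k_\beta L^\gamma_{\alpha k}.$$ Then, over $\widetilde E$: 1. $\delta_\beta=\rho^k_\beta\delta_k$ and $L^\gamma_{\alpha\beta}=\rho^k_\beta L^\gamma_{\alpha k}=h^{\bar\sigma\gamma}\delta_\beta h_{\alpha\bar\sigma}$. 2. There is a nonlinear connection $H$, i.e. a $C^\infty$ complex subbundle $H\subset\mathcal T'E$ with $\mathcal T'E=H\oplus V\mathcal T'E$, which is spanned in every chart by the $\mathcal X_\alpha$. 3. There is a unique complex linear connection $\mathcal D:\Gamma(\mathcal T_{\mathbb C}E)\times\Gamma(\mathcal T_{\mathbb C}E)\to\Gamma(\mathcal T_{\mathbb C}E)$ (tensorial in the direction, with $\mathcal D_X(fY)=f\mathcal D_XY+\rho_{\mathcal T}(X)(f)\,Y$) which commutes with conjugation, preserves $H$, $V\mathcal T'E$ and their conjugates, and satisfies in every chart $$\mathcal D_{\mathcal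 X_\beta}\mathcal V_\alpha=L^\gamma_{\alpha\beta}\mathcal V_\gamma,\quad \mathcal D_{\mathcal V_\beta}\mathcal V_\alpha=C^\gamma_{\alpha\beta}\mathcal V_\gamma,\quad \mathcal D_{\mathcal X_\beta}\mathcal X_\alpha=L^\gamma_{\alpha\beta}\mathcal X_\gamma,\quad \mathcal D_{\mathcal V_\beta}\mathcal X_\alpha=C^\gamma_{\alpha\beta}\mathcal X_\gamma,$$ $$\mathcal D_{\mathcal X_\beta}\mathcal V_{\bar\alpha}=\mathcal D_{\mathcal V_\beta}\mathcal V_{\bar\alpha}=\mathcal D_{\mathcal X_\beta}\mathcal X_{\bar\alpha}=\mathcal D_{\mathcal V_\beta}\mathcal X_{\bar\alpha}=0,$$ the last line saying that $\mathcal D$ is of type $(1,0)$. It is called the Chern–Finsler connection of $E$. 4. $\mathcal D$ is induced by the vertical Chern–Finsler connection: there is a unique partial linear connection $D:\Gamma(T_{\mathbb C}E)\times\Gamma(VT_{\mathbb C}E)\to\Gamma(VT_{\mathbb C}E)$ on $VT_{\mathbb C}E=\ker\pi_*$ which commutes with conjugation, preserves the $(1,0)$- and $(0,1)$-parts of $VT_{\mathbb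 C}E$, and satisfies in every chart $D_{\delta_k}\dot\partial_\alpha=L^\gamma_{\alpha k}\dot\partial_\gamma$, $D_{\dot\partial_\beta}\dot\partial_\alpha=C^\gamma_{\alpha\beta}\dot\partial_\gamma$, $D_{\delta_k}\dot\partial_{\bar\alpha}=D_{\dot\partial_\beta}\dot\partial_{\bar\alpha}=0$; and $\mathcal D_X(0,W)=(0,D_{\rho_{\mathcal T}(X)}W)$ for all $X$ in $\mathcal T_{\mathbb C}E$ and all smooth sections $W$ of $VT_{\mathbb C}E$. -/

import Mathlib

open scoped ComplexOrder Manifold ContDiff Topology TensorProduct Bundle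

noncomputable section

namespace FinslerAlgebroid

open Bundle

/-! ### Linear algebra: complexification of a complex vector space -/

section Complexification

variable {V W : Type*} [AddCommGroup V] [Module ℂ V] [AddCommGroup W] [Module ℂ W]

/-- The `(1,0)`-component of a vector: `v ↦ ½ (v - i J v)` in the complexification `ℂ ⊗[ℝ] V`,
where `J` is multiplication by `i` on `V` and `i` is the scalar of the complexification.
It is an isomorphism of `V` onto the `(1,0)`-part of `ℂ ⊗[ℝ] V`; for example it sends the
tangent vector `∂/∂x` to `∂/∂z = ½ (∂/∂x - i ∂/∂y)`. -/
def hol : V →ₗ[ℂ] ℂ ⊗[ℝ] V where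
  toFun v := (1 / 2 : ℂ) ⊗ₜ[ℝ] v - (Complex.I / 2) ⊗ₜ[ℝ] (Complex.I • v)
  map_add' v w := by
    simp only [smul_add, TensorProduct.tmul_add]
    abel
  map_smul' c v := by
    have h1 : c • v = c.re • v + c.im • (Complex.I • v) := by
      conv_lhs => rw [← Complex.re_add_im c]
      rw [add_smul, mul_smul]
      rfl
    have h2 : Complex.I • c • v = c.re • (Complex.I • v) - c.im • v := by
      have h3 : Complex.I * c = (c.re : ℂ) * Complex.I - (c.im : ℂ) := by
        apply Complex.ext <;> simp
      rw [← mul_smul, h3, sub_smul, mul_smul]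
      rfl
    rw [h1] at *
    rw [h2]
    simp only [TensorProduct.tmul_add, TensorProduct.tmul_sub, TensorProduct.tmul_smul,
      TensorProduct.smul_tmul', RingHom.id_apply, smul_sub, smul_eq_mul, Complex.real_smul]
    have e1 : c * (1 / 2) = c.re * (1 / 2) + c.im * (Complex.I / 2) := by
      apply Complex.ext <;> simp
    have e2 : c * (Complex.I / 2) = c.re * (Complex.I / 2) - c.im * (1 / 2) := by
      apply Complex.ext <;> simp
    rw [e1, e2, TensorProduct.add_tmul, TensorProduct.sub_tmul]
    abel

/-- Complex conjugation `c ⊗ v ↦ c̄ ⊗ v` on the complexification. -/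
def conjC : (ℂ ⊗[ℝ] V) →ₗ[ℝ] (ℂ ⊗[ℝ] V) :=
  LinearMap.rTensor V Complex.conjAe.toLinearMap

variable (V) in
/-- The `(1,0)`-part of the complexification. -/
def holPart : Submodule ℂ (ℂ ⊗[ℝ] V) := LinearMap.range hol

variable (V) in
/-- The `(0,1)`-part of the complexification, conjugate to the `(1,0)`-part. -/
def antiPart : Submodule ℂ (ℂ ⊗[ℝ] V) :=
  Submodule.span ℂ (Set.range fun v : V => conjC (hol v))

/-- The complex-linear extension to complexifications of a linear map. -/
def complexify (f : V →ₗ[ℂ] W) : (ℂ ⊗[ℝ] V) →ₗ[ℂ] (ℂ ⊗[ℝ] W) :=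
  (f.restrictScalars ℝ).baseChange ℂ

theorem complexify_hol (f : V →ₗ[ℂ] W) (v : V) : complexify f (hol v) = hol (f v) := by
  simp [complexify, hol, map_sub]

theorem complexify_conjC (f : V →ₗ[ℂ] W) (x : ℂ ⊗[ℝ] V) :
    complexify f (conjC x) = conjC (complexify f x) := by
  induction x using TensorProduct.induction_on with
  | zero => simp
  | tmul c v => simp [complexify, conjC]
  | add a b ha hb => simp only [map_add, ha, hb]

end Complexification

/-! ### Holomorphic Lie algebroids -/

/-- The holomorphic model of an `n`-dimensional complex manifold. -/
abbrev IM (n : ℕ) := 𝓘(ℂ, Fin n → ℂ)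

/-- The holomorphic model of the total space of a rank `m` bundle over it. -/
abbrev IE (n m : ℕ) := (𝓘(ℂ, Fin n → ℂ)).prod 𝓘(ℂ, Fin m → ℂ)

/-- The underlying real model of the total space (same charts, real differentiability). -/
abbrev IER (n m : ℕ) := (𝓘(ℝ, Fin n → ℂ)).prod 𝓘(ℝ, Fin m → ℂ)

set_option linter.unusedSectionVars false

section Main

variable (n m : ℕ)
  (M : Type*) [TopologicalSpace M] [ChartedSpace (Fin n → ℂ) M] [IsManifold (IM n) ω M]
  (E : M → Type*) [∀ x, AddCommGroup (E x)] [∀ x, Module ℂ (E x)]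
  [TopologicalSpace (TotalSpace (Fin m → ℂ) E)] [∀ x, TopologicalSpace (E x)]
  [FiberBundle (Fin m → ℂ) E] [VectorBundle ℂ (Fin m → ℂ) E]
  [ContMDiffVectorBundle ω (Fin m → ℂ) E (IM n)]

/-- A section of `E` is holomorphic at `x` (that is, in a neighbourhood of `x`). -/
def HolSectionAt (s : ∀ x, E x) (x : M) : Prop :=
  ContMDiffAt (IM n) (IE n m) ω (fun y => (⟨y, s y⟩ : TotalSpace (Fin m → ℂ) E)) x

/-- A holomorphic Lie algebroid: a holomorphic vector bundle `E → M` with a holomorphic anchor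
`ρ : E → T'M` and a Lie bracket on (the sheaf of) holomorphic sections satisfying the Leibniz rule.
Sections are total functions, and the bracket is constrained at the points near which
its arguments are holomorphic; `bracket_congr` says that it is an operation on germs. -/
structure HolomorphicLieAlgebroid where
  anchor : ∀ x, E x →ₗ[ℂ] TangentSpace (IM n) x
  anchor_holomorphic : ContMDiff (IE n m) (IM n).tangent ω
    (fun v : TotalSpace (Fin m → ℂ) E => (⟨v.1, anchor v.1 v.2⟩ : TangentBundle (IM n) M))
  bracket : (∀ x, E x) → (∀ x, E x) → ∀ x, E x
  bracket_congr : ∀ (s s' t t' : ∀ x, E x) (x : M),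
    HolSectionAt n m M E s x → HolSectionAt n m M E t x →
    (∀ᶠ y in 𝓝 x, s y = s' y) → (∀ᶠ y in 𝓝 x, t y = t' y) → bracket s t x = bracket s' t' x
  bracket_holomorphic : ∀ (s t : ∀ x, E x) (x : M),
    HolSectionAt n m M E s x → HolSectionAt n m M E t x → HolSectionAt n m M E (bracket s t) x
  bracket_add : ∀ (s t r : ∀ x, E x) (x : M),
    HolSectionAt n m M E s x → HolSectionAt n m M E t x → HolSectionAt n m M E r x →
    bracket s (fun y => t y + r y) x = bracket s t x + bracket s r x
  bracket_skew : ∀ (s t : ∀ x, E x) (x : M),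
    HolSectionAt n m M E s x → HolSectionAt n m M E t x → bracket s t x = - bracket t s x
  bracket_jacobi : ∀ (s t r : ∀ x, E x) (x : M),
    HolSectionAt n m M E s x → HolSectionAt n m M E t x → HolSectionAt n m M E r x →
    bracket s (bracket t r) x + bracket t (bracket r s) x + bracket r (bracket s t) x = 0
  bracket_leibniz : ∀ (f : M → ℂ) (s t : ∀ x, E x) (x : M),
    ContMDiffAt (IM n) 𝓘(ℂ, ℂ) ω f x → HolSectionAt n m M E s x → HolSectionAt n m M E t x →
    bracket s (fun y => f y • t y) x =
      f x • bracket s t x + (show ℂ from mfderiv (IM n) 𝓘(ℂ, ℂ) f x (anchor x (s x))) • t x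

/-- A holomorphic coordinate chart `(z^k)` of `M` on `U = chart.source` together with a
holomorphic frame `(e_α)` of `E` over `U`; it gives the coordinates `(z^k, u^α)` on `π⁻¹(U)`. -/
structure HolChart where
  chart : OpenPartialHomeomorph M (Fin n → ℂ)
  chart_mem : chart ∈ IsManifold.maximalAtlas (IM n) ω M
  frame : Fin m → ∀ x, E x
  isFrame : IsLocalFrameOn (IM n) (Fin m → ℂ) ω frame chart.source

variable {n m M E}

namespace HolChart

variable (c : HolChart n m M E)

/-- The coordinates `(z, u)` of a point `u^α e_α(z)` of the total space. -/
def coord (p : TotalSpace (Fin m → ℂ) E) : (Fin n → ℂ) × (Fin m → ℂ) :=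
  (c.chart p.1, fun α => c.isFrame.coeff α p.1 p.2)

/-- The point `u^α e_α(z)` of the total space with coordinates `(z, u)`. -/
def param (y : (Fin n → ℂ) × (Fin m → ℂ)) : TotalSpace (Fin m → ℂ) E :=
  ⟨c.chart.symm y.1, ∑ α, y.2 α • c.frame α (c.chart.symm y.1)⟩

/-- The tangent vector of the total space at `p` with components `w` in the coordinates. -/
def coordVec (p : TotalSpace (Fin m → ℂ) E) (w : (Fin n → ℂ) × (Fin m → ℂ)) :
    TangentSpace (IE n m) p :=
  mfderiv 𝓘(ℂ, (Fin n → ℂ) × (Fin m → ℂ)) (IE n m) c.param (c.coord p) w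

/-- The vector `∂_k = ∂/∂z^k` of the natural frame, in the complexified tangent space of `E`. -/
def dz (k : Fin n) (p : TotalSpace (Fin m → ℂ) E) : ℂ ⊗[ℝ] TangentSpace (IE n m) p :=
  hol (c.coordVec p (Pi.single k 1, 0))

/-- The vector `∂̇_α = ∂/∂u^α` of the natural frame, in the complexified tangent space of `E`. -/
def du (α : Fin m) (p : TotalSpace (Fin m → ℂ) E) : ℂ ⊗[ℝ] TangentSpace (IE n m) p :=
  hol (c.coordVec p (0, Pi.single α 1))

/-- The anchor coefficients `ρ^k_α`, defined by `ρ(e_α) = ρ^k_α ∂/∂z^k`. -/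
def rho (A : HolomorphicLieAlgebroid n m M E) (k : Fin n) (α : Fin m) (x : M) : ℂ :=
  (show Fin n → ℂ from mfderiv (IM n) 𝓘(ℂ, Fin n → ℂ) c.chart x (A.anchor x (c.frame α x))) k

theorem param_mdifferentiableAt {x : M} (hx : x ∈ c.chart.source) (u : Fin m → ℂ) :
    MDifferentiableAt 𝓘(ℂ, (Fin n → ℂ) × (Fin m → ℂ)) (IE n m) c.param (c.chart x, u) := by
  have hsymm : ContMDiffAt 𝓘(ℂ, Fin n → ℂ) (IM n) ω c.chart.symm (c.chart x) :=
    contMDiffAt_symm_of_mem_maximalAtlas c.chart_mem (c.chart.map_source hx)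
  have hfst : ContMDiffAt 𝓘(ℂ, (Fin n → ℂ) × (Fin m → ℂ)) 𝓘(ℂ, Fin n → ℂ) ω
      (Prod.fst : (Fin n → ℂ) × (Fin m → ℂ) → _) (c.chart x, u) :=
    contDiff_fst.contMDiff.contMDiffAt
  have hbase : ContMDiffAt 𝓘(ℂ, (Fin n → ℂ) × (Fin m → ℂ)) (IM n) ω
      (fun y : (Fin n → ℂ) × (Fin m → ℂ) => c.chart.symm y.1) (c.chart x, u) :=
    ContMDiffAt.comp (c.chart x, u) (g := c.chart.symm) (f := Prod.fst) hsymm hfst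
  refine ContMDiffAt.mdifferentiableAt (n := ω) ?_ (by simp)
  rw [Bundle.contMDiffAt_totalSpace]
  refine ⟨hbase, ?_⟩
  have hxs : c.chart.symm (c.chart x) = x := c.chart.left_inv hx
  simp only [param]
  set e := trivializationAt (Fin m → ℂ) E (c.chart.symm (c.chart x)) with he
  have hframe : ∀ α, ContMDiffAt 𝓘(ℂ, (Fin n → ℂ) × (Fin m → ℂ)) 𝓘(ℂ, Fin m → ℂ) ω
      (fun y : (Fin n → ℂ) × (Fin m → ℂ) =>
        (e ⟨c.chart.symm y.1, c.frame α (c.chart.symm y.1)⟩).2) (c.chart x, u) := by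
    intro α
    have h1 : ContMDiffAt (IM n) (IE n m) ω
        (fun y => (⟨y, c.frame α y⟩ : TotalSpace (Fin m → ℂ) E)) (c.chart.symm (c.chart x)) :=
      (c.isFrame.contMDiffOn α).contMDiffAt
        (c.chart.open_source.mem_nhds (by rw [hxs]; exact hx))
    have h2 := (Bundle.contMDiffAt_totalSpace.1 h1).2
    exact ContMDiffAt.comp (c.chart x, u)
      (g := fun y => (e ⟨y, c.frame α y⟩).2) (f := fun y => c.chart.symm y.1) h2 hbase
  have hsum : ContMDiffAt 𝓘(ℂ, (Fin n → ℂ) × (Fin m → ℂ)) 𝓘(ℂ, Fin m → ℂ) ω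
      (fun y : (Fin n → ℂ) × (Fin m → ℂ) => ∑ α, y.2 α •
        (e ⟨c.chart.symm y.1, c.frame α (c.chart.symm y.1)⟩).2) (c.chart x, u) := by
    refine ContMDiffAt.sum fun α _ => ?_
    have h1 : ContDiff ℂ ω (fun y : (Fin n → ℂ) × (Fin m → ℂ) => y.2 α) := by fun_prop
    exact ContMDiffAt.smul h1.contMDiff.contMDiffAt (hframe α)
  refine hsum.congr_of_eventuallyEq ?_
  have hmem : ∀ᶠ y in 𝓝 ((c.chart x, u) : (Fin n → ℂ) × (Fin m → ℂ)),
      c.chart.symm y.1 ∈ e.baseSet :=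
    hbase.continuousAt.eventually
      (e.open_baseSet.mem_nhds (FiberBundle.mem_baseSet_trivializationAt' _))
  filter_upwards [hmem] with y hy
  have hlin : ∀ w : E (c.chart.symm y.1),
      (e ⟨c.chart.symm y.1, w⟩).2 = e.linearMapAt ℂ (c.chart.symm y.1) w := by
    intro w
    rw [Bundle.Trivialization.linearMapAt_apply, if_pos hy]
  simp only [hlin, map_sum, map_smul]

theorem param_coord {p : TotalSpace (Fin m → ℂ) E} (hp : p.1 ∈ c.chart.source) :
    c.param (c.coord p) = p := by
  obtain ⟨x, v⟩ := p
  have hxs : c.chart.symm (c.chart x) = x := c.chart.left_inv hp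
  have hv : ∑ α, c.isFrame.coeff α x v • c.frame α x = v := by
    simpa [IsLocalFrameOn.coeff, show x ∈ c.chart.source from hp] using
      (c.isFrame.toBasisAt hp).sum_repr v
  have key : ∀ x' : M, x' = x → (⟨x', ∑ α, c.isFrame.coeff α x v • c.frame α x'⟩ :
      TotalSpace (Fin m → ℂ) E) = ⟨x, v⟩ := by
    rintro _ rfl
    rw [hv]
  exact key _ hxs

/-- The projection `π_*` of a coordinate vector only sees its base component. -/
theorem proj_coordVec {p : TotalSpace (Fin m → ℂ) E} (hp : p.1 ∈ c.chart.source)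
    (w : (Fin n → ℂ) × (Fin m → ℂ)) :
    mfderiv (IE n m) (IM n) (TotalSpace.proj : TotalSpace (Fin m → ℂ) E → M) p
        (c.coordVec p w) =
      mfderiv 𝓘(ℂ, Fin n → ℂ) (IM n) c.chart.symm (c.chart p.1) w.1 := by
  have hparam := (c.param_mdifferentiableAt hp (c.coord p).2).hasMFDerivAt
  have hproj : ∀ q, q = p → HasMFDerivAt (IE n m) (IM n)
      (TotalSpace.proj : TotalSpace (Fin m → ℂ) E → M) q
      (mfderiv (IE n m) (IM n) (TotalSpace.proj : TotalSpace (Fin m → ℂ) E → M) p :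
        (Fin n → ℂ) × (Fin m → ℂ) →L[ℂ] (Fin n → ℂ)) := by
    rintro _ rfl
    exact (mdifferentiableAt_proj E).hasMFDerivAt
  have h1 := HasMFDerivAt.comp (c.coord p) (hproj _ (c.param_coord hp)) hparam
  have hsymm : MDifferentiableAt 𝓘(ℂ, Fin n → ℂ) (IM n) c.chart.symm (c.chart p.1) :=
    (contMDiffAt_symm_of_mem_maximalAtlas c.chart_mem
      (c.chart.map_source hp)).mdifferentiableAt (by simp)
  have h2 : HasMFDerivAt 𝓘(ℂ, (Fin n → ℂ) × (Fin m → ℂ)) (IM n)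
      (c.chart.symm ∘ Prod.fst) (c.coord p) _ :=
    HasMFDerivAt.comp (c.coord p) (g := c.chart.symm) (f := Prod.fst) hsymm.hasMFDerivAt
      (hasFDerivAt_fst (𝕜 := ℂ)).hasMFDerivAt
  have h3 := hasMFDerivAt_unique h1 h2
  exact congrArg (fun L : (Fin n → ℂ) × (Fin m → ℂ) →L[ℂ] (Fin n → ℂ) => L w) h3

theorem rho_spec (A : HolomorphicLieAlgebroid n m M E) (α : Fin m) {x : M}
    (hx : x ∈ c.chart.source) :
    mfderiv 𝓘(ℂ, Fin n → ℂ) (IM n) c.chart.symm (c.chart x) (fun k => c.rho A k α x) =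
      A.anchor x (c.frame α x) := by
  have hc : MDifferentiableAt (IM n) 𝓘(ℂ, Fin n → ℂ) c.chart x :=
    (contMDiffAt_of_mem_maximalAtlas c.chart_mem hx).mdifferentiableAt (by simp)
  have hsymm : MDifferentiableAt 𝓘(ℂ, Fin n → ℂ) (IM n) c.chart.symm (c.chart x) :=
    (contMDiffAt_symm_of_mem_maximalAtlas c.chart_mem
      (c.chart.map_source hx)).mdifferentiableAt (by simp)
  have h1 := HasMFDerivAt.comp x hsymm.hasMFDerivAt hc.hasMFDerivAt
  have h2 : HasMFDerivAt (IM n) (IM n) (c.chart.symm ∘ c.chart) x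
      (ContinuousLinearMap.id ℂ (TangentSpace (IM n) x)) := by
    refine (hasMFDerivAt_id x).congr_of_eventuallyEq ?_
    filter_upwards [c.chart.open_source.mem_nhds hx] with y hy
    exact c.chart.left_inv hy
  have h3 := hasMFDerivAt_unique h1 h2
  exact congrArg (fun L : (Fin n → ℂ) →L[ℂ] (Fin n → ℂ) => L (A.anchor x (c.frame α x))) h3

end HolChart

/-! ### The complexified prolongation and the vertical bundle -/

/-- The action `X f` of a complexified tangent vector of `E` on a complex function:
`(c ⊗ v) f = c · df(v)` with the real differential `df`. -/
def vecAct {p : TotalSpace (Fin m → ℂ) E} (X : ℂ ⊗[ℝ] TangentSpace (IE n m) p)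
    (f : TotalSpace (Fin m → ℂ) E → ℂ) : ℂ :=
  LinearMap.liftBaseChange ℂ
    ({ toFun := fun v => (show ℂ from mfderiv (IER n m) 𝓘(ℝ, ℂ) f p v)
       map_add' := fun v w => map_add (mfderiv (IER n m) 𝓘(ℝ, ℂ) f p) v w
       map_smul' := fun r v => map_smul (mfderiv (IER n m) 𝓘(ℝ, ℂ) f p) r v } :
      TangentSpace (IE n m) p →ₗ[ℝ] ℂ) X

variable (n) in
/-- The complexified tangent map `π_* : T_ℂE → T_ℂM` of the projection. -/
def projC (p : TotalSpace (Fin m → ℂ) E) :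
    (ℂ ⊗[ℝ] TangentSpace (IE n m) p) →ₗ[ℂ] (ℂ ⊗[ℝ] TangentSpace (IM n) p.1) :=
  complexify (mfderiv (IE n m) (IM n) (TotalSpace.proj : TotalSpace (Fin m → ℂ) E → M) p
    ).toLinearMap

variable (n) in
/-- The fibre at `p` of the complexified vertical bundle `VT_ℂE = ker π_*`. -/
def VertC (p : TotalSpace (Fin m → ℂ) E) : Submodule ℂ (ℂ ⊗[ℝ] TangentSpace (IE n m) p) :=
  LinearMap.ker (projC n p)

variable (A : HolomorphicLieAlgebroid n m M E)

/-- The fibre at `p` of the complexified prolongation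
`𝒯_ℂE = {(e, v) ∈ E_ℂ × T_ℂE | ρ(e) = π_*(v)}`, as a complex vector bundle over `E`. -/
def Prolongation (p : TotalSpace (Fin m → ℂ) E) :
    Submodule ℂ ((ℂ ⊗[ℝ] E p.1) × (ℂ ⊗[ℝ] TangentSpace (IE n m) p)) :=
  LinearMap.eqLocus (complexify (A.anchor p.1) ∘ₗ LinearMap.fst ℂ _ _)
    (projC n p ∘ₗ LinearMap.snd ℂ _ _)

/-- The anchor `ρ_𝒯 : 𝒯_ℂE → T_ℂE`, `(e, v) ↦ v`. -/
def anchorT (p : TotalSpace (Fin m → ℂ) E) :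
    Prolongation A p →ₗ[ℂ] ℂ ⊗[ℝ] TangentSpace (IE n m) p :=
  LinearMap.snd ℂ _ _ ∘ₗ (Prolongation A p).subtype

/-- The identification `v ↦ (0, v)` of `VT_ℂE` with the vertical subbundle of `𝒯_ℂE`. -/
def vertIncl (p : TotalSpace (Fin m → ℂ) E) : VertC n p →ₗ[ℂ] Prolongation A p :=
  LinearMap.codRestrict (Prolongation A p) (LinearMap.inr ℂ _ _ ∘ₗ (VertC n p).subtype)
    (fun w => by
      have h : projC n p w.1 = 0 := w.2
      simp [Prolongation, LinearMap.mem_eqLocus, h])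

/-- Complex conjugation on `VT_ℂE`. -/
def conjV {p : TotalSpace (Fin m → ℂ) E} (w : VertC n p) : VertC n p :=
  ⟨conjC w.1, by
    have h : projC n p w.1 = 0 := w.2
    change complexify _ (conjC w.1) = 0
    rw [complexify_conjC]
    change conjC (projC n p w.1) = 0
    rw [h, map_zero]⟩

variable {A} in
/-- Complex conjugation on `𝒯_ℂE`. -/
def conjT {p : TotalSpace (Fin m → ℂ) E} (w : Prolongation A p) : Prolongation A p :=
  ⟨(conjC w.1.1, conjC w.1.2), by
    have h : complexify (A.anchor p.1) w.1.1 = projC n p w.1.2 := w.2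
    change complexify _ (conjC w.1.1) = complexify _ (conjC w.1.2)
    rw [complexify_conjC, complexify_conjC, h]
    rfl⟩

/-- The holomorphic prolongation `𝒯'E`, as a subbundle of `𝒯_ℂE`. -/
def holProlongation (p : TotalSpace (Fin m → ℂ) E) : Submodule ℂ (Prolongation A p) :=
  ((holPart (E p.1)).prod (holPart (TangentSpace (IE n m) p))).comap (Prolongation A p).subtype

/-- The vertical subbundle `V𝒯'E` of `𝒯'E`: the elements with first component zero. -/
def holVertical (p : TotalSpace (Fin m → ℂ) E) : Submodule ℂ (Prolongation A p) :=
  ((⊥ : Submodule ℂ (ℂ ⊗[ℝ] E p.1)).prod (holPart (TangentSpace (IE n m) p))).comap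
    (Prolongation A p).subtype

/-! ### Local frames -/

namespace HolChart

variable (c : HolChart n m M E)

theorem projC_du {p : TotalSpace (Fin m → ℂ) E} (hp : p.1 ∈ c.chart.source) (α : Fin m) :
    projC n p (c.du α p) = 0 := by
  rw [projC, du, complexify_hol]
  erw [c.proj_coordVec hp]
  exact (congrArg _ (map_zero _)).trans (map_zero hol)

open Classical in
/-- `∂̇_α` as a local section of `VT_ℂE` (extended by zero outside the domain of the chart). -/
def duV (α : Fin m) (p : TotalSpace (Fin m → ℂ) E) : VertC n p :=
  if h : p.1 ∈ c.chart.source then ⟨c.du α p, c.projC_du h α⟩ else 0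

/-- `𝒱_α = (0, ∂̇_α)`. -/
def vT (α : Fin m) (p : TotalSpace (Fin m → ℂ) E) : Prolongation A p :=
  vertIncl A p (c.duV α p)

/-- `∂_α = ρ^k_α ∂_k`. -/
def dA (α : Fin m) (p : TotalSpace (Fin m → ℂ) E) : ℂ ⊗[ℝ] TangentSpace (IE n m) p :=
  ∑ k, c.rho A k α p.1 • c.dz k p

theorem projC_dA {p : TotalSpace (Fin m → ℂ) E} (hp : p.1 ∈ c.chart.source) (α : Fin m) :
    projC n p (c.dA A α p) = hol (A.anchor p.1 (c.frame α p.1)) := by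
  have h : ∀ k, projC n p (c.dz k p) =
      hol (mfderiv 𝓘(ℂ, Fin n → ℂ) (IM n) c.chart.symm (c.chart p.1) (Pi.single k 1)) := by
    intro k
    rw [projC, dz, complexify_hol]
    erw [c.proj_coordVec hp]
    rfl
  rw [← c.rho_spec A α hp, dA, map_sum]
  simp only [map_smul, h]
  have hsum : (fun k => c.rho A k α p.1) =
      ∑ k, c.rho A k α p.1 • (Pi.single k 1 : Fin n → ℂ) := by
    ext j
    simp [Finset.sum_apply, Pi.single_apply]
  conv_rhs => rw [hsum]
  refine Eq.symm ((congrArg hol (map_sum _ _ _)).trans ?_)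
  rw [map_sum]
  refine Finset.sum_congr rfl fun k _ => ?_
  exact (congrArg hol (map_smul _ _ _)).trans (map_smul hol _ _)

open Classical in
/-- `𝒵_α = (e_α, ρ^k_α ∂_k)` (extended by zero outside the domain of the chart). -/
def zT (α : Fin m) (p : TotalSpace (Fin m → ℂ) E) : Prolongation A p :=
  if h : p.1 ∈ c.chart.source then
    ⟨(hol (c.frame α p.1), c.dA A α p), by
      change complexify (A.anchor p.1) (hol (c.frame α p.1)) = projC n p (c.dA A α p)
      rw [complexify_hol, c.projC_dA A h]⟩
  else 0

/-- The natural frame `{∂_k, ∂̇_α, ∂_k̄, ∂̇_ᾱ}` of `T_ℂE`. -/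
def tangentFrame : (Fin n ⊕ Fin m) ⊕ (Fin n ⊕ Fin m) → ∀ p : TotalSpace (Fin m → ℂ) E,
    ℂ ⊗[ℝ] TangentSpace (IE n m) p :=
  Sum.elim (Sum.elim c.dz c.du)
    (Sum.elim (fun k p => conjC (c.dz k p)) (fun α p => conjC (c.du α p)))

/-- The natural frame `{∂̇_α, ∂̇_ᾱ}` of `VT_ℂE`. -/
def verticalFrame : Fin m ⊕ Fin m → ∀ p : TotalSpace (Fin m → ℂ) E, VertC n p :=
  Sum.elim c.duV (fun α p => conjV (c.duV α p))

/-- The natural frame `{𝒵_α, 𝒱_α, 𝒵_ᾱ, 𝒱_ᾱ}` of `𝒯_ℂE`. -/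
def prolongationFrame : (Fin m ⊕ Fin m) ⊕ (Fin m ⊕ Fin m) → ∀ p : TotalSpace (Fin m → ℂ) E,
    Prolongation A p :=
  Sum.elim (Sum.elim (c.zT A) (c.vT A))
    (Sum.elim (fun α p => conjT (c.zT A α p)) (fun α p => conjT (c.vT A α p)))

end HolChart

/-! ### Finsler structures and the Chern-Finsler coefficients -/

variable (n m E) in
/-- The open submanifold `Ẽ` of nonzero vectors of `E`. -/
def nonzeroVectors : Set (TotalSpace (Fin m → ℂ) E) := {p | p.2 ≠ 0}

variable (n) in
/-- A complex Finsler structure on `E`. -/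
structure IsFinslerStructure (F : TotalSpace (Fin m → ℂ) E → ℝ) : Prop where
  smooth : ContMDiffOn (IER n m) 𝓘(ℝ, ℝ) ∞ F (nonzeroVectors m E)
  nonneg : ∀ p, 0 ≤ F p
  eq_zero_iff : ∀ p, F p = 0 ↔ p.2 = 0
  homogeneous : ∀ (x : M) (u : E x) (l : ℂ), F ⟨x, l • u⟩ = ‖l‖ ^ 2 * F ⟨x, u⟩

namespace HolChart

variable (c : HolChart n m M E) (F : TotalSpace (Fin m → ℂ) E → ℝ)

/-- `∂̇_σ̄ F`. -/
def dbarF (σ : Fin m) (p : TotalSpace (Fin m → ℂ) E) : ℂ :=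
  vecAct (conjC (c.du σ p)) (fun q => (F q : ℂ))

/-- The matrix `h_{ασ̄} = ∂̇_α ∂̇_σ̄ F`, with row `α` and column `σ`. -/
def h (p : TotalSpace (Fin m → ℂ) E) : Matrix (Fin m) (Fin m) ℂ :=
  Matrix.of fun α σ => vecAct (c.du α p) (c.dbarF F σ)

/-- `h^{σ̄γ}`, the entries (row `σ`, column `γ`) of the inverse matrix of `(h_{ασ̄})`. -/
def hInv (σ γ : Fin m) (p : TotalSpace (Fin m → ℂ) E) : ℂ := (c.h F p)⁻¹ σ γ

/-- `N^β_k = h^{σ̄β} ∂_k ∂̇_σ̄ F`. -/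
def Nz (β : Fin m) (k : Fin n) (p : TotalSpace (Fin m → ℂ) E) : ℂ :=
  ∑ σ, c.hInv F σ β p * vecAct (c.dz k p) (c.dbarF F σ)

/-- `N^β_α = h^{σ̄β} ∂_α ∂̇_σ̄ F`. -/
def NA (β α : Fin m) (p : TotalSpace (Fin m → ℂ) E) : ℂ :=
  ∑ σ, c.hInv F σ β p * vecAct (c.dA A α p) (c.dbarF F σ)

/-- `δ_k = ∂_k - N^β_k ∂̇_β`. -/
def deltaz (k : Fin n) (p : TotalSpace (Fin m → ℂ) E) : ℂ ⊗[ℝ] TangentSpace (IE n m) p :=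
  c.dz k p - ∑ β, c.Nz F β k p • c.du β p

/-- The adapted frame `𝒳_α = 𝒵_α - N^β_α 𝒱_β`. -/
def xT (α : Fin m) (p : TotalSpace (Fin m → ℂ) E) : Prolongation A p :=
  c.zT A α p - ∑ β, c.NA A F β α p • c.vT A β p

/-- `δ_α = ρ_𝒯(𝒳_α)`. -/
def deltaA (α : Fin m) (p : TotalSpace (Fin m → ℂ) E) : ℂ ⊗[ℝ] TangentSpace (IE n m) p :=
  anchorT A p (c.xT A F α p)

/-- `L^γ_{αk} = h^{σ̄γ} δ_k h_{ασ̄}`. -/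
def Lz (γ α : Fin m) (k : Fin n) (p : TotalSpace (Fin m → ℂ) E) : ℂ :=
  ∑ σ, c.hInv F σ γ p * vecAct (c.deltaz F k p) (fun q => c.h F q α σ)

/-- `C^γ_{αβ} = h^{σ̄γ} ∂̇_β h_{ασ̄}`. -/
def C (γ α β : Fin m) (p : TotalSpace (Fin m → ℂ) E) : ℂ :=
  ∑ σ, c.hInv F σ γ p * vecAct (c.du β p) (fun q => c.h F q α σ)

/-- `L^γ_{αβ} = ρ^k_β L^γ_{αk}`. -/
def LA (γ α β : Fin m) (p : TotalSpace (Fin m → ℂ) E) : ℂ :=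
  ∑ k, c.rho A k β p.1 * c.Lz F γ α k p

end HolChart

variable (n) in
/-- Convexity of a Finsler structure: the matrix `(h_{ασ̄})` is Hermitian positive definite
at every nonzero vector. -/
def IsConvex (F : TotalSpace (Fin m → ℂ) E → ℝ) : Prop :=
  ∀ (c : HolChart n m M E), ∀ p ∈ nonzeroVectors m E, p.1 ∈ c.chart.source → (c.h F p).PosDef

/-! ### Connections -/

variable (n) in
/-- A complex function is `C^∞` (in the real sense) near `p`. -/
def SmoothFunAt (f : TotalSpace (Fin m → ℂ) E → ℂ) (p : TotalSpace (Fin m → ℂ) E) : Prop :=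
  ∀ᶠ q in 𝓝 p, ContMDiffAt (IER n m) 𝓘(ℝ, ℂ) ∞ f q

/-- A section of a complex bundle over `E`, with a local frame attached to each chart, is `C^∞`
near `p`: it is a combination of the vectors of a frame with coefficients `C^∞` near `p`. -/
def SmoothSectionAt {ι : Type} [Fintype ι] {B : TotalSpace (Fin m → ℂ) E → Type*}
    [∀ p, AddCommGroup (B p)] [∀ p, Module ℂ (B p)]
    (frame : HolChart n m M E → ι → ∀ p, B p) (s : ∀ p, B p)
    (p : TotalSpace (Fin m → ℂ) E) : Prop :=
  ∃ c : HolChart n m M E, p.1 ∈ c.chart.source ∧ ∃ a : ι → TotalSpace (Fin m → ℂ) E → ℂ,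
    (∀ i, SmoothFunAt n (a i) p) ∧ ∀ᶠ q in 𝓝 p, s q = ∑ i, a i q • frame c i q

/-- A `C^∞` section of `T_ℂE` near `p`. -/
def SmoothT (s : ∀ p : TotalSpace (Fin m → ℂ) E, ℂ ⊗[ℝ] TangentSpace (IE n m) p)
    (p : TotalSpace (Fin m → ℂ) E) : Prop :=
  SmoothSectionAt (fun c : HolChart n m M E => c.tangentFrame) s p

/-- A `C^∞` section of `VT_ℂE` near `p`. -/
def SmoothV (s : ∀ p : TotalSpace (Fin m → ℂ) E, VertC n p)
    (p : TotalSpace (Fin m → ℂ) E) : Prop :=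
  SmoothSectionAt (fun c : HolChart n m M E => c.verticalFrame) s p

/-- A `C^∞` section of `𝒯_ℂE` near `p`. -/
def SmoothP (s : ∀ p : TotalSpace (Fin m → ℂ) E, Prolongation A p)
    (p : TotalSpace (Fin m → ℂ) E) : Prop :=
  SmoothSectionAt (fun c : HolChart n m M E => c.prolongationFrame A) s p

/-- `D : Γ(Q) × Γ(B) → Γ(B)` is a linear connection over the open set `S ⊆ E`, where the bundle `Q`
of directions acts on functions through the anchor `a : Q → T_ℂE`. As `D` is tensorial in the
direction, `D p X s` is the derivative at `p` of the section `s` in the direction `X ∈ Q p`; it is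
constrained only for sections `s` which are `C^∞` near `p`. (By the Leibniz rule for a function
equal to `1` near `p` and `0` elsewhere, it depends only on the germ of `s`.) -/
structure IsConnectionOn (S : Set (TotalSpace (Fin m → ℂ) E))
    {Q B : TotalSpace (Fin m → ℂ) E → Type*}
    [∀ p, AddCommGroup (Q p)] [∀ p, Module ℂ (Q p)]
    [∀ p, AddCommGroup (B p)] [∀ p, Module ℂ (B p)]
    (a : ∀ p, Q p →ₗ[ℂ] ℂ ⊗[ℝ] TangentSpace (IE n m) p)
    (smoothQ : (∀ p, Q p) → TotalSpace (Fin m → ℂ) E → Prop)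
    (smoothB : (∀ p, B p) → TotalSpace (Fin m → ℂ) E → Prop)
    (D : ∀ p, Q p → (∀ q, B q) → B p) : Prop where
  add_direction : ∀ p ∈ S, ∀ (X Y : Q p) (s : ∀ q, B q), smoothB s p →
    D p (X + Y) s = D p X s + D p Y s
  smul_direction : ∀ p ∈ S, ∀ (l : ℂ) (X : Q p) (s : ∀ q, B q), smoothB s p →
    D p (l • X) s = l • D p X s
  add : ∀ p ∈ S, ∀ (X : Q p) (s t : ∀ q, B q), smoothB s p → smoothB t p →
    D p X (fun q => s q + t q) = D p X s + D p X t
  leibniz : ∀ p ∈ S, ∀ (X : Q p) (f : TotalSpace (Fin m → ℂ) E → ℂ) (s : ∀ q, B q),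
    SmoothFunAt n f p → smoothB s p →
    D p X (fun q => f q • s q) = f p • D p X s + vecAct (a p X) f • s p
  smooth : ∀ p ∈ S, ∀ (X : ∀ q, Q q) (s : ∀ q, B q), smoothQ X p → smoothB s p →
    smoothB (fun q => D q (X q) s) p

/-- `D` preserves the distribution `W`: derivatives of sections of `W` lie in `W`. -/
def Preserves (S : Set (TotalSpace (Fin m → ℂ) E)) {Q B : TotalSpace (Fin m → ℂ) E → Type*}
    (smoothB : (∀ p, B p) → TotalSpace (Fin m → ℂ) E → Prop)
    (D : ∀ p, Q p → (∀ q, B q) → B p) (W : ∀ p, Set (B p)) : Prop :=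
  ∀ p ∈ S, ∀ (X : Q p) (s : ∀ q, B q), smoothB s p → (∀ᶠ q in 𝓝 p, s q ∈ W q) → D p X s ∈ W p

/-- A complex nonlinear connection over `S`: a `C^∞` complex subbundle `H` of `𝒯'E` with
`𝒯'E = H ⊕ V𝒯'E`. -/
structure IsNonlinearConnection (S : Set (TotalSpace (Fin m → ℂ) E))
    (H : ∀ p : TotalSpace (Fin m → ℂ) E, Submodule ℂ (Prolongation A p)) : Prop where
  sup_vertical : ∀ p ∈ S, H p ⊔ holVertical A p = holProlongation A p
  disjoint_vertical : ∀ p ∈ S, Disjoint (H p) (holVertical A p)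
  smooth : ∀ p ∈ S, ∃ Y : Fin m → ∀ q : TotalSpace (Fin m → ℂ) E, Prolongation A q,
    (∀ i, SmoothP A (Y i) p) ∧ ∀ᶠ q in 𝓝 p, H q = Submodule.span ℂ (Set.range fun i => Y i q)

/-- A complex linear connection `𝒟 : Γ(𝒯_ℂE) × Γ(𝒯_ℂE) → Γ(𝒯_ℂE)` over `S` adapted to the nonlinear
connection `H`: it commutes with conjugation and preserves the four distributions of
`𝒯_ℂE = H ⊕ V𝒯'E ⊕ H̄ ⊕ V̄𝒯'E`. -/
structure IsLinearConnectionP (S : Set (TotalSpace (Fin m → ℂ) E))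
    (H : ∀ p : TotalSpace (Fin m → ℂ) E, Submodule ℂ (Prolongation A p))
    (D : ∀ p : TotalSpace (Fin m → ℂ) E, Prolongation A p →
      (∀ q : TotalSpace (Fin m → ℂ) E, Prolongation A q) → Prolongation A p) : Prop where
  connection : IsConnectionOn S (anchorT A) (SmoothP A) (SmoothP A) D
  real : ∀ p ∈ S, ∀ (X : Prolongation A p) (s : ∀ q, Prolongation A q), SmoothP A s p →
    D p (conjT X) (fun q => conjT (s q)) = conjT (D p X s)
  horizontal : Preserves S (SmoothP A) D (fun p => (H p : Set (Prolongation A p)))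
  vertical : Preserves S (SmoothP A) D (fun p => (holVertical A p : Set (Prolongation A p)))
  horizontal_bar : Preserves S (SmoothP A) D (fun p => {w | conjT w ∈ H p})
  vertical_bar : Preserves S (SmoothP A) D (fun p => {w | conjT w ∈ holVertical A p})

/-- A partial linear connection `D : Γ(T_ℂE) × Γ(VT_ℂE) → Γ(VT_ℂE)` over `S`: it commutes with
conjugation and preserves the `(1,0)`- and `(0,1)`-parts of `VT_ℂE`. -/
structure IsVerticalConnection (S : Set (TotalSpace (Fin m → ℂ) E))
    (D : ∀ p : TotalSpace (Fin m → ℂ) E, (ℂ ⊗[ℝ] TangentSpace (IE n m) p) →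
      (∀ q : TotalSpace (Fin m → ℂ) E, VertC n q) → VertC n p) : Prop where
  connection : IsConnectionOn S (fun _ => LinearMap.id) SmoothT SmoothV D
  real : ∀ p ∈ S, ∀ (X : ℂ ⊗[ℝ] TangentSpace (IE n m) p) (s : ∀ q, VertC n q), SmoothV s p →
    D p (conjC X) (fun q => conjV (s q)) = conjV (D p X s)
  vertical : Preserves S SmoothV D (fun p => {w | w.1 ∈ holPart (TangentSpace (IE n m) p)})
  vertical_bar : Preserves S SmoothV D (fun p => {w | w.1 ∈ antiPart (TangentSpace (IE n m) p)})

/-- In every chart, the connection `D` on `𝒯_ℂE` is normal, with coefficients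
`L^γ_{αβ}`, `C^γ_{αβ}`, `L^γ̄_{ᾱβ}` (`L'`) and `C^γ̄_{ᾱβ}` (`C'`) in the adapted frame
`{𝒳_α, 𝒱_α, 𝒳_ᾱ, 𝒱_ᾱ}` of the Chern-Finsler nonlinear connection of `F`; the index order is
`L γ α β` for `L^γ_{αβ}`. The connection is of type `(1,0)` when `L' = C' = 0`. -/
structure HasCoefficientsP (F : TotalSpace (Fin m → ℂ) E → ℝ)
    (S : Set (TotalSpace (Fin m → ℂ) E))
    (D : ∀ p : TotalSpace (Fin m → ℂ) E, Prolongation A p →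
      (∀ q : TotalSpace (Fin m → ℂ) E, Prolongation A q) → Prolongation A p)
    (L C L' C' : HolChart n m M E → Fin m → Fin m → Fin m →
      TotalSpace (Fin m → ℂ) E → ℂ) : Prop where
  horizontal_vertical : ∀ c, ∀ p ∈ S, p.1 ∈ c.chart.source → ∀ α β,
    D p (c.xT A F β p) (c.vT A α) = ∑ γ, L c γ α β p • c.vT A γ p
  vertical_vertical : ∀ c, ∀ p ∈ S, p.1 ∈ c.chart.source → ∀ α β,
    D p (c.vT A β p) (c.vT A α) = ∑ γ, C c γ α β p • c.vT A γ p
  horizontal_horizontal : ∀ c, ∀ p ∈ S, p.1 ∈ c.chart.source → ∀ α β,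
    D p (c.xT A F β p) (c.xT A F α) = ∑ γ, L c γ α β p • c.xT A F γ p
  vertical_horizontal : ∀ c, ∀ p ∈ S, p.1 ∈ c.chart.source → ∀ α β,
    D p (c.vT A β p) (c.xT A F α) = ∑ γ, C c γ α β p • c.xT A F γ p
  horizontal_vertical_bar : ∀ c, ∀ p ∈ S, p.1 ∈ c.chart.source → ∀ α β,
    D p (c.xT A F β p) (fun q => conjT (c.vT A α q)) = ∑ γ, L' c γ α β p • conjT (c.vT A γ p)
  vertical_vertical_bar : ∀ c, ∀ p ∈ S, p.1 ∈ c.chart.source → ∀ α β,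
    D p (c.vT A β p) (fun q => conjT (c.vT A α q)) = ∑ γ, C' c γ α β p • conjT (c.vT A γ p)
  horizontal_horizontal_bar : ∀ c, ∀ p ∈ S, p.1 ∈ c.chart.source → ∀ α β,
    D p (c.xT A F β p) (fun q => conjT (c.xT A F α q)) =
      ∑ γ, L' c γ α β p • conjT (c.xT A F γ p)
  vertical_horizontal_bar : ∀ c, ∀ p ∈ S, p.1 ∈ c.chart.source → ∀ α β,
    D p (c.vT A β p) (fun q => conjT (c.xT A F α q)) =
      ∑ γ, C' c γ α β p • conjT (c.xT A F γ p)

/-- In every chart, the partial connection `D` on `VT_ℂE` has the coefficients `L^γ_{αk}`,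
`C^γ_{αβ}`, `L^γ̄_{ᾱk}` (`L'`) and `C^γ̄_{ᾱβ}` (`C'`) in the directions `δ_k`, `∂̇_β`. -/
structure HasCoefficientsV (F : TotalSpace (Fin m → ℂ) E → ℝ)
    (S : Set (TotalSpace (Fin m → ℂ) E))
    (D : ∀ p : TotalSpace (Fin m → ℂ) E, (ℂ ⊗[ℝ] TangentSpace (IE n m) p) →
      (∀ q : TotalSpace (Fin m → ℂ) E, VertC n q) → VertC n p)
    (L : HolChart n m M E → Fin m → Fin m → Fin n → TotalSpace (Fin m → ℂ) E → ℂ)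
    (C : HolChart n m M E → Fin m → Fin m → Fin m → TotalSpace (Fin m → ℂ) E → ℂ)
    (L' : HolChart n m M E → Fin m → Fin m → Fin n → TotalSpace (Fin m → ℂ) E → ℂ)
    (C' : HolChart n m M E → Fin m → Fin m → Fin m → TotalSpace (Fin m → ℂ) E → ℂ) :
    Prop where
  horizontal : ∀ c, ∀ p ∈ S, p.1 ∈ c.chart.source → ∀ α k,
    D p (c.deltaz F k p) (c.duV α) = ∑ γ, L c γ α k p • c.duV γ p
  vertical : ∀ c, ∀ p ∈ S, p.1 ∈ c.chart.source → ∀ α β,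
    D p (c.du β p) (c.duV α) = ∑ γ, C c γ α β p • c.duV γ p
  horizontal_bar : ∀ c, ∀ p ∈ S, p.1 ∈ c.chart.source → ∀ α k,
    D p (c.deltaz F k p) (fun q => conjV (c.duV α q)) = ∑ γ, L' c γ α k p • conjV (c.duV γ p)
  vertical_bar : ∀ c, ∀ p ∈ S, p.1 ∈ c.chart.source → ∀ α β,
    D p (c.du β p) (fun q => conjV (c.duV α q)) = ∑ γ, C' c γ α β p • conjV (c.duV γ p)

end Main

end FinslerAlgebroid

end

open FinslerAlgebroid Bundle

open scoped ComplexOrder Manifold ContDiff Topology TensorProduct Bundle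

noncomputable section

namespace FinslerAlgebroid

set_option linter.unusedSectionVars false

/-! ### The splitting of a complexification into its (1,0)- and (0,1)-parts. -/

section Complexification

variable {V W : Type*} [AddCommGroup V] [Module ℂ V] [AddCommGroup W] [Module ℂ W]

/-! Over `Ẽ` the matrix `h` is a Hermitian metric on a bundle whose frames change like the `e_α`,
and every connection below comes from its Chern connection. Up to transposition the connection form
is `θ(X) = X'(h) h⁻¹`, where `X'` is the (1,0)-component of `X` (`chernForm`). If `e'_α = T^β_α e_β`
with `T` holomorphic, then `h' = Tᵗ h T̄`, and vectors of type (1,0) kill `T̄`. Differentiating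
therefore gives the gauge law `X(T) + θ(X) T = T θ'(X)` (`chernForm_trans`). Hence `X(s^γ) +
θ^γ_α(X) s^α` is independent of the chart on any bundle whose frames change by `T`; on a conjugate
bundle the conjugate of `θ(X̄)` plays the same role with `T̄` (`blockForm_trans`,
`IsBlockFrame.nabla_eq_nabla`).

It remains to see that both bundles have frames made of blocks of this kind (`IsBlockFrame`). For
`∂̇_α` this holds because fibre coordinates change linearly (`du_eq_sum`). For `𝒳_α` the point is
that the `N^β_α` solve the linear system which says that `δ_α` annihilates all the functions `∂̇_σ̄
F`. Between charts these functions change by the antiholomorphic matrix `T̄`, invisible to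
(1,0)-vectors, so the condition is intrinsic. As `h` is invertible, a (1,0)-vector is determined by
its projection to `M` and its action on the `∂̇_σ̄ F`. Thus `𝒳_α` is the only lift of `e_α` of this
kind, and the `𝒳_α` change by `T` (`xT_trans`). Their span is the nonlinear connection `H`.

The resulting connection acts block by block, so it preserves the four distributions, and it
commutes with conjugation, which permutes the blocks. Evaluating `θ` on `δ_β`, `δ_k` and `∂̇_β`
gives the coefficients `L` and `C`; on conjugate blocks the form vanishes in (1,0)-directions, which
is type (1,0). The identities between `δ_β`, `δ_k` and the two forms of `L` are linearity in the
direction.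

For uniqueness, the Leibniz rule reduces a connection to its values on frame vectors, reality
reduces the directions to those of type (1,0), and there the values are prescribed
(`IsConnectionOn.eq_of_conj`). The connection on `𝒯_ℂE` is induced by the one on `VT_ℂE` because
their vertical blocks carry the same form, evaluated on `ρ_𝒯(X)`. -/

@[simp]
theorem conjC_conjC (x : ℂ ⊗[ℝ] V) : conjC (conjC x) = x := by
  induction x using TensorProduct.induction_on with
  | zero => simp
  | tmul c v => simp [conjC]
  | add a b ha hb => simp only [map_add, ha, hb]

theorem conjC_smul (z : ℂ) (x : ℂ ⊗[ℝ] V) : conjC (z • x) = star z • conjC x := by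
  induction x using TensorProduct.induction_on with
  | zero => simp
  | tmul c v => simp [conjC, TensorProduct.smul_tmul']
  | add a b ha hb => simp only [map_add, smul_add, ha, hb]

/-- The projection of the complexification onto its `(1,0)`-part along its `(0,1)`-part, as a map
to `V`: it sends `c ⊗ v` to `c v`. -/
def holCoeff : (ℂ ⊗[ℝ] V) →ₗ[ℂ] V :=
  LinearMap.liftBaseChange ℂ (LinearMap.id : V →ₗ[ℝ] V)

theorem holCoeff_tmul (z : ℂ) (v : V) : holCoeff (z ⊗ₜ[ℝ] v) = z • v := by
  simp [holCoeff]

theorem hol_apply (v : V) :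
    hol v = (1 / 2 : ℂ) ⊗ₜ[ℝ] v - (Complex.I / 2) ⊗ₜ[ℝ] (Complex.I • v) := rfl

@[simp]
theorem holCoeff_hol (v : V) : holCoeff (hol v) = v := by
  rw [hol_apply, map_sub, holCoeff_tmul, holCoeff_tmul, smul_smul, ← sub_smul]
  have : (1 / 2 - Complex.I / 2 * Complex.I : ℂ) = 1 := by
    rw [div_mul_eq_mul_div, Complex.I_mul_I]; norm_num
  rw [this, one_smul]

theorem conjC_hol (v : V) :
    conjC (hol v) = (1 / 2 : ℂ) ⊗ₜ[ℝ] v + (Complex.I / 2) ⊗ₜ[ℝ] (Complex.I • v) := by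
  rw [hol_apply, map_sub]
  simp [conjC, neg_div, TensorProduct.neg_tmul, Complex.conj_ofNat]

@[simp]
theorem holCoeff_conjC_hol (v : V) : holCoeff (conjC (hol v)) = 0 := by
  rw [conjC_hol, map_add, holCoeff_tmul, holCoeff_tmul, smul_smul, ← add_smul]
  have : (1 / 2 + Complex.I / 2 * Complex.I : ℂ) = 0 := by
    rw [div_mul_eq_mul_div, Complex.I_mul_I]; norm_num
  rw [this, zero_smul]

/-- Decomposition of a complexified vector into its `(1,0)`- and `(0,1)`-components. -/
theorem hol_add_conjC_hol (x : ℂ ⊗[ℝ] V) :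
    hol (holCoeff x) + conjC (hol (holCoeff (conjC x))) = x := by
  induction x using TensorProduct.induction_on with
  | zero => simp
  | tmul c v =>
    have h : conjC (c ⊗ₜ[ℝ] v) = (star c) ⊗ₜ[ℝ] v := by simp [conjC]
    rw [h, holCoeff_tmul, holCoeff_tmul, map_smul, map_smul, conjC_smul, conjC_hol, hol_apply,
      star_star, smul_sub, smul_add]
    simp only [TensorProduct.smul_tmul', smul_eq_mul]
    rw [sub_add_add_cancel, ← TensorProduct.add_tmul]
    congr 1
    ring
  | add a b ha hb =>
    simp only [map_add]
    conv_rhs => rw [← ha, ← hb]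
    abel

theorem hol_injective : Function.Injective (hol : V → ℂ ⊗[ℝ] V) :=
  Function.LeftInverse.injective holCoeff_hol

/-- The (0,1)-component of `x` is the conjugate of the (1,0)-component of its conjugate, so it
vanishes exactly when `holCoeff (conjC x)` does. -/
theorem mem_holPart_iff {x : ℂ ⊗[ℝ] V} : x ∈ holPart V ↔ holCoeff (conjC x) = 0 := by
  constructor
  · rintro ⟨v, rfl⟩
    simp
  · intro h
    refine ⟨holCoeff x, ?_⟩
    conv_rhs => rw [← hol_add_conjC_hol x, h]
    simp

theorem mem_antiPart_iff {x : ℂ ⊗[ℝ] V} : x ∈ antiPart V ↔ holCoeff x = 0 := by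
  constructor
  · intro h
    induction h using Submodule.span_induction with
    | mem x hx => obtain ⟨v, rfl⟩ := hx; simp
    | zero => simp
    | add x y _ _ hx hy => simp [hx, hy]
    | smul a x _ hx => simp [hx]
  · intro h
    have := hol_add_conjC_hol x
    rw [h, map_zero, zero_add] at this
    rw [← this]
    exact Submodule.subset_span ⟨_, rfl⟩

theorem holCoeff_complexify (f : V →ₗ[ℂ] W) (x : ℂ ⊗[ℝ] V) :
    holCoeff (complexify f x) = f (holCoeff x) := by
  induction x using TensorProduct.induction_on with
  | zero => simp
  | tmul c v => simp [complexify, holCoeff_tmul]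
  | add a b ha hb => simp only [map_add, ha, hb]

end Complexification

/-! ### Restriction of scalars for manifold derivatives -/

section RestrictScalars

variable {V H V' H' : Type*} [NormedAddCommGroup V] [NormedSpace ℂ V] [TopologicalSpace H]
  [NormedAddCommGroup V'] [NormedSpace ℂ V'] [TopologicalSpace H']
  {I : ModelWithCorners ℂ V H} {IR : ModelWithCorners ℝ V H}
  {I' : ModelWithCorners ℂ V' H'} {IR' : ModelWithCorners ℝ V' H'}
  {X : Type*} [TopologicalSpace X] [ChartedSpace H X]
  {Y : Type*} [TopologicalSpace Y] [ChartedSpace H' Y]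

/-- `IE` and `IER` are models over different fields with the same underlying maps. Regularity in
charts is therefore a statement about one and the same function, and the three equalities are `rfl`
in every application. -/
theorem contMDiffAt_restrictScalars (h : (I : H → V) = IR) (hs : (I.symm : V → H) = IR.symm)
    (h' : (I' : H' → V') = IR') {k : ℕ∞ω} {f : X → Y} {x : X}
    (hf : ContMDiffAt I I' k f x) : ContMDiffAt IR IR' k f x := by
  rw [contMDiffAt_iff] at hf ⊢
  refine ⟨hf.1, ?_⟩
  have := hf.2.restrict_scalars ℝ
  simp only [extChartAt_coe, extChartAt_coe_symm] at this ⊢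
  rw [← h, ← hs, ← h']
  exact this

theorem hasMFDerivAt_restrictScalars (h : (I : H → V) = IR) (hs : (I.symm : V → H) = IR.symm)
    (h' : (I' : H' → V') = IR') {f : X → Y} {x : X} {f' : V →L[ℂ] V'}
    (hf : HasMFDerivAt I I' f x f') : HasMFDerivAt IR IR' f x (f'.restrictScalars ℝ) := by
  refine ⟨hf.1, ?_⟩
  have := hf.2.restrictScalars ℝ
  simp only [writtenInExtChartAt, extChartAt_coe, extChartAt_coe_symm] at this ⊢
  rw [← h, ← hs, ← h']
  exact this

end RestrictScalars

/-! ### Smooth dependence of the inverse of a matrix on its entries. -/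

section MatrixSmooth

variable {𝕜 : Type*} [NontriviallyNormedField 𝕜] [NormedAlgebra 𝕜 ℂ]
  {ι : Type*} [Fintype ι] [DecidableEq ι]

theorem contDiff_det {k : ℕ∞ω} :
    ContDiff 𝕜 k (fun A : ι → ι → ℂ => (Matrix.of A).det) := by
  simp only [Matrix.det_apply]
  refine ContDiff.sum fun s _ => ContDiff.const_smul _ (contDiff_prod fun i _ => ?_)
  simp only [Matrix.of_apply]
  fun_prop

theorem contDiff_adjugate {k : ℕ∞ω} (i j : ι) :
    ContDiff 𝕜 k (fun A : ι → ι → ℂ => (Matrix.of A).adjugate i j) := by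
  simp only [Matrix.adjugate_apply]
  let f : (ι → ι → ℂ) → ι → ι → ℂ := fun A a b => (Matrix.of A).updateRow j (Pi.single i 1) a b
  have hf : ContDiff 𝕜 k f := ?_
  · exact (contDiff_det (𝕜 := 𝕜)).comp hf
  refine contDiff_pi.2 fun a => contDiff_pi.2 fun b => ?_
  simp only [f]
  by_cases h : a = j
  · subst h
    simpa using contDiff_const
  · simp only [Matrix.updateRow_ne h, Matrix.of_apply]
    fun_prop

/-- Cramer's rule: the determinant and the adjugate are polynomial in the entries. The field is left
free because the frame coefficients need the holomorphic version and the inverse of `h` the real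
one. -/
theorem contDiffAt_matrix_inv {k : ℕ∞ω} (i j : ι) {A : ι → ι → ℂ}
    (hA : (Matrix.of A).det ≠ 0) :
    ContDiffAt 𝕜 k (fun B : ι → ι → ℂ => (Matrix.of B)⁻¹ i j) A := by
  simp only [Matrix.inv_def, Matrix.smul_apply, Ring.inverse_eq_inv', smul_eq_mul]
  exact ((contDiff_det (𝕜 := 𝕜)).contDiffAt.inv hA).mul (contDiff_adjugate i j).contDiffAt

end MatrixSmooth

section Main

variable {n m : ℕ}
  {M : Type*} [TopologicalSpace M] [ChartedSpace (Fin n → ℂ) M] [IsManifold (IM n) ω M]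
  {E : M → Type*} [∀ x, AddCommGroup (E x)] [∀ x, Module ℂ (E x)]
  [TopologicalSpace (TotalSpace (Fin m → ℂ) E)] [∀ x, TopologicalSpace (E x)]
  [FiberBundle (Fin m → ℂ) E] [VectorBundle ℂ (Fin m → ℂ) E]
  [ContMDiffVectorBundle ω (Fin m → ℂ) E (IM n)]

/-! ### The action of complexified tangent vectors on functions -/

/-- A complex function on the total space is real differentiable at a point. -/
abbrev RealDiffAt (n : ℕ) {m : ℕ} {M : Type*} [TopologicalSpace M] [ChartedSpace (Fin n → ℂ) M]
    {E : M → Type*} [∀ x, AddCommGroup (E x)] [∀ x, Module ℂ (E x)]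
    [TopologicalSpace (TotalSpace (Fin m → ℂ) E)] [∀ x, TopologicalSpace (E x)]
    [FiberBundle (Fin m → ℂ) E]
    (f : TotalSpace (Fin m → ℂ) E → ℂ) (p : TotalSpace (Fin m → ℂ) E) : Prop :=
  MDifferentiableAt (IER n m) 𝓘(ℝ, ℂ) f p

/-- The real differential of a complex function on the total space. -/
def realDiff (f : TotalSpace (Fin m → ℂ) E → ℂ) (p : TotalSpace (Fin m → ℂ) E) :
    TangentSpace (IE n m) p →ₗ[ℝ] ℂ where
  toFun v := (show ℂ from mfderiv (IER n m) 𝓘(ℝ, ℂ) f p v)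
  map_add' v w := map_add (mfderiv (IER n m) 𝓘(ℝ, ℂ) f p) v w
  map_smul' r v := map_smul (mfderiv (IER n m) 𝓘(ℝ, ℂ) f p) r v

/-- `vecAct` as a linear form in the vector. -/
def vecActLin (f : TotalSpace (Fin m → ℂ) E → ℂ) (p : TotalSpace (Fin m → ℂ) E) :
    (ℂ ⊗[ℝ] TangentSpace (IE n m) p) →ₗ[ℂ] ℂ :=
  LinearMap.liftBaseChange ℂ (realDiff f p)

section VecAct

variable {p : TotalSpace (Fin m → ℂ) E} {f g : TotalSpace (Fin m → ℂ) E → ℂ}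
  (X Y : ℂ ⊗[ℝ] TangentSpace (IE n m) p)

theorem vecAct_eq (f : TotalSpace (Fin m → ℂ) E → ℂ) : vecAct X f = vecActLin f p X := rfl

theorem vecAct_tmul (z : ℂ) (v : TangentSpace (IE n m) p)
    (f : TotalSpace (Fin m → ℂ) E → ℂ) : vecAct (z ⊗ₜ[ℝ] v) f = z * realDiff f p v := by
  simp [vecAct_eq, vecActLin]

theorem vecAct_add (f : TotalSpace (Fin m → ℂ) E → ℂ) :
    vecAct (X + Y) f = vecAct X f + vecAct Y f := map_add (vecActLin f p) X Y

theorem vecAct_sub (f : TotalSpace (Fin m → ℂ) E → ℂ) :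
    vecAct (X - Y) f = vecAct X f - vecAct Y f := map_sub (vecActLin f p) X Y

theorem vecAct_smul (z : ℂ) (f : TotalSpace (Fin m → ℂ) E → ℂ) :
    vecAct (z • X) f = z * vecAct X f := map_smul (vecActLin f p) z X

theorem vecAct_zero (f : TotalSpace (Fin m → ℂ) E → ℂ) :
    vecAct (0 : ℂ ⊗[ℝ] TangentSpace (IE n m) p) f = 0 := map_zero (vecActLin f p)

theorem vecAct_sum {ι : Type*} (s : Finset ι) (X : ι → ℂ ⊗[ℝ] TangentSpace (IE n m) p)
    (f : TotalSpace (Fin m → ℂ) E → ℂ) :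
    vecAct (∑ i ∈ s, X i) f = ∑ i ∈ s, vecAct (X i) f := map_sum (vecActLin f p) X s

theorem vecAct_hol (v : TangentSpace (IE n m) p) (f : TotalSpace (Fin m → ℂ) E → ℂ) :
    vecAct (hol v) f = (realDiff f p v - Complex.I * realDiff f p (Complex.I • v)) / 2 := by
  rw [hol_apply, vecAct_sub, vecAct_tmul, vecAct_tmul]
  ring

theorem vecAct_conjC_hol (v : TangentSpace (IE n m) p) (f : TotalSpace (Fin m → ℂ) E → ℂ) :
    vecAct (conjC (hol v)) f =
      (realDiff f p v + Complex.I * realDiff f p (Complex.I • v)) / 2 := by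
  rw [conjC_hol, vecAct_add, vecAct_tmul, vecAct_tmul]
  ring

theorem realDiff_of_hasMFDerivAt {f' : (Fin n → ℂ) × (Fin m → ℂ) →L[ℝ] ℂ}
    (h : HasMFDerivAt (IER n m) 𝓘(ℝ, ℂ) f p f') (v : TangentSpace (IE n m) p) :
    realDiff f p v = f' v :=
  congrArg (fun L : (Fin n → ℂ) × (Fin m → ℂ) →L[ℝ] ℂ => L v) h.mfderiv

theorem realDiff_congr (h : f =ᶠ[𝓝 p] g) : realDiff (n := n) f p = realDiff g p := by
  ext v
  exact congrArg (fun L : (Fin n → ℂ) × (Fin m → ℂ) →L[ℝ] ℂ => L v)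
    (h.mfderiv_eq (I := IER n m) (I' := 𝓘(ℝ, ℂ)))

theorem vecAct_congr (h : f =ᶠ[𝓝 p] g) : vecAct X f = vecAct X g := by
  rw [vecAct_eq, vecAct_eq, vecActLin, vecActLin, realDiff_congr h]

theorem vecAct_const (z : ℂ) : vecAct X (fun _ => z) = 0 := by
  have : realDiff (fun _ => z) p = (0 : TangentSpace (IE n m) p →ₗ[ℝ] ℂ) := by
    ext v
    exact realDiff_of_hasMFDerivAt (hasMFDerivAt_const z p) v
  rw [vecAct_eq, vecActLin, this]
  simp

/-- Both sides are ℂ-linear in `X`, so pure tensors suffice. This is the common source of the sum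
and product rules for complexified vectors. -/
theorem vecActLin_eq_of_realDiff {a b : ℂ} {k : TotalSpace (Fin m → ℂ) E → ℂ}
    (h : ∀ v : TangentSpace (IE n m) p, realDiff k p v = a * realDiff f p v + b * realDiff g p v) :
    vecAct X k = a * vecAct X f + b * vecAct X g := by
  induction X using TensorProduct.induction_on with
  | zero => simp [vecAct_zero]
  | tmul z v => rw [vecAct_tmul, vecAct_tmul, vecAct_tmul, h]; ring
  | add x y hx hy => rw [vecAct_add, vecAct_add, vecAct_add, hx, hy]; ring

theorem vecAct_fun_add (hf : RealDiffAt n f p) (hg : RealDiffAt n g p) :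
    vecAct X (fun q => f q + g q) = vecAct X f + vecAct X g := by
  have h := vecActLin_eq_of_realDiff (a := 1) (b := 1) (f := f) (g := g)
    (k := fun q => f q + g q) X fun v => by
      rw [realDiff_of_hasMFDerivAt (f := fun q => f q + g q)
        (hf.hasMFDerivAt.add hg.hasMFDerivAt) v, one_mul, one_mul]
      rfl
  simpa using h

theorem vecAct_fun_mul (hf : RealDiffAt n f p) (hg : RealDiffAt n g p) :
    vecAct X (fun q => f q * g q) = f p * vecAct X g + g p * vecAct X f := by
  refine vecActLin_eq_of_realDiff X fun v => ?_
  rw [realDiff_of_hasMFDerivAt (f := fun q => f q * g q)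
    (hf.hasMFDerivAt.mul hg.hasMFDerivAt) v]
  rfl

theorem RealDiffAt.mul (hf : RealDiffAt n f p) (hg : RealDiffAt n g p) :
    RealDiffAt n (fun q => f q * g q) p :=
  MDifferentiableAt.mul hf hg

theorem RealDiffAt.sum {ι : Type*} {s : Finset ι} {f : ι → TotalSpace (Fin m → ℂ) E → ℂ}
    (hf : ∀ i ∈ s, RealDiffAt n (f i) p) : RealDiffAt n (fun q => ∑ i ∈ s, f i q) p := by
  classical
  induction s using Finset.induction_on with
  | empty => simpa using mdifferentiableAt_const
  | insert a s ha ih =>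
    simp only [Finset.sum_insert ha]
    exact (hf a (by simp)).add (ih fun i hi => hf i (by simp [hi]))

theorem vecAct_fun_sum {ι : Type*} (s : Finset ι) {f : ι → TotalSpace (Fin m → ℂ) E → ℂ}
    (hf : ∀ i ∈ s, RealDiffAt n (f i) p) :
    vecAct X (fun q => ∑ i ∈ s, f i q) = ∑ i ∈ s, vecAct X (f i) := by
  classical
  induction s using Finset.induction_on with
  | empty => simpa using vecAct_const X 0
  | insert a s ha ih =>
    simp only [Finset.sum_insert ha]
    rw [vecAct_fun_add X (hf a (by simp)) (RealDiffAt.sum fun i hi => hf i (by simp [hi])),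
      ih fun i hi => hf i (by simp [hi])]

theorem hasMFDerivAt_star (hf : RealDiffAt n f p) :
    HasMFDerivAt (IER n m) 𝓘(ℝ, ℂ) (fun q => star (f q)) p
      ((Complex.conjCLE : ℂ →L[ℝ] ℂ).comp
        (mfderiv (IER n m) 𝓘(ℝ, ℂ) f p : (Fin n → ℂ) × (Fin m → ℂ) →L[ℝ] ℂ)) :=
  HasMFDerivAt.comp p (g := fun z : ℂ => star z) (I' := 𝓘(ℝ, ℂ))
    (Complex.conjCLE.hasFDerivAt (x := f p)).hasMFDerivAt hf.hasMFDerivAt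

theorem RealDiffAt.star (hf : RealDiffAt n f p) : RealDiffAt n (fun q => star (f q)) p :=
  (hasMFDerivAt_star hf).mdifferentiableAt

theorem realDiff_star (hf : RealDiffAt n f p) (v : TangentSpace (IE n m) p) :
    realDiff (fun q => star (f q)) p v = star (realDiff f p v) :=
  realDiff_of_hasMFDerivAt (hasMFDerivAt_star hf) v

/-- Conjugation is real linear, so it commutes with the real differential; only the scalar factor of
the tensor is affected. -/
theorem vecAct_conjC_star (hf : RealDiffAt n f p) :
    vecAct (conjC X) (fun q => star (f q)) = star (vecAct X f) := by
  induction X using TensorProduct.induction_on with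
  | zero => simp [vecAct_zero]
  | tmul z v =>
    have h : conjC (z ⊗ₜ[ℝ] v) = (star z) ⊗ₜ[ℝ] v := by simp [conjC]
    rw [h, vecAct_tmul, vecAct_tmul, realDiff_star hf, star_mul']
  | add x y hx hy => rw [map_add, vecAct_add, vecAct_add, hx, hy, star_add]

theorem vecAct_conjC (hf : RealDiffAt n f p) :
    vecAct (conjC X) f = star (vecAct X (fun q => star (f q))) := by
  rw [← vecAct_conjC_star X hf.star]
  simp

theorem vecAct_star (hf : RealDiffAt n f p) :
    vecAct X (fun q => star (f q)) = star (vecAct (conjC X) f) := by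
  rw [← vecAct_conjC_star _ hf, conjC_conjC]

end VecAct

section Holomorphic

variable {p : TotalSpace (Fin m → ℂ) E} {f : TotalSpace (Fin m → ℂ) E → ℂ}

theorem hasMFDerivAt_real (hf : MDifferentiableAt (IE n m) 𝓘(ℂ, ℂ) f p) :
    HasMFDerivAt (IER n m) 𝓘(ℝ, ℂ) f p
      ((mfderiv (IE n m) 𝓘(ℂ, ℂ) f p :
        (Fin n → ℂ) × (Fin m → ℂ) →L[ℂ] ℂ).restrictScalars ℝ) :=
  hasMFDerivAt_restrictScalars (I := IE n m) (I' := 𝓘(ℂ, ℂ)) rfl rfl rfl hf.hasMFDerivAt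

theorem realDiffAt_of_holomorphic (hf : MDifferentiableAt (IE n m) 𝓘(ℂ, ℂ) f p) :
    RealDiffAt n f p := (hasMFDerivAt_real hf).mdifferentiableAt

/-- The Cauchy-Riemann equations: the real differential of a holomorphic function is its complex
differential with scalars restricted. -/
theorem realDiff_I_smul (hf : MDifferentiableAt (IE n m) 𝓘(ℂ, ℂ) f p)
    (v : TangentSpace (IE n m) p) :
    realDiff f p (Complex.I • v) = Complex.I * realDiff f p v := by
  rw [realDiff_of_hasMFDerivAt (hasMFDerivAt_real hf),
    realDiff_of_hasMFDerivAt (hasMFDerivAt_real hf)]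
  exact map_smul (mfderiv (IE n m) 𝓘(ℂ, ℂ) f p :
        (Fin n → ℂ) × (Fin m → ℂ) →L[ℂ] ℂ) Complex.I v

theorem vecAct_conjC_hol_of_holomorphic (hf : MDifferentiableAt (IE n m) 𝓘(ℂ, ℂ) f p)
    (v : TangentSpace (IE n m) p) : vecAct (conjC (hol v)) f = 0 := by
  rw [vecAct_conjC_hol, realDiff_I_smul hf, ← mul_assoc, Complex.I_mul_I]
  ring

/-- This is what makes the metric `h` and the horizontal lift independent of the chart: applied to
the transition functions, it says that their conjugates behave as constants for (1,0)-vectors. -/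
theorem vecAct_hol_star_of_holomorphic (hf : MDifferentiableAt (IE n m) 𝓘(ℂ, ℂ) f p)
    (v : TangentSpace (IE n m) p) : vecAct (hol v) (fun q => star (f q)) = 0 := by
  rw [vecAct_star _ (realDiffAt_of_holomorphic hf), vecAct_conjC_hol_of_holomorphic hf, star_zero]

end Holomorphic

/-! ### Smooth functions -/

section SmoothFun

variable {p : TotalSpace (Fin m → ℂ) E} {f g : TotalSpace (Fin m → ℂ) E → ℂ}

theorem SmoothFunAt.contMDiffAt (h : SmoothFunAt n f p) :
    ContMDiffAt (IER n m) 𝓘(ℝ, ℂ) ∞ f p := h.self_of_nhds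

theorem SmoothFunAt.realDiffAt (h : SmoothFunAt n f p) : RealDiffAt n f p :=
  h.contMDiffAt.mdifferentiableAt (by simp)

theorem SmoothFunAt.eventually (h : SmoothFunAt n f p) : ∀ᶠ q in 𝓝 p, SmoothFunAt n f q :=
  eventually_eventually_nhds.2 h

theorem SmoothFunAt.congr (h : SmoothFunAt n f p) (hg : g =ᶠ[𝓝 p] f) : SmoothFunAt n g p := by
  filter_upwards [h, hg.eventually_nhds] with q hq hgq
  exact hq.congr_of_eventuallyEq hgq

theorem smoothFunAt_const (z : ℂ) : SmoothFunAt n (fun _ : TotalSpace (Fin m → ℂ) E => z) p :=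
  Filter.Eventually.of_forall fun _ => contMDiffAt_const

theorem SmoothFunAt.add (hf : SmoothFunAt n f p) (hg : SmoothFunAt n g p) :
    SmoothFunAt n (fun q => f q + g q) p := by
  filter_upwards [hf, hg] with q hq hq'
  exact hq.add hq'

theorem SmoothFunAt.mul (hf : SmoothFunAt n f p) (hg : SmoothFunAt n g p) :
    SmoothFunAt n (fun q => f q * g q) p := by
  filter_upwards [hf, hg] with q hq hq'
  have h : ContDiff ℝ ∞ (fun z : ℂ × ℂ => z.1 * z.2) := contDiff_fst.mul contDiff_snd
  exact h.contMDiff.contMDiffAt.comp q (hq.prodMk_space hq')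

theorem SmoothFunAt.neg (hf : SmoothFunAt n f p) : SmoothFunAt n (fun q => - f q) p := by
  filter_upwards [hf] with q hq
  exact hq.neg

theorem SmoothFunAt.sum {ι : Type*} {s : Finset ι} {f : ι → TotalSpace (Fin m → ℂ) E → ℂ}
    (hf : ∀ i ∈ s, SmoothFunAt n (f i) p) : SmoothFunAt n (fun q => ∑ i ∈ s, f i q) p := by
  classical
  induction s using Finset.induction_on with
  | empty => simpa using smoothFunAt_const 0
  | insert a s ha ih =>
    simp only [Finset.sum_insert ha]
    exact (hf a (by simp)).add (ih fun i hi => hf i (by simp [hi]))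

theorem SmoothFunAt.star (hf : SmoothFunAt n f p) : SmoothFunAt n (fun q => star (f q)) p := by
  filter_upwards [hf] with q hq
  have h : ContMDiff 𝓘(ℝ, ℂ) 𝓘(ℝ, ℂ) ∞ (fun z : ℂ => Star.star z) :=
    (Complex.conjCLE : ℂ ≃L[ℝ] ℂ).contDiff.contMDiff
  exact h.contMDiffAt.comp q hq

theorem smoothFunAt_of_holomorphic
    (hf : ∀ᶠ q in 𝓝 p, ContMDiffAt (IE n m) 𝓘(ℂ, ℂ) ω f q) : SmoothFunAt n f p := by
  filter_upwards [hf] with q hq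
  exact (contMDiffAt_restrictScalars (I := IE n m) (I' := 𝓘(ℂ, ℂ)) (IR := IER n m)
    (IR' := 𝓘(ℝ, ℂ)) rfl rfl rfl hq).of_le (by exact_mod_cast le_top)

theorem SmoothFunAt.matrix_inv {ι : Type*} [Fintype ι] [DecidableEq ι]
    {a : ι → ι → TotalSpace (Fin m → ℂ) E → ℂ} (ha : ∀ i j, SmoothFunAt n (a i j) p)
    (hdet : ∀ᶠ q in 𝓝 p, (Matrix.of fun i j => a i j q).det ≠ 0) (i j : ι) :
    SmoothFunAt n (fun q => (Matrix.of fun i j => a i j q)⁻¹ i j) p := by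
  have h : ∀ᶠ q in 𝓝 p, ∀ i j, ContMDiffAt (IER n m) 𝓘(ℝ, ℂ) ∞ (a i j) q :=
    Filter.eventually_all.2 fun i => Filter.eventually_all.2 fun j => ha i j
  filter_upwards [h, hdet] with q hq hd
  have h1 : ContMDiffAt (IER n m) 𝓘(ℝ, ι → ι → ℂ) ∞ (fun q i j => a i j q) q :=
    contMDiffAt_pi_space.2 fun i => contMDiffAt_pi_space.2 fun j => hq i j
  exact (contDiffAt_matrix_inv (𝕜 := ℝ) (k := ∞) i j hd).contMDiffAt.comp q h1

end SmoothFun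

/-! ### Smoothness of the coordinates -/

theorem eventually_mem_base {s : Set M} (hs : IsOpen s) {p : TotalSpace (Fin m → ℂ) E}
    (hp : p.1 ∈ s) : ∀ᶠ q in 𝓝 p, q.1 ∈ s :=
  (FiberBundle.continuous_proj (Fin m → ℂ) E).continuousAt.eventually (hs.mem_nhds hp)

namespace HolChart

variable (c : HolChart n m M E) {p : TotalSpace (Fin m → ℂ) E}

theorem sum_coeff {x : M} (hx : x ∈ c.chart.source) (v : E x) :
    ∑ α, c.isFrame.coeff α x v • c.frame α x = v := by
  simpa [IsLocalFrameOn.coeff, hx] using (c.isFrame.toBasisAt hx).sum_repr v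

theorem coeff_sum {x : M} (hx : x ∈ c.chart.source) (w : Fin m → ℂ) (β : Fin m) :
    c.isFrame.coeff β x (∑ α, w α • c.frame α x) = w β := by
  have h : ∑ α, w α • c.frame α x = (c.isFrame.toBasisAt hx).equivFun.symm w := by
    simp [Module.Basis.equivFun_symm_apply]
  rw [h, IsLocalFrameOn.coeff, dif_pos hx, Module.Basis.coord_apply,
    ← Module.Basis.equivFun_apply, LinearEquiv.apply_symm_apply]

/-- In a trivialization the fibre coordinate is `P u`, where the columns of `P` are the trivialized
frame vectors. `P` depends holomorphically on the base point and is invertible, so `u = P⁻¹ (P u)`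
is holomorphic as well. -/
theorem contMDiffAt_coeff (hp : p.1 ∈ c.chart.source) (β : Fin m) :
    ContMDiffAt (IE n m) 𝓘(ℂ, ℂ) ω
      (fun q : TotalSpace (Fin m → ℂ) E => c.isFrame.coeff β q.1 q.2) p := by
  set e := trivializationAt (Fin m → ℂ) E p.1 with he
  have hpe : p.1 ∈ e.baseSet := FiberBundle.mem_baseSet_trivializationAt' _
  let P : TotalSpace (Fin m → ℂ) E → Fin m → Fin m → ℂ :=
    fun q i j => (e ⟨q.1, c.frame j q.1⟩).2 i
  have hproj : ContMDiffAt (IE n m) (IM n) ω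
      (TotalSpace.proj : TotalSpace (Fin m → ℂ) E → M) p :=
    (contMDiff_proj E).contMDiffAt
  have hframe : ∀ α, ContMDiffAt (IM n) 𝓘(ℂ, Fin m → ℂ) ω
      (fun x => (e ⟨x, c.frame α x⟩).2) p.1 := by
    intro α
    have h1 : ContMDiffAt (IM n) (IE n m) ω
        (fun y => (⟨y, c.frame α y⟩ : TotalSpace (Fin m → ℂ) E)) p.1 :=
      (c.isFrame.contMDiffOn α).contMDiffAt (c.chart.open_source.mem_nhds hp)
    exact (Bundle.contMDiffAt_totalSpace.1 h1).2
  have hP : ContMDiffAt (IE n m) 𝓘(ℂ, Fin m → Fin m → ℂ) ω P p := by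
    refine contMDiffAt_pi_space.2 fun i => contMDiffAt_pi_space.2 fun j => ?_
    exact contMDiffAt_pi_space.1 (ContMDiffAt.comp p (g := fun x => (e ⟨x, c.frame j x⟩).2)
      (f := TotalSpace.proj) (hframe j) hproj) i
  have hu : ContMDiffAt (IE n m) 𝓘(ℂ, Fin m → ℂ) ω
      (fun q : TotalSpace (Fin m → ℂ) E => (e q).2) p :=
    (Bundle.contMDiffAt_totalSpace.1 (contMDiffAt_id (I := IE n m) (x := p))).2
  have hlin : ∀ {x : M} (_ : x ∈ e.baseSet) (w : E x),
      (e ⟨x, w⟩).2 = e.linearMapAt ℂ x w := by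
    intro x hx w
    rw [Bundle.Trivialization.linearMapAt_apply, if_pos hx]
  have key : ∀ q : TotalSpace (Fin m → ℂ) E, q.1 ∈ e.baseSet → q.1 ∈ c.chart.source →
      (e q).2 = (Matrix.of (P q)).mulVec (fun α => c.isFrame.coeff α q.1 q.2) := by
    intro q hq hqc
    have h1 : (e q).2 = e.linearMapAt ℂ q.1 q.2 := hlin hq q.2
    rw [h1, ← congrArg (e.linearMapAt ℂ q.1) (c.sum_coeff hqc q.2), map_sum]
    have h2 : ∀ α, e.linearMapAt ℂ q.1 (c.isFrame.coeff α q.1 q.2 • c.frame α q.1) =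
        c.isFrame.coeff α q.1 q.2 • (e ⟨q.1, c.frame α q.1⟩).2 := fun α => by
      rw [map_smul, hlin hq]
    ext i
    simp only [h2, Matrix.mulVec, dotProduct, P, Matrix.of_apply,
      Finset.sum_apply, Pi.smul_apply, smul_eq_mul]
    exact Finset.sum_congr rfl fun _ _ => mul_comm _ _
  have hdet : ∀ q : TotalSpace (Fin m → ℂ) E, q.1 ∈ e.baseSet → q.1 ∈ c.chart.source →
      (Matrix.of (P q)).det ≠ 0 := by
    intro q hq hqc h0
    -- A kernel vector `w` of `P` would give a point with coordinates `w ≠ 0` but with zero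
    -- trivialization, hence the zero vector.
    obtain ⟨w, hw, hw0⟩ := Matrix.exists_mulVec_eq_zero_iff.2 h0
    have h2 := key ⟨q.1, ∑ α, w α • c.frame α q.1⟩ hq hqc
    simp only [c.coeff_sum hqc] at h2
    -- `P` depends only on the base point, so the matrix at the new point is the old one by
    -- definition.
    have h3 : Matrix.mulVec (Matrix.of (P ⟨q.1, ∑ α, w α • c.frame α q.1⟩)) w = 0 := hw0
    rw [h3, hlin hq] at h2
    have h4 : ∑ α, w α • c.frame α q.1 = 0 := by
      have := (e.continuousLinearEquivAt ℂ q.1 hq).injective (a₁ := ∑ α, w α • c.frame α q.1)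
        (a₂ := 0)
      apply this
      rw [map_zero, ← h2, Bundle.Trivialization.linearMapAt_apply, if_pos hq]
      rfl
    apply hw
    ext β
    rw [← c.coeff_sum hqc w β, h4, map_zero]
    rfl
  have hinv : ContMDiffAt (IE n m) 𝓘(ℂ, ℂ) ω
      (fun q => ∑ j, (Matrix.of (P q))⁻¹ β j * (e q).2 j) p := by
    refine ContMDiffAt.sum fun j _ => ContMDiffAt.mul ?_ (contMDiffAt_pi_space.1 hu j)
    exact (contDiffAt_matrix_inv (𝕜 := ℂ) β j (hdet p hpe hp)).contMDiffAt.comp p hP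
  refine hinv.congr_of_eventuallyEq ?_
  filter_upwards [eventually_mem_base e.open_baseSet hpe,
    eventually_mem_base c.chart.open_source hp] with q hq hqc
  have h5 : (Matrix.of (P q))⁻¹.mulVec (e q).2 = fun α => c.isFrame.coeff α q.1 q.2 := by
    rw [key q hq hqc, Matrix.mulVec_mulVec, Matrix.nonsing_inv_mul _ (hdet q hq hqc).isUnit,
      Matrix.one_mulVec]
  exact (congrFun h5 β).symm

theorem contMDiffAt_coord (hp : p.1 ∈ c.chart.source) :
    ContMDiffAt (IE n m) 𝓘(ℂ, (Fin n → ℂ) × (Fin m → ℂ)) ω c.coord p := by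
  have hproj : ContMDiffAt (IE n m) (IM n) ω
      (TotalSpace.proj : TotalSpace (Fin m → ℂ) E → M) p :=
    (contMDiff_proj E).contMDiffAt
  have h1 : ContMDiffAt (IE n m) 𝓘(ℂ, Fin n → ℂ) ω
      (fun q : TotalSpace (Fin m → ℂ) E => c.chart q.1) p :=
    ContMDiffAt.comp p (g := c.chart) (f := TotalSpace.proj)
      (contMDiffAt_of_mem_maximalAtlas c.chart_mem hp) hproj
  exact h1.prodMk_space (contMDiffAt_pi_space.2 fun β => c.contMDiffAt_coeff hp β)

/-- Differentiability of `param` is enough to define `coordVec`; full regularity is needed to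
differentiate a function in coordinates repeatedly. -/
theorem contMDiffAt_param {x : M} (hx : x ∈ c.chart.source) (u : Fin m → ℂ) :
    ContMDiffAt 𝓘(ℂ, (Fin n → ℂ) × (Fin m → ℂ)) (IE n m) ω c.param (c.chart x, u) := by
  have hsymm : ContMDiffAt 𝓘(ℂ, Fin n → ℂ) (IM n) ω c.chart.symm (c.chart x) :=
    contMDiffAt_symm_of_mem_maximalAtlas c.chart_mem (c.chart.map_source hx)
  have hfst : ContMDiffAt 𝓘(ℂ, (Fin n → ℂ) × (Fin m → ℂ)) 𝓘(ℂ, Fin n → ℂ) ω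
      (Prod.fst : (Fin n → ℂ) × (Fin m → ℂ) → _) (c.chart x, u) :=
    contDiff_fst.contMDiff.contMDiffAt
  have hbase : ContMDiffAt 𝓘(ℂ, (Fin n → ℂ) × (Fin m → ℂ)) (IM n) ω
      (fun y : (Fin n → ℂ) × (Fin m → ℂ) => c.chart.symm y.1) (c.chart x, u) :=
    ContMDiffAt.comp (c.chart x, u) (g := c.chart.symm) (f := Prod.fst) hsymm hfst
  rw [Bundle.contMDiffAt_totalSpace]
  refine ⟨hbase, ?_⟩
  have hxs : c.chart.symm (c.chart x) = x := c.chart.left_inv hx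
  simp only [param]
  set e := trivializationAt (Fin m → ℂ) E (c.chart.symm (c.chart x)) with he
  have hframe : ∀ α, ContMDiffAt 𝓘(ℂ, (Fin n → ℂ) × (Fin m → ℂ)) 𝓘(ℂ, Fin m → ℂ) ω
      (fun y : (Fin n → ℂ) × (Fin m → ℂ) =>
        (e ⟨c.chart.symm y.1, c.frame α (c.chart.symm y.1)⟩).2) (c.chart x, u) := by
    intro α
    have h1 : ContMDiffAt (IM n) (IE n m) ω
        (fun y => (⟨y, c.frame α y⟩ : TotalSpace (Fin m → ℂ) E)) (c.chart.symm (c.chart x)) :=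
      (c.isFrame.contMDiffOn α).contMDiffAt
        (c.chart.open_source.mem_nhds (by rw [hxs]; exact hx))
    exact ContMDiffAt.comp (c.chart x, u)
      (g := fun y => (e ⟨y, c.frame α y⟩).2) (f := fun y => c.chart.symm y.1)
      (Bundle.contMDiffAt_totalSpace.1 h1).2 hbase
  have hsum : ContMDiffAt 𝓘(ℂ, (Fin n → ℂ) × (Fin m → ℂ)) 𝓘(ℂ, Fin m → ℂ) ω
      (fun y : (Fin n → ℂ) × (Fin m → ℂ) => ∑ α, y.2 α •
        (e ⟨c.chart.symm y.1, c.frame α (c.chart.symm y.1)⟩).2) (c.chart x, u) := by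
    refine ContMDiffAt.sum fun α _ => ?_
    have h1 : ContDiff ℂ ω (fun y : (Fin n → ℂ) × (Fin m → ℂ) => y.2 α) := by fun_prop
    exact ContMDiffAt.smul h1.contMDiff.contMDiffAt (hframe α)
  refine hsum.congr_of_eventuallyEq ?_
  have hmem : ∀ᶠ y in 𝓝 ((c.chart x, u) : (Fin n → ℂ) × (Fin m → ℂ)),
      c.chart.symm y.1 ∈ e.baseSet :=
    hbase.continuousAt.eventually
      (e.open_baseSet.mem_nhds (FiberBundle.mem_baseSet_trivializationAt' _))
  filter_upwards [hmem] with y hy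
  have hlin : ∀ w : E (c.chart.symm y.1),
      (e ⟨c.chart.symm y.1, w⟩).2 = e.linearMapAt ℂ (c.chart.symm y.1) w := by
    intro w
    rw [Bundle.Trivialization.linearMapAt_apply, if_pos hy]
  simp only [hlin, map_sum, map_smul]

theorem coord_param {y : (Fin n → ℂ) × (Fin m → ℂ)} (hy : y.1 ∈ c.chart.target) :
    c.coord (c.param y) = y := by
  have hs : c.chart.symm y.1 ∈ c.chart.source := c.chart.map_target hy
  ext i
  · simp [coord, param, c.chart.right_inv hy]
  · exact c.coeff_sum hs y.2 i

/-- The differential of the coordinates at a point, a left and right inverse of `coordVec`. -/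
def coordDiff (p : TotalSpace (Fin m → ℂ) E) :
    TangentSpace (IE n m) p →ₗ[ℂ] (Fin n → ℂ) × (Fin m → ℂ) :=
  (mfderiv (IE n m) 𝓘(ℂ, (Fin n → ℂ) × (Fin m → ℂ)) c.coord p :
    (Fin n → ℂ) × (Fin m → ℂ) →L[ℂ] (Fin n → ℂ) × (Fin m → ℂ)).toLinearMap

/-- `coordVec` as a linear map. -/
def coordVecLin (p : TotalSpace (Fin m → ℂ) E) :
    (Fin n → ℂ) × (Fin m → ℂ) →ₗ[ℂ] TangentSpace (IE n m) p :=
  (mfderiv 𝓘(ℂ, (Fin n → ℂ) × (Fin m → ℂ)) (IE n m) c.param (c.coord p) :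
    (Fin n → ℂ) × (Fin m → ℂ) →L[ℂ] (Fin n → ℂ) × (Fin m → ℂ)).toLinearMap

theorem coordVec_eq (w : (Fin n → ℂ) × (Fin m → ℂ)) : c.coordVec p w = c.coordVecLin p w := rfl

theorem hasMFDerivAt_param (hp : p.1 ∈ c.chart.source) :
    HasMFDerivAt 𝓘(ℂ, (Fin n → ℂ) × (Fin m → ℂ)) (IE n m) c.param (c.coord p)
      (mfderiv 𝓘(ℂ, (Fin n → ℂ) × (Fin m → ℂ)) (IE n m) c.param (c.coord p)) :=
  (c.param_mdifferentiableAt hp (c.coord p).2).hasMFDerivAt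

/-- The points `param (coord p)` and `p` are equal only propositionally, while tangent spaces depend
on the point. With the derivative typed on the model space, it can be transported along the
equality. -/
theorem hasMFDerivAt_of_eq {Y : Type*} {V H : Type*} [NormedAddCommGroup V] [NormedSpace ℂ V]
    [TopologicalSpace H] {I : ModelWithCorners ℂ V H} [TopologicalSpace Y] [ChartedSpace H Y]
    {f : TotalSpace (Fin m → ℂ) E → Y} {p q : TotalSpace (Fin m → ℂ) E} (h : q = p)
    {f' : (Fin n → ℂ) × (Fin m → ℂ) →L[ℂ] V} (hf : HasMFDerivAt (IE n m) I f p f') :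
    HasMFDerivAt (IE n m) I f q f' := by
  subst h
  exact hf

/-- Chain rule for `param ∘ coord`, which is the identity near `p`. -/
theorem coordVec_coordDiff (hp : p.1 ∈ c.chart.source) (v : TangentSpace (IE n m) p) :
    c.coordVec p (c.coordDiff p v) = v := by
  have h1 := HasMFDerivAt.comp p (c.hasMFDerivAt_param hp)
    ((c.contMDiffAt_coord hp).mdifferentiableAt (by simp)).hasMFDerivAt
  have h2 : HasMFDerivAt (IE n m) (IE n m) (c.param ∘ c.coord) p
      (ContinuousLinearMap.id ℂ (TangentSpace (IE n m) p)) := by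
    refine (hasMFDerivAt_id p).congr_of_eventuallyEq ?_
    filter_upwards [eventually_mem_base c.chart.open_source hp] with q hq
    exact c.param_coord hq
  exact congrArg (fun L : (Fin n → ℂ) × (Fin m → ℂ) →L[ℂ] (Fin n → ℂ) × (Fin m → ℂ) => L v)
    (hasMFDerivAt_unique h1 h2)

/-- Chain rule for `coord ∘ param`, which is the identity near `coord p`. -/
theorem coordDiff_coordVec (hp : p.1 ∈ c.chart.source) (w : (Fin n → ℂ) × (Fin m → ℂ)) :
    c.coordDiff p (c.coordVec p w) = w := by
  have h0 := ((c.contMDiffAt_coord hp).mdifferentiableAt (by simp)).hasMFDerivAt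
  have h1 := HasMFDerivAt.comp (c.coord p) (hasMFDerivAt_of_eq (c.param_coord hp) h0)
    (c.hasMFDerivAt_param hp)
  have h2 : HasMFDerivAt 𝓘(ℂ, (Fin n → ℂ) × (Fin m → ℂ)) 𝓘(ℂ, (Fin n → ℂ) × (Fin m → ℂ))
      (c.coord ∘ c.param) (c.coord p)
      (ContinuousLinearMap.id ℂ ((Fin n → ℂ) × (Fin m → ℂ))) := by
    refine (hasMFDerivAt_id (c.coord p)).congr_of_eventuallyEq ?_
    have : (c.coord p).1 ∈ c.chart.target := c.chart.map_source hp
    filter_upwards [continuousAt_fst.eventually (c.chart.open_target.mem_nhds this)] with y hy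
    exact c.coord_param hy
  exact congrArg (fun L : (Fin n → ℂ) × (Fin m → ℂ) →L[ℂ] (Fin n → ℂ) × (Fin m → ℂ) => L w)
    (hasMFDerivAt_unique h1 h2)

/-- Turns the differential on the manifold into a Fréchet derivative on a fixed vector space, where
smooth dependence on the point makes sense. -/
theorem realDiff_coordVec (hp : p.1 ∈ c.chart.source) {f : TotalSpace (Fin m → ℂ) E → ℂ}
    (hf : RealDiffAt n f p) (w : (Fin n → ℂ) × (Fin m → ℂ)) :
    realDiff f p (c.coordVec p w) = fderiv ℝ (f ∘ c.param) (c.coord p) w := by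
  have h1 : HasMFDerivAt 𝓘(ℝ, (Fin n → ℂ) × (Fin m → ℂ)) (IER n m) c.param (c.coord p) _ :=
    hasMFDerivAt_restrictScalars (I := 𝓘(ℂ, (Fin n → ℂ) × (Fin m → ℂ))) (I' := IE n m)
      rfl rfl rfl (c.hasMFDerivAt_param hp)
  have h2 : ∀ q, q = p → HasMFDerivAt (IER n m) 𝓘(ℝ, ℂ) f q
      (mfderiv (IER n m) 𝓘(ℝ, ℂ) f p : (Fin n → ℂ) × (Fin m → ℂ) →L[ℝ] ℂ) := by
    rintro _ rfl
    exact hf.hasMFDerivAt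
  let L : (Fin n → ℂ) × (Fin m → ℂ) →L[ℝ] ℂ :=
    (mfderiv (IER n m) 𝓘(ℝ, ℂ) f p : (Fin n → ℂ) × (Fin m → ℂ) →L[ℝ] ℂ).comp
      ((mfderiv 𝓘(ℂ, (Fin n → ℂ) × (Fin m → ℂ)) (IE n m) c.param (c.coord p) :
        (Fin n → ℂ) × (Fin m → ℂ) →L[ℂ] (Fin n → ℂ) × (Fin m → ℂ)).restrictScalars ℝ)
  have h3 : HasMFDerivAt 𝓘(ℝ, (Fin n → ℂ) × (Fin m → ℂ)) 𝓘(ℝ, ℂ) (f ∘ c.param) (c.coord p) L :=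
    HasMFDerivAt.comp (c.coord p) (h2 _ (c.param_coord hp)) h1
  have h4 : HasFDerivAt (f ∘ c.param) L (c.coord p) := hasMFDerivAt_iff_hasFDerivAt.1 h3
  rw [h4.fderiv]
  rfl

/-- Read in the chart, the function is the derivative of a smooth function of `(z, u)` in a constant
direction. -/
theorem smoothFunAt_realDiff_coordVec (hp : p.1 ∈ c.chart.source)
    {f : TotalSpace (Fin m → ℂ) E → ℂ} (hf : SmoothFunAt n f p)
    (w : (Fin n → ℂ) × (Fin m → ℂ)) :
    SmoothFunAt n (fun q => realDiff f q (c.coordVec q w)) p := by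
  filter_upwards [hf.eventually, (eventually_mem_base c.chart.open_source hp).eventually_nhds]
    with q hq hqc
  have hq0 := hqc.self_of_nhds
  have h1 : ContMDiffAt 𝓘(ℝ, (Fin n → ℂ) × (Fin m → ℂ)) (IER n m) ∞ c.param (c.coord q) :=
    (contMDiffAt_restrictScalars (I := 𝓘(ℂ, (Fin n → ℂ) × (Fin m → ℂ))) (I' := IE n m)
      rfl rfl rfl (c.contMDiffAt_param hq0 (c.coord q).2)).of_le (by exact_mod_cast le_top)
  have h2 : ContMDiffAt (IER n m) 𝓘(ℝ, (Fin n → ℂ) × (Fin m → ℂ)) ∞ c.coord q :=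
    (contMDiffAt_restrictScalars (I' := 𝓘(ℂ, (Fin n → ℂ) × (Fin m → ℂ))) (I := IE n m)
      rfl rfl rfl (c.contMDiffAt_coord hq0)).of_le (by exact_mod_cast le_top)
  have h3 : ContMDiffAt (IER n m) 𝓘(ℝ, ℂ) ∞ f (c.param (c.coord q)) := by
    rw [c.param_coord hq0]
    exact hq.contMDiffAt
  have h4 : ContDiffAt ℝ ∞ (f ∘ c.param) (c.coord q) :=
    contMDiffAt_iff_contDiffAt.1 (h3.comp (c.coord q) h1)
  have h5 : ContDiffAt ℝ ∞ (fun y => fderiv ℝ (f ∘ c.param) y w) (c.coord q) :=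
    (h4.fderiv_right (m := ∞) (by simp)).clm_apply contDiffAt_const
  refine (h5.contMDiffAt.comp q h2).congr_of_eventuallyEq ?_
  filter_upwards [hqc, hq.eventually] with r hr hfr
  exact c.realDiff_coordVec hr hfr.realDiffAt w

theorem smoothFunAt_vecAct_hol_coordVec (hp : p.1 ∈ c.chart.source)
    {f : TotalSpace (Fin m → ℂ) E → ℂ} (hf : SmoothFunAt n f p)
    (w : (Fin n → ℂ) × (Fin m → ℂ)) :
    SmoothFunAt n (fun q => vecAct (hol (c.coordVec q w)) f) p := by
  have h1 := c.smoothFunAt_realDiff_coordVec hp hf w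
  have h2 := c.smoothFunAt_realDiff_coordVec hp hf (Complex.I • w)
  refine ((h1.add (((smoothFunAt_const Complex.I).mul h2).neg)).mul
    (smoothFunAt_const (1 / 2))).congr (Filter.Eventually.of_forall fun q => ?_)
  simp only
  rw [vecAct_hol, coordVec_eq, coordVec_eq, ← map_smul]
  ring

end HolChart

/-! ### Change of charts -/

theorem isOpen_nonzeroVectors : IsOpen (nonzeroVectors m E) := by
  refine isOpen_iff_mem_nhds.2 fun p hp => ?_
  set e := trivializationAt (Fin m → ℂ) E p.1 with he
  have hpe : p.1 ∈ e.baseSet := FiberBundle.mem_baseSet_trivializationAt' _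
  have h0 : ∀ q : TotalSpace (Fin m → ℂ) E, q.1 ∈ e.baseSet → (q.2 = 0 ↔ (e q).2 = 0) := by
    intro q hq
    exact ((e.continuousLinearEquivAt ℂ q.1 hq).map_eq_zero_iff (x := q.2)).symm
  have hc : ContinuousAt (fun q => (e q).2) p :=
    continuousAt_snd.comp (e.continuousOn.continuousAt
      (e.open_source.mem_nhds (e.mem_source.2 hpe)))
  have hne : (e p).2 ≠ 0 := fun h => hp ((h0 p hpe).2 h)
  filter_upwards [eventually_mem_base e.open_baseSet hpe, hc.eventually_ne hne] with q hq hq0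
  exact fun h => hq0 ((h0 q hq).1 h)

namespace HolChart

variable (c c' : HolChart n m M E) {p : TotalSpace (Fin m → ℂ) E}

/-- The transition functions `M^β_α` of the frames, `e'_α = M^β_α e_β`. -/
def trans (β α : Fin m) (x : M) : ℂ := c.isFrame.coeff β x (c'.frame α x)

theorem frame_eq_sum_trans {x : M} (hx : x ∈ c.chart.source) (α : Fin m) :
    c'.frame α x = ∑ β, c.trans c' β α x • c.frame β x :=
  (c.sum_coeff hx _).symm

theorem contMDiffAt_trans (hp : p.1 ∈ c.chart.source) (hp' : p.1 ∈ c'.chart.source)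
    (β α : Fin m) :
    ContMDiffAt (IE n m) 𝓘(ℂ, ℂ) ω
      (fun q : TotalSpace (Fin m → ℂ) E => c.trans c' β α q.1) p := by
  have h1 : ContMDiffAt (IM n) (IE n m) ω
      (fun y => (⟨y, c'.frame α y⟩ : TotalSpace (Fin m → ℂ) E)) p.1 :=
    (c'.isFrame.contMDiffOn α).contMDiffAt (c'.chart.open_source.mem_nhds hp')
  have h2 : ContMDiffAt (IM n) 𝓘(ℂ, ℂ) ω (fun y => c.trans c' β α y) p.1 :=
    ContMDiffAt.comp p.1 (g := fun q : TotalSpace (Fin m → ℂ) E => c.isFrame.coeff β q.1 q.2)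
      (c.contMDiffAt_coeff (p := ⟨p.1, c'.frame α p.1⟩) hp β) h1
  exact ContMDiffAt.comp p (f := TotalSpace.proj) h2 (contMDiff_proj E).contMDiffAt

theorem mdifferentiableAt_trans (hp : p.1 ∈ c.chart.source) (hp' : p.1 ∈ c'.chart.source)
    (β α : Fin m) :
    MDifferentiableAt (IE n m) 𝓘(ℂ, ℂ)
      (fun q : TotalSpace (Fin m → ℂ) E => c.trans c' β α q.1) p :=
  (c.contMDiffAt_trans c' hp hp' β α).mdifferentiableAt (by simp)

theorem smoothFunAt_trans (hp : p.1 ∈ c.chart.source) (hp' : p.1 ∈ c'.chart.source)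
    (β α : Fin m) :
    SmoothFunAt n (fun q : TotalSpace (Fin m → ℂ) E => c.trans c' β α q.1) p := by
  refine smoothFunAt_of_holomorphic ?_
  filter_upwards [eventually_mem_base c.chart.open_source hp,
    eventually_mem_base c'.chart.open_source hp'] with q hq hq'
  exact c.contMDiffAt_trans c' hq hq' β α

/-- The coordinates of one chart are, on a fixed fibre, linear functions of those of the other; a
vertical line is therefore sent to a vertical line whose direction is multiplied by the transition
matrix. -/
theorem coord_param_line (hp : p.1 ∈ c.chart.source) (hp' : p.1 ∈ c'.chart.source)
    (u : Fin m → ℂ) (t : ℂ) :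
    c.coord (c'.param (c'.coord p + t • ((0, u) : (Fin n → ℂ) × (Fin m → ℂ)))) =
      c.coord p + t • ((0, fun β => ∑ α, c.trans c' β α p.1 * u α) :
        (Fin n → ℂ) × (Fin m → ℂ)) := by
  obtain ⟨x, v⟩ := p
  have hxs : c'.chart.symm (c'.chart x) = x := c'.chart.left_inv hp'
  -- Generalizing the base point allows substitution: `c'.chart.symm (c'.chart x)` equals `x`, but
  -- not by definition.
  have key : ∀ x' : M, x = x' → c.coord (⟨x', ∑ α, (c'.isFrame.coeff α x v + t * u α) •
      c'.frame α x'⟩ : TotalSpace (Fin m → ℂ) E) =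
      c.coord ⟨x, v⟩ + t • ((0, fun β => ∑ α, c.trans c' β α x * u α) :
        (Fin n → ℂ) × (Fin m → ℂ)) := by
    rintro _ rfl
    ext β
    · simp [coord]
    · have h1 : ∑ α, (c'.isFrame.coeff α x v + t * u α) • c'.frame α x =
          v + t • ∑ α, u α • c'.frame α x := by
        simp only [add_smul, Finset.sum_add_distrib, Finset.smul_sum, mul_smul]
        rw [c'.sum_coeff hp']
      simp only [coord, h1, map_add, map_smul, map_sum, Prod.snd_add, Prod.smul_snd, Pi.add_apply,
        Pi.smul_apply, smul_eq_mul, trans]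
      simp only [mul_comm]
  have hy : c'.coord ⟨x, v⟩ + t • ((0, u) : (Fin n → ℂ) × (Fin m → ℂ)) =
      (c'.chart x, fun α => c'.isFrame.coeff α x v + t * u α) := by
    ext i <;> simp [coord]
  rw [hy]
  exact key _ hxs.symm

/-- Differentiate `coord_param_line` at `t = 0`. Only a line in a single fibre is involved, so no
derivative of the transition matrix appears. -/
theorem coordVec_vertical (hp : p.1 ∈ c.chart.source) (hp' : p.1 ∈ c'.chart.source)
    (u : Fin m → ℂ) :
    c'.coordVec p (0, u) = c.coordVec p (0, fun β => ∑ α, c.trans c' β α p.1 * u α) := by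
  set A := (Fin n → ℂ) × (Fin m → ℂ) with hA
  set u' : Fin m → ℂ := fun β => ∑ α, c.trans c' β α p.1 * u α with hu'
  have hline : ∀ a w : A, HasFDerivAt (fun t : ℂ => a + t • w)
      ((ContinuousLinearMap.id ℂ ℂ).smulRight w : ℂ →L[ℂ] A) 0 := fun a w =>
    (((ContinuousLinearMap.id ℂ ℂ).smulRight w : ℂ →L[ℂ] A).hasFDerivAt (x := 0)).const_add a
  have h0 := ((c.contMDiffAt_coord hp).mdifferentiableAt (by simp)).hasMFDerivAt
  have h1 : HasMFDerivAt 𝓘(ℂ, A) 𝓘(ℂ, A) (c.coord ∘ c'.param) (c'.coord p)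
      ((mfderiv (IE n m) 𝓘(ℂ, A) c.coord p : A →L[ℂ] A).comp
        (mfderiv 𝓘(ℂ, A) (IE n m) c'.param (c'.coord p) : A →L[ℂ] A)) :=
    HasMFDerivAt.comp (c'.coord p) (hasMFDerivAt_of_eq (c'.param_coord hp') h0)
      (c'.hasMFDerivAt_param hp')
  have h2 : HasFDerivAt (c.coord ∘ c'.param)
      ((mfderiv (IE n m) 𝓘(ℂ, A) c.coord p : A →L[ℂ] A).comp
        (mfderiv 𝓘(ℂ, A) (IE n m) c'.param (c'.coord p) : A →L[ℂ] A)) (c'.coord p) :=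
    hasMFDerivAt_iff_hasFDerivAt.1 h1
  have h3 : HasFDerivAt (c.coord ∘ c'.param)
      ((mfderiv (IE n m) 𝓘(ℂ, A) c.coord p : A →L[ℂ] A).comp
        (mfderiv 𝓘(ℂ, A) (IE n m) c'.param (c'.coord p) : A →L[ℂ] A))
      (c'.coord p + (0 : ℂ) • ((0, u) : A)) := by
    rw [zero_smul, add_zero]
    exact h2
  have h4 := h3.comp (0 : ℂ) (hline (c'.coord p) (0, u))
  have h5 : HasFDerivAt ((c.coord ∘ c'.param) ∘ fun t : ℂ => c'.coord p + t • ((0, u) : A))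
      ((ContinuousLinearMap.id ℂ ℂ).smulRight ((0, u') : A) : ℂ →L[ℂ] A) 0 := by
    refine (hline (c.coord p) (0, u')).congr_of_eventuallyEq (Filter.Eventually.of_forall ?_)
    intro t
    exact c.coord_param_line c' hp hp' u t
  have h6 := congrArg (fun L : ℂ →L[ℂ] A => L 1) (h4.unique h5)
  have h7 : c.coordDiff p (c'.coordVec p (0, u)) = (0, u') := by
    have h8 : (1 : ℂ) • ((0, u') : A) = (0, u') := one_smul _ _
    refine Eq.trans ?_ (h6.trans h8)
    change _ = c.coordDiff p (c'.coordVec p ((1 : ℂ) • (0, u)))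
    rw [one_smul]
  rw [← h7, c.coordVec_coordDiff hp]

theorem du_eq_sum (hp : p.1 ∈ c.chart.source) (hp' : p.1 ∈ c'.chart.source) (α : Fin m) :
    c'.du α p = ∑ β, c.trans c' β α p.1 • c.du β p := by
  have h : ((0, fun β => ∑ γ, c.trans c' β γ p.1 * (Pi.single α 1 : Fin m → ℂ) γ) :
      (Fin n → ℂ) × (Fin m → ℂ)) =
      ∑ β, c.trans c' β α p.1 • ((0, Pi.single β 1) : (Fin n → ℂ) × (Fin m → ℂ)) := by
    ext i
    · simp [Prod.fst_sum]
    · simp [Prod.snd_sum, Pi.single_apply, Finset.sum_apply]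
  simp only [du, c.coordVec_vertical c' hp hp', h, coordVec_eq, map_sum, map_smul]

end HolChart

/-! ### Local coefficients of the Chern-Finsler connection -/

variable {A : HolomorphicLieAlgebroid n m M E} {F : TotalSpace (Fin m → ℂ) E → ℝ}

theorem IsFinslerStructure.smoothFunAt (hF : IsFinslerStructure n F)
    {p : TotalSpace (Fin m → ℂ) E} (hp : p ∈ nonzeroVectors m E) :
    SmoothFunAt n (fun q => (F q : ℂ)) p := by
  filter_upwards [isOpen_nonzeroVectors.mem_nhds hp] with q hq
  have h1 := (hF.smooth.contMDiffAt (isOpen_nonzeroVectors.mem_nhds hq))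
  exact (Complex.ofRealCLM.contDiff (n := ∞)).contMDiff.contMDiffAt.comp q h1

namespace HolChart

variable (c c' : HolChart n m M E) {p : TotalSpace (Fin m → ℂ) E}

/-- The coefficients are the fibre component of the composite of the frame section, the anchor and
the tangent map of the chart, all holomorphic. -/
theorem smoothFunAt_rho (hp : p.1 ∈ c.chart.source) (k : Fin n) (α : Fin m) :
    SmoothFunAt n (fun q : TotalSpace (Fin m → ℂ) E => c.rho A k α q.1) p := by
  refine smoothFunAt_of_holomorphic ?_
  filter_upwards [eventually_mem_base c.chart.open_source hp] with q hq
  have h1 : ContMDiffAt (IM n) (IE n m) ω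
      (fun y => (⟨y, c.frame α y⟩ : TotalSpace (Fin m → ℂ) E)) q.1 :=
    (c.isFrame.contMDiffOn α).contMDiffAt (c.chart.open_source.mem_nhds hq)
  have h2 : ContMDiffAt (IM n) (IM n).tangent ω
      (fun y => (⟨y, A.anchor y (c.frame α y)⟩ : TangentBundle (IM n) M)) q.1 :=
    ContMDiffAt.comp q.1 (g := fun v : TotalSpace (Fin m → ℂ) E =>
      (⟨v.1, A.anchor v.1 v.2⟩ : TangentBundle (IM n) M)) A.anchor_holomorphic.contMDiffAt h1
  have h3 : ContMDiffOn (IM n).tangent (𝓘(ℂ, Fin n → ℂ)).tangent ω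
      (tangentMapWithin (IM n) 𝓘(ℂ, Fin n → ℂ) c.chart c.chart.source)
      (Bundle.TotalSpace.proj ⁻¹' c.chart.source) :=
    (contMDiffOn_of_mem_maximalAtlas c.chart_mem).contMDiffOn_tangentMapWithin le_rfl
      c.chart.open_source.uniqueMDiffOn
  have hopen : IsOpen ((Bundle.TotalSpace.proj : TangentBundle (IM n) M → M) ⁻¹'
      c.chart.source) :=
    c.chart.open_source.preimage (FiberBundle.continuous_proj (Fin n → ℂ) (TangentSpace (IM n)))
  have h4 := (h3.contMDiffAt (x := ⟨q.1, A.anchor q.1 (c.frame α q.1)⟩)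
    (hopen.mem_nhds hq)).comp q.1 h2
  have h5 := (contMDiff_snd_tangentBundle_modelSpace (Fin n → ℂ) 𝓘(ℂ, Fin n → ℂ)
    (n := ω)).contMDiffAt.comp q.1 h4
  have h6 : ContMDiffAt (IM n) 𝓘(ℂ, Fin n → ℂ) ω (fun y => fun k => c.rho A k α y) q.1 := by
    refine h5.congr_of_eventuallyEq ?_
    filter_upwards [c.chart.open_source.mem_nhds hq] with y hy
    ext k
    -- On the open source the derivative within the source, used by the tangent map, is the
    -- derivative in the definition of `rho`.
    exact congrArg (fun L : (Fin n → ℂ) →L[ℂ] (Fin n → ℂ) => L (A.anchor y (c.frame α y)) k)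
      (mfderivWithin_of_isOpen c.chart.open_source hy).symm
  exact ContMDiffAt.comp q (f := TotalSpace.proj) (contMDiffAt_pi_space.1 h6 k)
    (contMDiff_proj E).contMDiffAt

theorem smoothFunAt_vecAct_du (hp : p.1 ∈ c.chart.source) {f : TotalSpace (Fin m → ℂ) E → ℂ}
    (hf : SmoothFunAt n f p) (α : Fin m) : SmoothFunAt n (fun q => vecAct (c.du α q) f) p :=
  c.smoothFunAt_vecAct_hol_coordVec hp hf _

theorem smoothFunAt_vecAct_dz (hp : p.1 ∈ c.chart.source) {f : TotalSpace (Fin m → ℂ) E → ℂ}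
    (hf : SmoothFunAt n f p) (k : Fin n) : SmoothFunAt n (fun q => vecAct (c.dz k q) f) p :=
  c.smoothFunAt_vecAct_hol_coordVec hp hf _

/-- For real differentiable `f`, `X̄ f` is the conjugate of `X` applied to the conjugate of `f`, so
smoothness for `X` is enough. -/
theorem smoothFunAt_vecAct_conjC {X : ∀ q : TotalSpace (Fin m → ℂ) E,
      ℂ ⊗[ℝ] TangentSpace (IE n m) q}
    (hX : ∀ f : TotalSpace (Fin m → ℂ) E → ℂ, SmoothFunAt n f p →
      SmoothFunAt n (fun q => vecAct (X q) f) p)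
    {f : TotalSpace (Fin m → ℂ) E → ℂ} (hf : SmoothFunAt n f p) :
    SmoothFunAt n (fun q => vecAct (conjC (X q)) f) p := by
  refine (hX _ hf.star).star.congr ?_
  filter_upwards [hf.eventually] with q hq
  exact vecAct_conjC _ hq.realDiffAt

theorem smoothFunAt_dbarF (hF : IsFinslerStructure n F) (hp : p.1 ∈ c.chart.source)
    (hp0 : p ∈ nonzeroVectors m E) (σ : Fin m) : SmoothFunAt n (c.dbarF F σ) p :=
  smoothFunAt_vecAct_conjC (fun _ hf => c.smoothFunAt_vecAct_du hp hf σ) (hF.smoothFunAt hp0)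

theorem smoothFunAt_h (hF : IsFinslerStructure n F) (hp : p.1 ∈ c.chart.source)
    (hp0 : p ∈ nonzeroVectors m E) (α σ : Fin m) : SmoothFunAt n (fun q => c.h F q α σ) p :=
  c.smoothFunAt_vecAct_du hp (c.smoothFunAt_dbarF hF hp hp0 σ) α

/-- The one consequence of convexity on which the construction rests: `h` is nondegenerate at
nonzero vectors. -/
theorem det_h_ne_zero (hconv : IsConvex n F) (hp : p.1 ∈ c.chart.source)
    (hp0 : p ∈ nonzeroVectors m E) : (c.h F p).det ≠ 0 :=
  ((Matrix.isUnit_iff_isUnit_det _).1 (hconv c p hp0 hp).isUnit).ne_zero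

theorem eventually_nonzero_base (hp : p.1 ∈ c.chart.source) (hp0 : p ∈ nonzeroVectors m E) :
    ∀ᶠ q in 𝓝 p, q ∈ nonzeroVectors m E ∧ q.1 ∈ c.chart.source :=
  Filter.Eventually.and (isOpen_nonzeroVectors.mem_nhds hp0)
    (eventually_mem_base c.chart.open_source hp)

theorem smoothFunAt_hInv (hF : IsFinslerStructure n F) (hconv : IsConvex n F)
    (hp : p.1 ∈ c.chart.source) (hp0 : p ∈ nonzeroVectors m E) (σ γ : Fin m) :
    SmoothFunAt n (c.hInv F σ γ) p := by
  refine SmoothFunAt.matrix_inv (a := fun i j q => c.h F q i j)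
    (fun i j => c.smoothFunAt_h hF hp hp0 i j) ?_ σ γ
  filter_upwards [c.eventually_nonzero_base hp hp0] with q hq
  exact c.det_h_ne_zero hconv hq.2 hq.1

theorem smoothFunAt_vecAct_dA (hp : p.1 ∈ c.chart.source)
    {f : TotalSpace (Fin m → ℂ) E → ℂ} (hf : SmoothFunAt n f p) (α : Fin m) :
    SmoothFunAt n (fun q => vecAct (c.dA A α q) f) p := by
  simp only [dA, vecAct_sum, vecAct_smul]
  exact SmoothFunAt.sum fun k _ => (c.smoothFunAt_rho hp k α).mul (c.smoothFunAt_vecAct_dz hp hf k)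

theorem smoothFunAt_NA (hF : IsFinslerStructure n F) (hconv : IsConvex n F)
    (hp : p.1 ∈ c.chart.source) (hp0 : p ∈ nonzeroVectors m E) (β α : Fin m) :
    SmoothFunAt n (c.NA A F β α) p :=
  SmoothFunAt.sum fun σ _ => (c.smoothFunAt_hInv hF hconv hp hp0 σ β).mul
    (c.smoothFunAt_vecAct_dA hp (c.smoothFunAt_dbarF hF hp hp0 σ) α)

/-- The connection form `θ^γ_α(X) = h^{σ̄γ} X'(h_{ασ̄})` of the Chern connection of the Hermitian
metric `h`, where `X'` is the `(1,0)`-component of `X`, as a matrix with row `γ` and column `α`. -/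
def chernForm (F : TotalSpace (Fin m → ℂ) E → ℝ) (p : TotalSpace (Fin m → ℂ) E)
    (X : ℂ ⊗[ℝ] TangentSpace (IE n m) p) : Matrix (Fin m) (Fin m) ℂ :=
  Matrix.of fun γ α => ∑ σ, c.hInv F σ γ p * vecAct (hol (holCoeff X)) (fun q => c.h F q α σ)

theorem dbarF_eq_sum (hp : p.1 ∈ c.chart.source) (hp' : p.1 ∈ c'.chart.source) (σ : Fin m) :
    c'.dbarF F σ p = ∑ δ, star (c.trans c' δ σ p.1) * c.dbarF F δ p := by
  simp only [dbarF, c.du_eq_sum c' hp hp', map_sum, conjC_smul, vecAct_sum, vecAct_smul]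

/-- The functions `∂̇_σ̄ F` change by conjugates of holomorphic functions, whose (1,0)-derivatives
vanish. So no derivative of the transition matrix survives; both the law for `h` and that for the
adapted frame follow from this. -/
theorem vecAct_hol_dbarF (hF : IsFinslerStructure n F) (hp : p.1 ∈ c.chart.source)
    (hp' : p.1 ∈ c'.chart.source) (hp0 : p ∈ nonzeroVectors m E) (σ : Fin m)
    (v : TangentSpace (IE n m) p) :
    vecAct (hol v) (c'.dbarF F σ) =
      ∑ δ, star (c.trans c' δ σ p.1) * vecAct (hol v) (c.dbarF F δ) := by
  have h1 : c'.dbarF F σ =ᶠ[𝓝 p] fun q => ∑ δ, star (c.trans c' δ σ q.1) * c.dbarF F δ q := by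
    filter_upwards [eventually_mem_base c.chart.open_source hp,
      eventually_mem_base c'.chart.open_source hp'] with q hq hq'
    exact c.dbarF_eq_sum c' hq hq' σ
  have h2 : ∀ δ, RealDiffAt n (fun q : TotalSpace (Fin m → ℂ) E => star (c.trans c' δ σ q.1)) p :=
    fun δ => (realDiffAt_of_holomorphic (c.mdifferentiableAt_trans c' hp hp' δ σ)).star
  have h3 : ∀ δ, RealDiffAt n (c.dbarF F δ) p :=
    fun δ => (c.smoothFunAt_dbarF hF hp hp0 δ).realDiffAt
  rw [vecAct_congr _ h1, vecAct_fun_sum _ _ fun δ _ => RealDiffAt.mul (h2 δ) (h3 δ)]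
  refine Finset.sum_congr rfl fun δ _ => ?_
  rw [vecAct_fun_mul _ (h2 δ) (h3 δ),
    vecAct_hol_star_of_holomorphic (c.mdifferentiableAt_trans c' hp hp' δ σ), mul_zero, add_zero]

theorem h_eq_sum (hF : IsFinslerStructure n F) (hp : p.1 ∈ c.chart.source)
    (hp' : p.1 ∈ c'.chart.source) (hp0 : p ∈ nonzeroVectors m E) (α σ : Fin m) :
    c'.h F p α σ = ∑ δ, (∑ γ, c.trans c' γ α p.1 * c.h F p γ δ) * star (c.trans c' δ σ p.1) := by
  change vecAct (hol _) (c'.dbarF F σ) = _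
  rw [c.vecAct_hol_dbarF c' hF hp hp' hp0]
  refine Finset.sum_congr rfl fun δ _ => ?_
  rw [mul_comm]
  congr 1
  change vecAct (c'.du α p) _ = _
  rw [c.du_eq_sum c' hp hp', vecAct_sum]
  simp only [vecAct_smul]
  rfl

/-- Product rule for `h' = Tᵗ h T̄`. The term with the derivative of `T̄` drops out, and the one
with the derivative of `T` remains; it becomes the inhomogeneous term of the gauge law. -/
theorem vecAct_hol_h (hF : IsFinslerStructure n F) (hp : p.1 ∈ c.chart.source)
    (hp' : p.1 ∈ c'.chart.source) (hp0 : p ∈ nonzeroVectors m E) (α σ : Fin m)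
    (v : TangentSpace (IE n m) p) :
    vecAct (hol v) (fun q => c'.h F q α σ) =
      ∑ δ, (∑ γ, (c.trans c' γ α p.1 * vecAct (hol v) (fun q => c.h F q γ δ) +
        c.h F p γ δ * vecAct (hol v) (fun q => c.trans c' γ α q.1))) *
          star (c.trans c' δ σ p.1) := by
  have h1 : (fun q => c'.h F q α σ) =ᶠ[𝓝 p] fun q => ∑ δ, (∑ γ, c.trans c' γ α q.1 *
      c.h F q γ δ) * star (c.trans c' δ σ q.1) := by
    filter_upwards [c.eventually_nonzero_base hp hp0,
      eventually_mem_base c'.chart.open_source hp'] with q hq hq'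
    exact c.h_eq_sum c' hF hq.2 hq' hq.1 α σ
  have h2 : ∀ δ α, RealDiffAt n (fun q : TotalSpace (Fin m → ℂ) E => c.trans c' δ α q.1) p :=
    fun δ α => realDiffAt_of_holomorphic (c.mdifferentiableAt_trans c' hp hp' δ α)
  have h3 : ∀ γ δ, RealDiffAt n (fun q => c.h F q γ δ) p :=
    fun γ δ => (c.smoothFunAt_h hF hp hp0 γ δ).realDiffAt
  have h4 : ∀ δ, RealDiffAt n (fun q => ∑ γ, c.trans c' γ α q.1 * c.h F q γ δ) p :=
    fun δ => RealDiffAt.sum fun γ _ => RealDiffAt.mul (h2 γ α) (h3 γ δ)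
  rw [vecAct_congr _ h1, vecAct_fun_sum _ _ fun δ _ => RealDiffAt.mul (h4 δ) (h2 δ σ).star]
  refine Finset.sum_congr rfl fun δ _ => ?_
  rw [vecAct_fun_mul _ (h4 δ) (h2 δ σ).star,
    vecAct_hol_star_of_holomorphic (c.mdifferentiableAt_trans c' hp hp' δ σ), mul_zero, zero_add,
    mul_comm, vecAct_fun_sum _ _ fun γ _ => RealDiffAt.mul (h2 γ α) (h3 γ δ)]
  congr 1
  exact Finset.sum_congr rfl fun γ _ => vecAct_fun_mul _ (h2 γ α) (h3 γ δ)

/-- Allows the full derivative `X(T)`, produced by the Leibniz rule, to replace the (1,0)-derivative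
which the Chern form produces. -/
theorem vecAct_of_holomorphic {f : TotalSpace (Fin m → ℂ) E → ℂ}
    (hf : MDifferentiableAt (IE n m) 𝓘(ℂ, ℂ) f p) (X : ℂ ⊗[ℝ] TangentSpace (IE n m) p) :
    vecAct (hol (holCoeff X)) f = vecAct X f := by
  conv_rhs => rw [← hol_add_conjC_hol X]
  rw [vecAct_add, vecAct_conjC_hol_of_holomorphic hf, add_zero]

/-- The transformation law of the connection form under a change of charts. -/
theorem chernForm_trans (hF : IsFinslerStructure n F) (hconv : IsConvex n F)
    (hp : p.1 ∈ c.chart.source) (hp' : p.1 ∈ c'.chart.source) (hp0 : p ∈ nonzeroVectors m E)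
    (X : ℂ ⊗[ℝ] TangentSpace (IE n m) p) (γ α : Fin m) :
    vecAct X (fun q => c.trans c' γ α q.1) + ∑ β, c.chernForm F p X γ β * c.trans c' β α p.1 =
      ∑ β, c.trans c' γ β p.1 * c'.chernForm F p X β α := by
  set T : Matrix (Fin m) (Fin m) ℂ := Matrix.of fun β α => c.trans c' β α p.1 with hT
  set dT : Matrix (Fin m) (Fin m) ℂ :=
    Matrix.of fun β α => vecAct (hol (holCoeff X)) (fun q => c.trans c' β α q.1) with hdT
  set G : Matrix (Fin m) (Fin m) ℂ :=
    Matrix.of fun α σ => vecAct (hol (holCoeff X)) (fun q => c.h F q α σ) with hG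
  set G' : Matrix (Fin m) (Fin m) ℂ :=
    Matrix.of fun α σ => vecAct (hol (holCoeff X)) (fun q => c'.h F q α σ) with hG'
  have e1 : c'.h F p = T.transpose * c.h F p * T.map star := by
    ext i j
    rw [c.h_eq_sum c' hF hp hp' hp0]
    simp [Matrix.mul_apply, T]
  have e2 : G' = (T.transpose * G + dT.transpose * c.h F p) * T.map star := by
    ext i j
    simp only [G', Matrix.of_apply]
    rw [c.vecAct_hol_h c' hF hp hp' hp0]
    simp only [Matrix.mul_apply, Matrix.add_apply, Matrix.transpose_apply, Matrix.map_apply, T,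
      dT, G, Matrix.of_apply, Finset.sum_add_distrib]
    refine Finset.sum_congr rfl fun δ _ => ?_
    congr 2
    exact Finset.sum_congr rfl fun _ _ => mul_comm _ _
  -- With row `γ` and column `α` in the Chern form, and row `σ` and column `γ` in `hInv`, the matrix
  -- product comes out transposed.
  have e3 : (c.chernForm F p X).transpose = G * (c.h F p)⁻¹ := by
    ext i j
    simp only [chernForm, Matrix.transpose_apply, Matrix.of_apply, Matrix.mul_apply, G, hInv]
    exact Finset.sum_congr rfl fun _ _ => mul_comm _ _
  have e4 : (c'.chernForm F p X).transpose = G' * (c'.h F p)⁻¹ := by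
    ext i j
    simp only [chernForm, Matrix.transpose_apply, Matrix.of_apply, Matrix.mul_apply, G', hInv]
    exact Finset.sum_congr rfl fun _ _ => mul_comm _ _
  have hd := c.det_h_ne_zero hconv hp hp0
  have hd' := c'.det_h_ne_zero hconv hp' hp0
  -- Since `h' = Tᵗ (h T̄)` is invertible, so is the factor `h T̄`; it can be cancelled on the right
  -- without treating `T` separately.
  have hunit : IsUnit (c.h F p * T.map star).det := by
    rw [e1, Matrix.mul_assoc, Matrix.det_mul] at hd'
    exact (right_ne_zero_of_mul hd').isUnit
  have e5 : dT.transpose + T.transpose * (c.chernForm F p X).transpose =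
      (c'.chernForm F p X).transpose * T.transpose := by
    have e6 : (dT.transpose + T.transpose * (c.chernForm F p X).transpose) *
        (c.h F p * T.map star) =
        (c'.chernForm F p X).transpose * T.transpose * (c.h F p * T.map star) := by
      -- `θ'ᵗ Tᵗ h T̄ = G' h'⁻¹ h' = G'`, which is expanded by the product rule `e2` and compared
      -- with the other side.
      have e7 : (c'.chernForm F p X).transpose * T.transpose * (c.h F p * T.map star) = G' := by
        rw [Matrix.mul_assoc, ← Matrix.mul_assoc T.transpose, ← e1, e4, Matrix.mul_assoc,
          Matrix.nonsing_inv_mul _ hd'.isUnit, Matrix.mul_one]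
      rw [e7, e2, e3, ← Matrix.mul_assoc]
      congr 1
      rw [add_mul, Matrix.mul_assoc T.transpose, Matrix.mul_assoc G,
        Matrix.nonsing_inv_mul _ hd.isUnit, Matrix.mul_one, add_comm]
    exact ((Matrix.isUnit_iff_isUnit_det _).2 hunit).mul_right_cancel e6
  have e9 := congrFun (congrFun e5 α) γ
  simp only [Matrix.add_apply, Matrix.transpose_apply, Matrix.mul_apply, dT, T,
    Matrix.of_apply] at e9
  rw [vecAct_of_holomorphic (c.mdifferentiableAt_trans c' hp hp' γ α)] at e9
  rw [Finset.sum_congr rfl fun β _ => mul_comm (c.chernForm F p X γ β) _, e9]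
  exact Finset.sum_congr rfl fun β _ => mul_comm _ _

end HolChart

/-! ### Smooth complexified vector fields -/

section SmoothVector

variable {p : TotalSpace (Fin m → ℂ) E}
  {Y : ∀ q : TotalSpace (Fin m → ℂ) E, ℂ ⊗[ℝ] TangentSpace (IE n m) q}

theorem SmoothT.vecAct (hY : SmoothT Y p) {g : TotalSpace (Fin m → ℂ) E → ℂ}
    (hg : SmoothFunAt n g p) : SmoothFunAt n (fun q => FinslerAlgebroid.vecAct (Y q) g) p := by
  obtain ⟨c, hp, a, ha, hYa⟩ := hY
  have h : ∀ i, SmoothFunAt n (fun q => FinslerAlgebroid.vecAct (c.tangentFrame i q) g) p := by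
    rintro ((k | α) | (k | α))
    · exact c.smoothFunAt_vecAct_dz hp hg k
    · exact c.smoothFunAt_vecAct_du hp hg α
    · exact HolChart.smoothFunAt_vecAct_conjC (fun _ hf => c.smoothFunAt_vecAct_dz hp hf k) hg
    · exact HolChart.smoothFunAt_vecAct_conjC (fun _ hf => c.smoothFunAt_vecAct_du hp hf α) hg
  refine (SmoothFunAt.sum (s := Finset.univ) fun i _ => (ha i).mul (h i)).congr ?_
  filter_upwards [hYa] with q hq
  rw [hq, vecAct_sum]
  simp only [vecAct_smul]

theorem SmoothT.conjC (hY : SmoothT Y p) : SmoothT (fun q => conjC (Y q)) p := by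
  obtain ⟨c, hp, a, ha, hYa⟩ := hY
  -- Conjugation exchanges the two halves of the frame, whence the swapped index.
  refine ⟨c, hp, fun i q => star (a i.swap q), fun i => (ha _).star, ?_⟩
  filter_upwards [hYa] with q hq
  rw [hq, map_sum]
  refine Fintype.sum_equiv (Equiv.sumComm _ _) _ _ fun i => ?_
  rw [conjC_smul]
  rcases i with ((k | α) | (k | α)) <;> simp [HolChart.tangentFrame]

theorem SmoothT.hol_holCoeff (hY : SmoothT Y p) : SmoothT (fun q => hol (holCoeff (Y q))) p := by
  obtain ⟨c, hp, a, ha, hYa⟩ := hY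
  refine ⟨c, hp, Sum.elim (fun i => a (Sum.inl i)) fun _ _ => 0, ?_, ?_⟩
  · rintro (i | i)
    · exact ha _
    · exact smoothFunAt_const 0
  filter_upwards [hYa] with q hq
  rw [hq]
  simp only [Fintype.sum_sum_type, HolChart.tangentFrame, Sum.elim_inl, Sum.elim_inr, map_add,
    map_sum, map_smul, HolChart.dz, HolChart.du, holCoeff_hol, holCoeff_conjC_hol, map_zero,
    smul_zero, zero_smul]

theorem HolChart.smoothFunAt_chernForm {F : TotalSpace (Fin m → ℂ) E → ℝ}
    (hF : IsFinslerStructure n F) (hconv : IsConvex n F) (c : HolChart n m M E)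
    (hp : p.1 ∈ c.chart.source) (hp0 : p ∈ nonzeroVectors m E) (hY : SmoothT Y p)
    (γ α : Fin m) : SmoothFunAt n (fun q => c.chernForm F q (Y q) γ α) p := by
  simp only [chernForm, Matrix.of_apply]
  exact SmoothFunAt.sum fun σ _ => (c.smoothFunAt_hInv hF hconv hp hp0 σ γ).mul
    (hY.hol_holCoeff.vecAct (c.smoothFunAt_h hF hp hp0 α σ))

end SmoothVector

/-- Restrict a chart of the base to the domain of a trivialization and take the local frame coming
from the standard basis. -/
theorem exists_holChart (x : M) : ∃ c : HolChart n m M E, x ∈ c.chart.source := by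
  set e := trivializationAt (Fin m → ℂ) E x with he
  refine ⟨⟨(chartAt (Fin n → ℂ) x).restr e.baseSet, ?_,
    e.localFrame (Pi.basisFun ℂ (Fin m)), ?_⟩, ?_⟩
  · exact restr_mem_maximalAtlas (contDiffGroupoid ω (IM n)) (IsManifold.chart_mem_maximalAtlas x)
      e.open_baseSet
  · refine (e.isLocalFrameOn_localFrame_baseSet (IM n) ω _).mono ?_
    simp [e.open_baseSet.interior_eq]
  · simpa [e.open_baseSet.interior_eq] using FiberBundle.mem_baseSet_trivializationAt' x

/-- A chart around a point of the base. -/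
def holChartAt (x : M) : HolChart n m M E := (exists_holChart x).choose

theorem mem_holChartAt (x : M) : x ∈ (holChartAt x : HolChart n m M E).chart.source :=
  (exists_holChart x).choose_spec

/-- Conjugation of a complex number, if the flag `b` is set. -/
def conjIf (b : Bool) (z : ℂ) : ℂ := if b then star z else z

theorem SmoothFunAt.conjIf {f : TotalSpace (Fin m → ℂ) E → ℂ} {p : TotalSpace (Fin m → ℂ) E}
    (hf : SmoothFunAt n f p) (b : Bool) :
    SmoothFunAt n (fun q => FinslerAlgebroid.conjIf b (f q)) p := by
  cases b
  · exact hf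
  · exact hf.star

/-- The connection form of a block of a frame: the Chern form, or its conjugate for a conjugate
block. -/
def HolChart.blockForm (c : HolChart n m M E) (F : TotalSpace (Fin m → ℂ) E → ℝ) (b : Bool)
    (p : TotalSpace (Fin m → ℂ) E) (X : ℂ ⊗[ℝ] TangentSpace (IE n m) p) (γ α : Fin m) : ℂ :=
  if b then star (c.chernForm F p (conjC X) γ α) else c.chernForm F p X γ α

namespace HolChart

variable (c c' : HolChart n m M E) {F : TotalSpace (Fin m → ℂ) E → ℝ}
  {p : TotalSpace (Fin m → ℂ) E}

theorem chernForm_add (X Y : ℂ ⊗[ℝ] TangentSpace (IE n m) p) (γ α : Fin m) :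
    c.chernForm F p (X + Y) γ α = c.chernForm F p X γ α + c.chernForm F p Y γ α := by
  simp only [chernForm, Matrix.of_apply, map_add, vecAct_add, mul_add, Finset.sum_add_distrib]

theorem chernForm_smul (z : ℂ) (X : ℂ ⊗[ℝ] TangentSpace (IE n m) p) (γ α : Fin m) :
    c.chernForm F p (z • X) γ α = z * c.chernForm F p X γ α := by
  simp only [chernForm, Matrix.of_apply, map_smul, vecAct_smul, Finset.mul_sum]
  exact Finset.sum_congr rfl fun σ _ => by ring

theorem blockForm_add (b : Bool) (X Y : ℂ ⊗[ℝ] TangentSpace (IE n m) p) (γ α : Fin m) :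
    c.blockForm F b p (X + Y) γ α = c.blockForm F b p X γ α + c.blockForm F b p Y γ α := by
  cases b <;> simp [blockForm, chernForm_add]

theorem blockForm_smul (b : Bool) (z : ℂ) (X : ℂ ⊗[ℝ] TangentSpace (IE n m) p) (γ α : Fin m) :
    c.blockForm F b p (z • X) γ α = z * c.blockForm F b p X γ α := by
  cases b <;> simp [blockForm, chernForm_smul, conjC_smul]

theorem blockForm_conj (b : Bool) (X : ℂ ⊗[ℝ] TangentSpace (IE n m) p) (γ α : Fin m) :
    c.blockForm F (!b) p (conjC X) γ α = star (c.blockForm F b p X γ α) := by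
  cases b <;> simp [blockForm]

theorem smoothFunAt_blockForm (hF : IsFinslerStructure n F) (hconv : IsConvex n F)
    (hp : p.1 ∈ c.chart.source) (hp0 : p ∈ nonzeroVectors m E)
    {Y : ∀ q : TotalSpace (Fin m → ℂ) E, ℂ ⊗[ℝ] TangentSpace (IE n m) q} (hY : SmoothT Y p)
    (b : Bool) (γ α : Fin m) : SmoothFunAt n (fun q => c.blockForm F b q (Y q) γ α) p := by
  cases b
  · exact c.smoothFunAt_chernForm hF hconv hp hp0 hY γ α
  · exact (c.smoothFunAt_chernForm hF hconv hp hp0 hY.conjC γ α).star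

/-- For a conjugate block, conjugate the law for `X̄`; the conjugate of `X̄(T)` is `X(T̄)`. -/
theorem blockForm_trans (hF : IsFinslerStructure n F) (hconv : IsConvex n F)
    (hp : p.1 ∈ c.chart.source) (hp' : p.1 ∈ c'.chart.source) (hp0 : p ∈ nonzeroVectors m E)
    (b : Bool) (X : ℂ ⊗[ℝ] TangentSpace (IE n m) p) (γ α : Fin m) :
    vecAct X (fun q => conjIf b (c.trans c' γ α q.1)) +
        ∑ β, c.blockForm F b p X γ β * conjIf b (c.trans c' β α p.1) =
      ∑ β, conjIf b (c.trans c' γ β p.1) * c'.blockForm F b p X β α := by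
  cases b
  · exact c.chernForm_trans c' hF hconv hp hp' hp0 X γ α
  · have h := congrArg star (c.chernForm_trans c' hF hconv hp hp' hp0 (conjC X) γ α)
    simp only [star_add, star_sum, star_mul'] at h
    rw [← vecAct_star _
      (realDiffAt_of_holomorphic (c.mdifferentiableAt_trans c' hp hp' γ α))] at h
    exact h

end HolChart

/-! ### Connections on bundles with block frames -/

section BlockFrame

variable {κ : Type} [Fintype κ] {B : TotalSpace (Fin m → ℂ) E → Type*}
  [∀ p, AddCommGroup (B p)] [∀ p, Module ℂ (B p)]

/-- Local frames of a bundle `B` over `Ẽ`, attached to the charts and consisting of blocks indexed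
by `κ`, each of which transforms like the frames of `E` or, where `bar` is set, like their
conjugates. -/
structure IsBlockFrame (bar : κ → Bool) (f : HolChart n m M E → κ × Fin m → ∀ p, B p) :
    Prop where
  linearIndependent : ∀ c, ∀ p ∈ nonzeroVectors m E, p.1 ∈ c.chart.source →
    LinearIndependent ℂ (fun i => f c i p)
  span : ∀ c, ∀ p ∈ nonzeroVectors m E, p.1 ∈ c.chart.source →
    ⊤ ≤ Submodule.span ℂ (Set.range fun i => f c i p)
  trans : ∀ c c', ∀ p ∈ nonzeroVectors m E, p.1 ∈ c.chart.source → p.1 ∈ c'.chart.source →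
    ∀ k α, f c' (k, α) p = ∑ β, conjIf (bar k) (c.trans c' β α p.1) • f c (k, β) p

namespace IsBlockFrame

variable {bar : κ → Bool} {f : HolChart n m M E → κ × Fin m → ∀ p, B p}
  (hf : IsBlockFrame bar f) (c c' : HolChart n m M E) {p : TotalSpace (Fin m → ℂ) E}

open Classical in
/-- The coefficients with respect to the frame of a chart. -/
def coef (i : κ × Fin m) (p : TotalSpace (Fin m → ℂ) E) : B p →ₗ[ℂ] ℂ :=
  if h : p ∈ nonzeroVectors m E ∧ p.1 ∈ c.chart.source then
    (Module.Basis.mk (hf.linearIndependent c p h.1 h.2) (hf.span c p h.1 h.2)).coord i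
  else 0

theorem sum_coef (hp0 : p ∈ nonzeroVectors m E) (hp : p.1 ∈ c.chart.source) (w : B p) :
    ∑ i, hf.coef c i p w • f c i p = w := by
  simpa [coef, hp0, hp] using
    (Module.Basis.mk (hf.linearIndependent c p hp0 hp) (hf.span c p hp0 hp)).sum_repr w

theorem coef_sum (hp0 : p ∈ nonzeroVectors m E) (hp : p.1 ∈ c.chart.source) (a : κ × Fin m → ℂ)
    (i : κ × Fin m) : hf.coef c i p (∑ j, a j • f c j p) = a i := by
  have h : ∑ j, a j • f c j p = (Module.Basis.mk (hf.linearIndependent c p hp0 hp)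
      (hf.span c p hp0 hp)).equivFun.symm a := by
    simp [Module.Basis.equivFun_symm_apply]
  rw [h, coef, dif_pos ⟨hp0, hp⟩, Module.Basis.coord_apply, ← Module.Basis.equivFun_apply,
    LinearEquiv.apply_symm_apply]

theorem coef_frame [DecidableEq κ] (hp0 : p ∈ nonzeroVectors m E) (hp : p.1 ∈ c.chart.source)
    (i j : κ × Fin m) : hf.coef c i p (f c j p) = if i = j then 1 else 0 := by
  have h := hf.coef_sum c hp0 hp (Pi.single j 1) i
  simpa [Pi.single_apply, ite_smul] using h

theorem eq_of_coef (hp0 : p ∈ nonzeroVectors m E) (hp : p.1 ∈ c.chart.source) {v w : B p}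
    (h : ∀ i, hf.coef c i p v = hf.coef c i p w) : v = w := by
  rw [← hf.sum_coef c hp0 hp v, ← hf.sum_coef c hp0 hp w]
  simp only [h]

/-- Since blocks do not mix under a change of charts, the coefficients of a vector in one block
involve only those of the same block. -/
theorem coef_trans (hp0 : p ∈ nonzeroVectors m E) (hp : p.1 ∈ c.chart.source)
    (hp' : p.1 ∈ c'.chart.source) (k : κ) (γ : Fin m) (w : B p) :
    hf.coef c (k, γ) p w =
      ∑ α, conjIf (bar k) (c.trans c' γ α p.1) * hf.coef c' (k, α) p w := by
  have h : w = ∑ j : κ × Fin m, (∑ α, conjIf (bar j.1) (c.trans c' j.2 α p.1) *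
      hf.coef c' (j.1, α) p w) • f c j p := by
    conv_lhs => rw [← hf.sum_coef c' hp0 hp' w]
    rw [Fintype.sum_prod_type, Fintype.sum_prod_type]
    refine Finset.sum_congr rfl fun k _ => ?_
    simp only [hf.trans c c' p hp0 hp hp', Finset.smul_sum, Finset.sum_smul, smul_smul]
    rw [Finset.sum_comm]
    simp only [mul_comm]
  conv_lhs => rw [h]
  rw [hf.coef_sum c hp0 hp]

/-- `SmoothSectionAt` provides smooth coefficients in some chart only; the smooth transition
functions carry this over to every chart around the point. -/
theorem smoothFunAt_coef (hp0 : p ∈ nonzeroVectors m E) (hp : p.1 ∈ c.chart.source)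
    {s : ∀ q, B q} (hs : SmoothSectionAt f s p) (i : κ × Fin m) :
    SmoothFunAt n (fun q => hf.coef c i q (s q)) p := by
  obtain ⟨c', hp', a, ha, hsa⟩ := hs
  obtain ⟨k, γ⟩ := i
  refine (SmoothFunAt.sum (s := Finset.univ) fun α _ =>
    ((c.smoothFunAt_trans c' hp hp' γ α).conjIf (bar k)).mul (ha (k, α))).congr ?_
  filter_upwards [hsa, c.eventually_nonzero_base hp hp0,
    eventually_mem_base c'.chart.open_source hp'] with q hq hqc hqc'
  rw [hf.coef_trans c c' hqc.1 hqc.2 hqc', hq]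
  simp only [hf.coef_sum c' hqc.1 hqc']

theorem smoothSectionAt_of_coef (hp0 : p ∈ nonzeroVectors m E) (hp : p.1 ∈ c.chart.source)
    {s : ∀ q, B q} (hs : ∀ i, SmoothFunAt n (fun q => hf.coef c i q (s q)) p) :
    SmoothSectionAt f s p := by
  refine ⟨c, hp, fun i q => hf.coef c i q (s q), hs, ?_⟩
  filter_upwards [c.eventually_nonzero_base hp hp0] with q hq
  exact (hf.sum_coef c hq.1 hq.2 _).symm

theorem _root_.FinslerAlgebroid.SmoothSectionAt.eventually {ι : Type} [Fintype ι]
    {f : HolChart n m M E → ι → ∀ p, B p} {s : ∀ q, B q} (hs : SmoothSectionAt f s p) :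
    ∀ᶠ q in 𝓝 p, SmoothSectionAt f s q := by
  obtain ⟨c, hp, a, ha, hsa⟩ := hs
  filter_upwards [eventually_mem_base c.chart.open_source hp,
    Filter.eventually_all.2 fun i => (ha i).eventually, hsa.eventually_nhds] with q h1 h2 h3
  exact ⟨c, h1, a, h2, h3⟩

/-- The covariant derivative computed in a chart. -/
def nabla (F : TotalSpace (Fin m → ℂ) E → ℝ) (p : TotalSpace (Fin m → ℂ) E)
    (X : ℂ ⊗[ℝ] TangentSpace (IE n m) p) (s : ∀ q, B q) : B p :=
  ∑ i : κ × Fin m, (vecAct X (fun q => hf.coef c i q (s q)) +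
    ∑ β, c.blockForm F (bar i.1) p X i.2 β * hf.coef c (i.1, β) p (s p)) • f c i p

variable {F : TotalSpace (Fin m → ℂ) E → ℝ}

theorem coef_nabla (hp0 : p ∈ nonzeroVectors m E) (hp : p.1 ∈ c.chart.source)
    (X : ℂ ⊗[ℝ] TangentSpace (IE n m) p) (s : ∀ q, B q) (k : κ) (α : Fin m) :
    hf.coef c (k, α) p (hf.nabla c F p X s) = vecAct X (fun q => hf.coef c (k, α) q (s q)) +
      ∑ β, c.blockForm F (bar k) p X α β * hf.coef c (k, β) p (s p) :=
  hf.coef_sum c hp0 hp _ _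

/-- Substituting `s = T s'` in the first chart produces the extra term `X(T) s'`, which the
inhomogeneous term of `blockForm_trans` cancels exactly. -/
theorem nabla_eq_nabla (hF : IsFinslerStructure n F) (hconv : IsConvex n F)
    (hp0 : p ∈ nonzeroVectors m E) (hp : p.1 ∈ c.chart.source) (hp' : p.1 ∈ c'.chart.source)
    (X : ℂ ⊗[ℝ] TangentSpace (IE n m) p) {s : ∀ q, B q} (hs : SmoothSectionAt f s p) :
    hf.nabla c F p X s = hf.nabla c' F p X s := by
  refine hf.eq_of_coef c hp0 hp ?_
  rintro ⟨k, γ⟩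
  rw [hf.coef_nabla c hp0 hp, hf.coef_trans c c' hp0 hp hp']
  simp only [hf.coef_nabla c' hp0 hp']
  have h1 : (fun q => hf.coef c (k, γ) q (s q)) =ᶠ[𝓝 p] fun q =>
      ∑ α, conjIf (bar k) (c.trans c' γ α q.1) * hf.coef c' (k, α) q (s q) := by
    filter_upwards [c.eventually_nonzero_base hp hp0,
      eventually_mem_base c'.chart.open_source hp'] with q hq hq'
    exact hf.coef_trans c c' hq.1 hq.2 hq' k γ (s q)
  have h2 : ∀ α, RealDiffAt n (fun q : TotalSpace (Fin m → ℂ) E =>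
      conjIf (bar k) (c.trans c' γ α q.1)) p :=
    fun α => ((c.smoothFunAt_trans c' hp hp' γ α).conjIf _).realDiffAt
  have h3 : ∀ α, RealDiffAt n (fun q => hf.coef c' (k, α) q (s q)) p :=
    fun α => (hf.smoothFunAt_coef c' hp0 hp' hs (k, α)).realDiffAt
  rw [vecAct_congr _ h1, vecAct_fun_sum _ _ fun α _ => RealDiffAt.mul (h2 α) (h3 α)]
  simp only [vecAct_fun_mul _ (h2 _) (h3 _), hf.coef_trans c c' hp0 hp hp', Finset.mul_sum,
    mul_add, Finset.sum_add_distrib]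
  rw [add_assoc]
  congr 1
  -- The gauge law solved for the derivative of the transition function; the rest is reordering of
  -- finite sums.
  have h4 : ∀ α, vecAct X (fun q => conjIf (bar k) (c.trans c' γ α q.1)) =
      ∑ β, conjIf (bar k) (c.trans c' γ β p.1) * c'.blockForm F (bar k) p X β α -
        ∑ β, c.blockForm F (bar k) p X γ β * conjIf (bar k) (c.trans c' β α p.1) :=
    fun α => eq_sub_of_add_eq (c.blockForm_trans c' hF hconv hp hp' hp0 (bar k) X γ α)
  simp only [h4, mul_sub, Finset.sum_sub_distrib, Finset.mul_sum]
  rw [Finset.sum_comm (f := fun β α => c.blockForm F (bar k) p X γ β *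
    (conjIf (bar k) (c.trans c' β α p.1) * hf.coef c' (k, α) p (s p)))]
  rw [Finset.sum_comm (f := fun α β => conjIf (bar k) (c.trans c' γ α p.1) *
    (c'.blockForm F (bar k) p X α β * hf.coef c' (k, β) p (s p)))]
  rw [sub_add_eq_add_sub, sub_eq_iff_eq_add]
  congr 1
  all_goals
    refine Finset.sum_congr rfl fun α _ => Finset.sum_congr rfl fun β _ => ?_
    ring

/-- The Chern-Finsler connection of a bundle with block frames. -/
def conn (F : TotalSpace (Fin m → ℂ) E → ℝ) (p : TotalSpace (Fin m → ℂ) E)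
    (X : ℂ ⊗[ℝ] TangentSpace (IE n m) p) (s : ∀ q, B q) : B p :=
  hf.nabla (holChartAt p.1) F p X s

theorem conn_eq (hF : IsFinslerStructure n F) (hconv : IsConvex n F)
    (hp0 : p ∈ nonzeroVectors m E) (hp : p.1 ∈ c.chart.source)
    (X : ℂ ⊗[ℝ] TangentSpace (IE n m) p) {s : ∀ q, B q} (hs : SmoothSectionAt f s p) :
    hf.conn F p X s = hf.nabla c F p X s :=
  hf.nabla_eq_nabla _ c hF hconv hp0 (mem_holChartAt p.1) hp X hs

end IsBlockFrame

end BlockFrame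

/-! ### Properties of the Chern-Finsler connection of a block frame -/

section Connection

variable {Q B : TotalSpace (Fin m → ℂ) E → Type*}
  [∀ p, AddCommGroup (Q p)] [∀ p, Module ℂ (Q p)]
  [∀ p, AddCommGroup (B p)] [∀ p, Module ℂ (B p)]
  {a : ∀ p, Q p →ₗ[ℂ] ℂ ⊗[ℝ] TangentSpace (IE n m) p}
  {smoothQ : (∀ p, Q p) → TotalSpace (Fin m → ℂ) E → Prop}
  {smoothB : (∀ p, B p) → TotalSpace (Fin m → ℂ) E → Prop}
  {D : ∀ p, Q p → (∀ q, B q) → B p} {S : Set (TotalSpace (Fin m → ℂ) E)}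
  {p : TotalSpace (Fin m → ℂ) E}

/-- A connection depends only on germs of sections. -/
theorem IsConnectionOn.congr (hD : IsConnectionOn S a smoothQ smoothB D) (hp : p ∈ S) (X : Q p)
    {s t : ∀ q, B q} (hs : smoothB s p) (ht : smoothB t p) (h : ∀ᶠ q in 𝓝 p, s q = t q) :
    D p X s = D p X t := by
  classical
  -- Smoothness is required only near `p`, so the indicator of the set where the sections agree
  -- serves as cut-off function, and `χ s = χ t` holds everywhere.
  let χ : TotalSpace (Fin m → ℂ) E → ℂ := fun q => if s q = t q then 1 else 0
  have h1 : χ =ᶠ[𝓝 p] fun _ => 1 := by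
    filter_upwards [h] with q hq
    simp [χ, hq]
  have hχ : SmoothFunAt n χ p := (smoothFunAt_const 1).congr h1
  have h2 : ∀ r, smoothB r p → D p X (fun q => χ q • r q) = D p X r := fun r hr => by
    rw [hD.leibniz p hp X χ r hχ hr, vecAct_congr _ h1, vecAct_const, h1.self_of_nhds, one_smul,
      zero_smul, add_zero]
  rw [← h2 s hs, ← h2 t ht]
  congr 1
  funext q
  by_cases hq : s q = t q
  · simp [χ, hq]
  · simp [χ, hq]

theorem IsConnectionOn.zero_section (hD : IsConnectionOn S a smoothQ smoothB D) (hp : p ∈ S)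
    (X : Q p) {s : ∀ q, B q} (hs : smoothB s p) : D p X (fun _ => 0) = 0 := by
  have h := hD.leibniz p hp X (fun _ => 0) s (smoothFunAt_const 0) hs
  simpa [vecAct_const] using h

variable {κ : Type} [Fintype κ] {bar : κ → Bool} {f : HolChart n m M E → κ × Fin m → ∀ p, B p}
  (hf : IsBlockFrame bar f) {F : TotalSpace (Fin m → ℂ) E → ℝ} (c : HolChart n m M E)

theorem smoothSectionAt_sum_frame (hp : p.1 ∈ c.chart.source)
    {b : κ × Fin m → TotalSpace (Fin m → ℂ) E → ℂ} (hb : ∀ i, SmoothFunAt n (b i) p)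
    (t : Finset (κ × Fin m)) : SmoothSectionAt f (fun q => ∑ i ∈ t, b i q • f c i q) p := by
  classical
  refine ⟨c, hp, fun i q => if i ∈ t then b i q else 0, fun i => ?_,
    Filter.Eventually.of_forall fun q => ?_⟩
  · by_cases hi : i ∈ t
    · simpa [hi] using hb i
    · simpa [hi] using smoothFunAt_const 0
  · simp [ite_smul, Finset.sum_ite_mem]

theorem smoothSectionAt_frame (hp : p.1 ∈ c.chart.source) (i : κ × Fin m) :
    SmoothSectionAt f (f c i) p := by
  classical
  have h := smoothSectionAt_sum_frame (f := f) c hp (b := fun _ _ => 1)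
    (fun _ => smoothFunAt_const 1) {i}
  simpa using h

/-- The axioms give additivity for two smooth sections only, so the sum is built up term by term,
with smoothness of each partial sum supplied along the way. -/
theorem IsConnectionOn.sum_frame (hD : IsConnectionOn (nonzeroVectors m E) a smoothQ smoothB D)
    (hB : ∀ p ∈ nonzeroVectors m E, ∀ s, SmoothSectionAt f s p → smoothB s p)
    (hp0 : p ∈ nonzeroVectors m E) (hp : p.1 ∈ c.chart.source) (X : Q p)
    {b : κ × Fin m → TotalSpace (Fin m → ℂ) E → ℂ} (hb : ∀ i, SmoothFunAt n (b i) p)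
    (t : Finset (κ × Fin m)) : D p X (fun q => ∑ i ∈ t, b i q • f c i q) =
      ∑ i ∈ t, (b i p • D p X (f c i) + vecAct (a p X) (b i) • f c i p) := by
  classical
  induction t using Finset.induction_on with
  | empty =>
    have h := smoothSectionAt_sum_frame (f := f) c hp hb ∅
    simpa using hD.zero_section hp0 X (hB p hp0 _ h)
  | insert i t hi ih =>
    have h1 := hB p hp0 _ (smoothSectionAt_frame (f := f) c hp i)
    have h2 : smoothB (fun q => b i q • f c i q) p := by
      refine hB p hp0 _ ?_
      simpa using smoothSectionAt_sum_frame (f := f) c hp hb {i}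
    simp only [Finset.sum_insert hi]
    rw [hD.add p hp0 X _ _ h2 (hB p hp0 _ (smoothSectionAt_sum_frame c hp hb t)),
      hD.leibniz p hp0 X _ _ (hb i) h1, ih]

/-- A connection is determined by the derivatives of the vectors of the frames. -/
theorem IsConnectionOn.eq_of_frame (hf : IsBlockFrame bar f) {D' : ∀ p, Q p → (∀ q, B q) → B p}
    (hD : IsConnectionOn (nonzeroVectors m E) a smoothQ smoothB D)
    (hD' : IsConnectionOn (nonzeroVectors m E) a smoothQ smoothB D')
    (hB : ∀ p ∈ nonzeroVectors m E, ∀ s, smoothB s p ↔ SmoothSectionAt f s p)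
    (hp0 : p ∈ nonzeroVectors m E) (hp : p.1 ∈ c.chart.source) (X : Q p)
    (h : ∀ i, D p X (f c i) = D' p X (f c i)) {s : ∀ q, B q} (hs : smoothB s p) :
    D p X s = D' p X s := by
  have hB' := fun p hp s => (hB p hp s).2
  have h1 : ∀ i, SmoothFunAt n (fun q => hf.coef c i q (s q)) p :=
    hf.smoothFunAt_coef c hp0 hp ((hB p hp0 s).1 hs)
  have h2 := hB' p hp0 _ (smoothSectionAt_sum_frame (f := f) c hp h1 Finset.univ)
  have h3 : ∀ᶠ q in 𝓝 p, s q = ∑ i, hf.coef c i q (s q) • f c i q := by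
    filter_upwards [c.eventually_nonzero_base hp hp0] with q hq
    exact (hf.sum_coef c hq.1 hq.2 _).symm
  rw [hD.congr hp0 X hs h2 h3, hD'.congr hp0 X hs h2 h3, hD.sum_frame c hB' hp0 hp X h1,
    hD'.sum_frame c hB' hp0 hp X h1]
  simp only [h]

namespace IsBlockFrame

/-- The bundle of directions enters only through its anchor, so one proof serves both connections:
directions in `𝒯_ℂE` with anchor `ρ_𝒯`, and directions in `T_ℂE` with the identity. -/
theorem isConnectionOn_conn (hF : IsFinslerStructure n F) (hconv : IsConvex n F)
    (hQ : ∀ p ∈ nonzeroVectors m E, ∀ X, smoothQ X p → SmoothT (fun q => a q (X q)) p)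
    (hB : ∀ p ∈ nonzeroVectors m E, ∀ s, smoothB s p ↔ SmoothSectionAt f s p) :
    IsConnectionOn (nonzeroVectors m E) a smoothQ smoothB
      (fun p X s => hf.conn F p (a p X) s) where
  add_direction p hp0 X Y s _ := by
    simp only [conn, nabla, map_add, vecAct_add, HolChart.blockForm_add, add_mul,
      Finset.sum_add_distrib, add_smul]
    abel
  smul_direction p hp0 l X s _ := by
    simp only [conn, nabla, map_smul, vecAct_smul, HolChart.blockForm_smul, mul_assoc,
      ← Finset.mul_sum, ← mul_add, mul_smul, ← Finset.smul_sum]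
  add p hp0 X s t hs ht := by
    have h1 := hf.smoothFunAt_coef _ hp0 (mem_holChartAt p.1) ((hB p hp0 s).1 hs)
    have h2 := hf.smoothFunAt_coef _ hp0 (mem_holChartAt p.1) ((hB p hp0 t).1 ht)
    simp only [conn, nabla, map_add, vecAct_fun_add _ (h1 _).realDiffAt (h2 _).realDiffAt, mul_add,
      Finset.sum_add_distrib, add_smul]
    abel
  leibniz p hp0 X g s hg hs := by
    have h1 := hf.smoothFunAt_coef _ hp0 (mem_holChartAt p.1) ((hB p hp0 s).1 hs)
    simp only [conn]
    refine hf.eq_of_coef _ hp0 (mem_holChartAt p.1) ?_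
    rintro ⟨k, α⟩
    simp only [map_add, map_smul, smul_eq_mul, hf.coef_nabla _ hp0 (mem_holChartAt p.1),
      vecAct_fun_mul _ hg.realDiffAt (h1 _).realDiffAt, mul_add, Finset.mul_sum,
      mul_left_comm _ (g p)]
    ring
  smooth p hp0 X s hX hs := by
    have hs' := (hB p hp0 s).1 hs
    have hp := mem_holChartAt (n := n) (m := m) (E := E) p.1
    have h1 := hf.smoothFunAt_coef _ hp0 hp hs'
    refine (hB p hp0 _).2 (hf.smoothSectionAt_of_coef _ hp0 hp ?_)
    rintro ⟨k, α⟩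
    have hX' := hQ p hp0 X hX
    refine ((hX'.vecAct (h1 (k, α))).add (SmoothFunAt.sum (s := Finset.univ) fun β _ =>
      (HolChart.smoothFunAt_blockForm _ hF hconv hp hp0 hX' (bar k) α β).mul (h1 (k, β)))).congr ?_
    -- At `q` the connection is computed in the chart chosen for `q`; independence of the chart,
    -- which needs `s` to be smooth at `q`, moves it to the fixed chart of `p`.
    filter_upwards [HolChart.eventually_nonzero_base _ hp hp0, hs'.eventually] with q hq hsq
    rw [hf.conn_eq _ hF hconv hq.1 hq.2 _ hsq, hf.coef_nabla _ hq.1 hq.2]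

/-- The connection preserves the subbundles spanned by blocks. -/
theorem coef_conn_eq_zero (hF : IsFinslerStructure n F) (hconv : IsConvex n F)
    (hp0 : p ∈ nonzeroVectors m E) (hp : p.1 ∈ c.chart.source)
    (X : ℂ ⊗[ℝ] TangentSpace (IE n m) p) {s : ∀ q, B q} (hs : SmoothSectionAt f s p) (k : κ)
    (h : ∀ᶠ q in 𝓝 p, ∀ α, hf.coef c (k, α) q (s q) = 0) (α : Fin m) :
    hf.coef c (k, α) p (hf.conn F p X s) = 0 := by
  have h1 : (fun q => hf.coef c (k, α) q (s q)) =ᶠ[𝓝 p] fun _ => 0 := by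
    filter_upwards [h] with q hq
    exact hq α
  rw [hf.conn_eq c hF hconv hp0 hp X hs, hf.coef_nabla c hp0 hp, vecAct_congr _ h1, vecAct_const,
    zero_add]
  simp [h.self_of_nhds]

/-- The connection coefficients in a frame. -/
theorem conn_frame (hF : IsFinslerStructure n F) (hconv : IsConvex n F)
    (hp0 : p ∈ nonzeroVectors m E) (hp : p.1 ∈ c.chart.source)
    (X : ℂ ⊗[ℝ] TangentSpace (IE n m) p) (k : κ) (α : Fin m) :
    hf.conn F p X (f c (k, α)) = ∑ γ, c.blockForm F (bar k) p X γ α • f c (k, γ) p := by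
  classical
  rw [hf.conn_eq c hF hconv hp0 hp X (smoothSectionAt_frame c hp _)]
  have h1 : ∀ i, (fun q => hf.coef c i q (f c (k, α) q)) =ᶠ[𝓝 p] fun _ =>
      if i = (k, α) then 1 else 0 := by
    intro i
    filter_upwards [c.eventually_nonzero_base hp hp0] with q hq
    exact hf.coef_frame c hq.1 hq.2 i _
  simp only [nabla, vecAct_congr _ (h1 _), vecAct_const, hf.coef_frame c hp0 hp, zero_add,
    Prod.mk.injEq, Fintype.sum_prod_type]
  rw [Finset.sum_eq_single k]
  · simp
  · intro k' _ hk'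
    simp [hk']
  · simp

/-- An antilinear map which permutes the blocks by `τ` conjugates the coefficients and permutes them
accordingly. -/
theorem coef_conj (τ : Equiv.Perm κ) (conjB : ∀ p, B p → B p)
    (hadd : ∀ p v w, conjB p (v + w) = conjB p v + conjB p w)
    (hsmul : ∀ p (z : ℂ) v, conjB p (z • v) = star z • conjB p v)
    (hframe : ∀ c, ∀ p ∈ nonzeroVectors m E, p.1 ∈ c.chart.source → ∀ k α,
      conjB p (f c (k, α) p) = f c (τ k, α) p)
    (hp0 : p ∈ nonzeroVectors m E) (hp : p.1 ∈ c.chart.source) (w : B p) (k : κ) (α : Fin m) :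
    hf.coef c (τ k, α) p (conjB p w) = star (hf.coef c (k, α) p w) := by
  let φ : B p →+ B p := AddMonoidHom.mk' (conjB p) (hadd p)
  have h1 : conjB p w = ∑ i : κ × Fin m, star (hf.coef c (τ.symm i.1, i.2) p w) • f c i p := by
    have h2 : φ w = φ (∑ i, hf.coef c i p w • f c i p) := by rw [hf.sum_coef c hp0 hp]
    change φ w = _
    rw [h2, map_sum]
    refine Fintype.sum_equiv (τ.prodCongr (Equiv.refl _)) _ _ ?_
    rintro ⟨k, α⟩
    change conjB p _ = _
    rw [hsmul, hframe c p hp0 hp]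
    simp
  rw [h1, hf.coef_sum c hp0 hp]
  simp

/-- The connection commutes with conjugation. -/
theorem conn_conj (τ : Equiv.Perm κ)
    (hτ : ∀ k, bar (τ k) = !bar k) (conjB : ∀ p, B p → B p)
    (hadd : ∀ p v w, conjB p (v + w) = conjB p v + conjB p w)
    (hsmul : ∀ p (z : ℂ) v, conjB p (z • v) = star z • conjB p v)
    (hframe : ∀ c, ∀ p ∈ nonzeroVectors m E, p.1 ∈ c.chart.source → ∀ k α,
      conjB p (f c (k, α) p) = f c (τ k, α) p)
    (hp0 : p ∈ nonzeroVectors m E) (X : ℂ ⊗[ℝ] TangentSpace (IE n m) p) {s : ∀ q, B q}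
    (hs : SmoothSectionAt f s p) :
    hf.conn F p (conjC X) (fun q => conjB q (s q)) = conjB p (hf.conn F p X s) := by
  have hp := mem_holChartAt (n := n) (m := m) (E := E) p.1
  refine hf.eq_of_coef _ hp0 hp ?_
  rintro ⟨k', α⟩
  obtain ⟨k, rfl⟩ := τ.surjective k'
  rw [hf.coef_conj _ τ conjB hadd hsmul hframe hp0 hp]
  simp only [conn]
  rw [hf.coef_nabla _ hp0 hp, hf.coef_nabla _ hp0 hp, hτ]
  have h1 : (fun q => hf.coef (holChartAt p.1) (τ k, α) q (conjB q (s q))) =ᶠ[𝓝 p]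
      fun q => star (hf.coef (holChartAt p.1) (k, α) q (s q)) := by
    filter_upwards [HolChart.eventually_nonzero_base _ hp hp0] with q hq
    exact hf.coef_conj _ τ conjB hadd hsmul hframe hq.1 hq.2 _ _ _
  rw [vecAct_congr _ h1, vecAct_conjC_star _ (hf.smoothFunAt_coef _ hp0 hp hs _).realDiffAt,
    star_add, star_sum]
  simp only [hf.coef_conj _ τ conjB hadd hsmul hframe hp0 hp, HolChart.blockForm_conj, star_mul']

end IsBlockFrame

end Connection

/-! ### The adapted frames -/

/-! ### Conjugations of the two bundles and independence of conjugate families. -/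

section Conjugation

variable {A : HolomorphicLieAlgebroid n m M E} {p : TotalSpace (Fin m → ℂ) E}

theorem conjV_add (v w : VertC n p) : conjV (v + w) = conjV v + conjV w :=
  Subtype.ext (map_add conjC v.1 w.1)

theorem conjV_smul (z : ℂ) (v : VertC n p) : conjV (z • v) = star z • conjV v :=
  Subtype.ext (conjC_smul z v.1)

theorem conjV_conjV (v : VertC n p) : conjV (conjV v) = v := Subtype.ext (conjC_conjC v.1)

theorem conjT_add (v w : Prolongation A p) : conjT (v + w) = conjT v + conjT w :=
  Subtype.ext (Prod.ext (map_add conjC v.1.1 w.1.1) (map_add conjC v.1.2 w.1.2))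

theorem conjT_smul (z : ℂ) (v : Prolongation A p) : conjT (z • v) = star z • conjT v :=
  Subtype.ext (Prod.ext (conjC_smul z v.1.1) (conjC_smul z v.1.2))

theorem conjT_conjT (v : Prolongation A p) : conjT (conjT v) = v :=
  Subtype.ext (Prod.ext (conjC_conjC v.1.1) (conjC_conjC v.1.2))

theorem vertIncl_conjV (v : VertC n p) : vertIncl A p (conjV v) = conjT (vertIncl A p v) :=
  Subtype.ext (Prod.ext (map_zero conjC).symm rfl)

variable {W U : Type*} [AddCommGroup W] [Module ℂ W] [AddCommGroup U] [Module ℂ U]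
  {ι : Type*} [Fintype ι] {σ : W → W}

/-- The linear map `l` annihilates the conjugate family and keeps the original one independent, so
the first coefficients vanish. Applying the involution `σ` exchanges the two families and settles
the others. -/
theorem linearIndependent_conj (hadd : ∀ v w, σ (v + w) = σ v + σ w)
    (hsmul : ∀ (z : ℂ) v, σ (z • v) = star z • σ v) (hσ : ∀ v, σ (σ v) = v) (l : W →ₗ[ℂ] U)
    {w : ι → W} (hw : LinearIndependent ℂ (fun i => l (w i))) (h0 : ∀ i, l (σ (w i)) = 0)
    {a b : ι → ℂ} (h : ∑ i, a i • w i + ∑ i, b i • σ (w i) = 0) : a = 0 ∧ b = 0 := by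
  let φ : W →+ W := AddMonoidHom.mk' σ hadd
  have h1 : ∀ a b : ι → ℂ, ∑ i, a i • w i + ∑ i, b i • σ (w i) = 0 → a = 0 := by
    intro a b h
    have := congrArg l h
    simp only [map_add, map_sum, map_smul, h0, smul_zero, Finset.sum_const_zero, add_zero,
      map_zero] at this
    exact funext fun i => Fintype.linearIndependent_iff.1 hw a this i
  refine ⟨h1 a b h, ?_⟩
  have h2 := congrArg φ h
  simp only [map_add, map_sum, map_zero] at h2
  have h3 : ∑ i, star (b i) • w i + ∑ i, star (a i) • σ (w i) = 0 := by
    rw [add_comm, ← h2]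
    congr 1
    · exact Finset.sum_congr rfl fun i _ => (hsmul _ _).symm
    · refine Finset.sum_congr rfl fun i _ => ?_
      change _ = σ _
      rw [hsmul, hσ]
  funext i
  simpa using congrFun (h1 _ _ h3) i

end Conjugation

namespace HolChart

variable {A : HolomorphicLieAlgebroid n m M E} {F : TotalSpace (Fin m → ℂ) E → ℝ}
  (c c' : HolChart n m M E) {p : TotalSpace (Fin m → ℂ) E}

theorem coordDiff_fst (hp : p.1 ∈ c.chart.source) (v : TangentSpace (IE n m) p) :
    (c.coordDiff p v).1 = (mfderiv (IM n) 𝓘(ℂ, Fin n → ℂ) c.chart p.1 :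
      (Fin n → ℂ) →L[ℂ] (Fin n → ℂ)) (mfderiv (IE n m) (IM n)
        (TotalSpace.proj : TotalSpace (Fin m → ℂ) E → M) p v) := by
  have h1 := ((c.contMDiffAt_coord hp).mdifferentiableAt (by simp)).hasMFDerivAt
  have h2 : HasMFDerivAt (IE n m) 𝓘(ℂ, Fin n → ℂ) (Prod.fst ∘ c.coord) p _ :=
    HasMFDerivAt.comp p (hasFDerivAt_fst (𝕜 := ℂ)).hasMFDerivAt h1
  have h3 := (contMDiffAt_of_mem_maximalAtlas c.chart_mem hp).mdifferentiableAt (by simp)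
  have h4 : HasMFDerivAt (IE n m) 𝓘(ℂ, Fin n → ℂ) (c.chart ∘ TotalSpace.proj) p _ :=
    HasMFDerivAt.comp p h3.hasMFDerivAt (mdifferentiableAt_proj E).hasMFDerivAt
  exact congrArg (fun L : (Fin n → ℂ) × (Fin m → ℂ) →L[ℂ] (Fin n → ℂ) => L v)
    (hasMFDerivAt_unique h2 h4)

theorem hol_eq_sum (hp : p.1 ∈ c.chart.source) (v : TangentSpace (IE n m) p) :
    hol v = ∑ k, (c.coordDiff p v).1 k • c.dz k p + ∑ β, (c.coordDiff p v).2 β • c.du β p := by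
  have h : c.coordDiff p v =
      ∑ k, (c.coordDiff p v).1 k • ((Pi.single k 1, 0) : (Fin n → ℂ) × (Fin m → ℂ)) +
        ∑ β, (c.coordDiff p v).2 β • ((0, Pi.single β 1) : (Fin n → ℂ) × (Fin m → ℂ)) := by
    ext i
    · simp [Prod.fst_sum, Finset.sum_apply, Pi.single_apply]
    · simp [Prod.snd_sum, Finset.sum_apply, Pi.single_apply]
  conv_lhs => rw [← c.coordVec_coordDiff hp v, h]
  simp only [coordVec_eq, dz, du, map_add, map_sum, map_smul]

/-- The base components of `v` are those of its projection, which here is the anchor of `e`,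
expanded in the frame. Hence `v` lies in the span of the `∂_α` and `∂̇_β`, even though the `∂_α` may
be dependent. -/
theorem coordDiff_fst_of_anchor (hp : p.1 ∈ c.chart.source) {e : E p.1}
    {v : TangentSpace (IE n m) p}
    (h : A.anchor p.1 e = mfderiv (IE n m) (IM n)
      (TotalSpace.proj : TotalSpace (Fin m → ℂ) E → M) p v) (k : Fin n) :
    (c.coordDiff p v).1 k = ∑ α, c.isFrame.coeff α p.1 e * c.rho A k α p.1 := by
  rw [c.coordDiff_fst hp, ← h]
  let L : E p.1 →ₗ[ℂ] ℂ := (LinearMap.proj k : (Fin n → ℂ) →ₗ[ℂ] ℂ) ∘ₗ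
    ((mfderiv (IM n) 𝓘(ℂ, Fin n → ℂ) c.chart p.1 :
      (Fin n → ℂ) →L[ℂ] (Fin n → ℂ)).toLinearMap) ∘ₗ (A.anchor p.1)
  change L e = ∑ α, c.isFrame.coeff α p.1 e • L (c.frame α p.1)
  conv_lhs => rw [← c.sum_coeff hp e]
  rw [map_sum]
  simp only [map_smul]

theorem hol_eq_sum_of_anchor (hp : p.1 ∈ c.chart.source) {e : E p.1}
    {v : TangentSpace (IE n m) p}
    (h : A.anchor p.1 e = mfderiv (IE n m) (IM n)
      (TotalSpace.proj : TotalSpace (Fin m → ℂ) E → M) p v) :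
    hol v = ∑ α, c.isFrame.coeff α p.1 e • c.dA A α p +
      ∑ β, (c.coordDiff p v).2 β • c.du β p := by
  rw [c.hol_eq_sum hp]
  simp only [c.coordDiff_fst_of_anchor hp h, dA, Finset.smul_sum, Finset.sum_smul, smul_smul]
  rw [Finset.sum_comm]

theorem zT_val (hp : p.1 ∈ c.chart.source) (α : Fin m) :
    (c.zT A α p).1 = (hol (c.frame α p.1), c.dA A α p) := by
  rw [zT, dif_pos hp]

theorem duV_val (hp : p.1 ∈ c.chart.source) (α : Fin m) : (c.duV α p).1 = c.du α p := by
  rw [duV, dif_pos hp]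

theorem vT_val (hp : p.1 ∈ c.chart.source) (α : Fin m) : (c.vT A α p).1 = (0, c.du α p) := by
  rw [vT, ← c.duV_val hp]
  rfl

theorem xT_val (hp : p.1 ∈ c.chart.source) (α : Fin m) :
    (c.xT A F α p).1 =
      (hol (c.frame α p.1), c.dA A α p - ∑ β, c.NA A F β α p • c.du β p) := by
  simp only [xT, Submodule.coe_sub, Submodule.coe_sum, Submodule.coe_smul, c.zT_val hp,
    c.vT_val hp]
  ext
  · simp [Prod.fst_sum]
  · simp [Prod.snd_sum]

theorem deltaA_eq (hp : p.1 ∈ c.chart.source) (α : Fin m) :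
    c.deltaA A F α p = c.dA A α p - ∑ β, c.NA A F β α p • c.du β p :=
  congrArg Prod.snd (c.xT_val hp α)

theorem NA_eq_sum (β α : Fin m) :
    c.NA A F β α p = ∑ k, c.rho A k α p.1 * c.Nz F β k p := by
  simp only [NA, Nz, dA, vecAct_sum, vecAct_smul, Finset.mul_sum]
  rw [Finset.sum_comm]
  exact Finset.sum_congr rfl fun k _ => Finset.sum_congr rfl fun σ _ => by ring

theorem deltaA_eq_sum (hp : p.1 ∈ c.chart.source) (α : Fin m) :
    c.deltaA A F α p = ∑ k, c.rho A k α p.1 • c.deltaz F k p := by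
  rw [c.deltaA_eq hp]
  simp only [deltaz, smul_sub, Finset.sum_sub_distrib, NA_eq_sum, dA, Finset.sum_smul,
    Finset.smul_sum, smul_smul]
  congr 1
  exact Finset.sum_comm

theorem LA_eq_sum (hp : p.1 ∈ c.chart.source) (α β γ : Fin m) :
    c.LA A F γ α β p =
      ∑ σ, c.hInv F σ γ p * vecAct (c.deltaA A F β p) (fun q => c.h F q α σ) := by
  simp only [LA, Lz, c.deltaA_eq_sum hp, vecAct_sum, vecAct_smul, Finset.mul_sum]
  rw [Finset.sum_comm]
  exact Finset.sum_congr rfl fun k _ => Finset.sum_congr rfl fun σ _ => by ring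

theorem holCoeff_dz (k : Fin n) : hol (holCoeff (c.dz k p)) = c.dz k p := by
  rw [dz, holCoeff_hol]

theorem holCoeff_du (α : Fin m) : hol (holCoeff (c.du α p)) = c.du α p := by
  rw [du, holCoeff_hol]

theorem holCoeff_dA (α : Fin m) : hol (holCoeff (c.dA A α p)) = c.dA A α p := by
  simp only [dA, map_sum, map_smul, holCoeff_dz]

theorem holCoeff_deltaz (k : Fin n) : hol (holCoeff (c.deltaz F k p)) = c.deltaz F k p := by
  simp only [deltaz, map_sub, map_sum, map_smul, holCoeff_dz, holCoeff_du]

theorem holCoeff_deltaA (hp : p.1 ∈ c.chart.source) (α : Fin m) :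
    hol (holCoeff (c.deltaA A F α p)) = c.deltaA A F α p := by
  simp only [c.deltaA_eq hp, map_sub, map_sum, map_smul, holCoeff_dA, holCoeff_du]

theorem sum_NA_mul_h (hconv : IsConvex n F) (hp : p.1 ∈ c.chart.source)
    (hp0 : p ∈ nonzeroVectors m E) (α σ : Fin m) :
    ∑ β, c.NA A F β α p * c.h F p β σ = vecAct (c.dA A α p) (c.dbarF F σ) := by
  have h1 : (c.h F p)⁻¹ * c.h F p = 1 :=
    Matrix.nonsing_inv_mul _ (c.det_h_ne_zero hconv hp hp0).isUnit
  have h2 : ∀ τ, ∑ β, c.hInv F τ β p * c.h F p β σ = if τ = σ then 1 else 0 := by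
    intro τ
    have h3 := congrFun (congrFun h1 τ) σ
    simp only [Matrix.mul_apply, Matrix.one_apply] at h3
    exact h3
  simp only [NA, Finset.sum_mul]
  rw [Finset.sum_comm]
  have h4 : ∀ τ, ∑ β, c.hInv F τ β p * vecAct (c.dA A α p) (c.dbarF F τ) * c.h F p β σ =
      (if τ = σ then 1 else 0) * vecAct (c.dA A α p) (c.dbarF F τ) := by
    intro τ
    rw [← h2, Finset.sum_mul]
    exact Finset.sum_congr rfl fun β _ => mul_right_comm _ _ _
  exact (Finset.sum_congr rfl fun τ _ => h4 τ).trans (by simp)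

/-- The intrinsic meaning of `N^β_α`: they are the unique coefficients for which `∂_α - N^β_α ∂̇_β`
annihilates every `∂̇_σ̄ F`. -/
theorem vecAct_deltaA_dbarF (hconv : IsConvex n F) (hp : p.1 ∈ c.chart.source)
    (hp0 : p ∈ nonzeroVectors m E) (α σ : Fin m) :
    vecAct (c.deltaA A F α p) (c.dbarF F σ) = 0 := by
  rw [c.deltaA_eq hp, vecAct_sub, vecAct_sum, ← c.sum_NA_mul_h hconv hp hp0, sub_eq_zero]
  simp only [vecAct_smul]
  rfl

/-- A vector of type `(1,0)` is determined by its projection and its action on `∂̇_σ̄ F`. -/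
theorem eq_of_vecAct_dbarF (hconv : IsConvex n F) (hp : p.1 ∈ c.chart.source)
    (hp0 : p ∈ nonzeroVectors m E) {v w : TangentSpace (IE n m) p}
    (h : mfderiv (IE n m) (IM n) (TotalSpace.proj : TotalSpace (Fin m → ℂ) E → M) p v =
      mfderiv (IE n m) (IM n) (TotalSpace.proj : TotalSpace (Fin m → ℂ) E → M) p w)
    (hF : ∀ σ, vecAct (hol v) (c.dbarF F σ) = vecAct (hol w) (c.dbarF F σ)) : v = w := by
  rw [← sub_eq_zero]
  have h0 : (c.coordDiff p v).1 = (c.coordDiff p w).1 := by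
    rw [c.coordDiff_fst hp, c.coordDiff_fst hp, h]
  have h1 : (c.coordDiff p (v - w)).1 = 0 := by
    rw [map_sub, Prod.fst_sub, h0, sub_self]
  have h2 := c.hol_eq_sum hp (v - w)
  simp only [h1, Pi.zero_apply, zero_smul, Finset.sum_const_zero, zero_add] at h2
  -- The difference is vertical, so its action on `∂̇_σ̄ F` is its coordinate row vector times `h`;
  -- nondegeneracy of `h` makes it zero.
  have h3 : Matrix.vecMul (c.coordDiff p (v - w)).2 (c.h F p) = 0 := by
    ext σ
    have h4 : vecAct (hol (v - w)) (c.dbarF F σ) = 0 := by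
      rw [map_sub, vecAct_sub, hF, sub_self]
    rw [h2, vecAct_sum] at h4
    simp only [vecAct_smul] at h4
    exact h4
  have h5 := Matrix.eq_zero_of_vecMul_eq_zero (c.det_h_ne_zero hconv hp hp0) h3
  apply hol_injective
  rw [h2, h5]
  simp

/-- The maps `ρ` and `π_*` are complex linear, so the defining condition of the prolongation passes
to (1,0)-components. -/
theorem anchor_holCoeff (w : Prolongation A p) :
    A.anchor p.1 (holCoeff w.1.1) = mfderiv (IE n m) (IM n)
      (TotalSpace.proj : TotalSpace (Fin m → ℂ) E → M) p (holCoeff w.1.2) := by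
  have h : complexify (A.anchor p.1) w.1.1 = projC n p w.1.2 := w.2
  have h1 := congrArg holCoeff h
  rw [holCoeff_complexify, projC, holCoeff_complexify] at h1
  exact h1

/-- Both sides have the same component in `E_ℂ`, hence anchors with the same projection to `M`. Both
anchors have type (1,0) and annihilate the functions `∂̇_σ̄ F` of the chart `c`, so they coincide.
-/
theorem xT_trans (hF : IsFinslerStructure n F) (hconv : IsConvex n F) (hp : p.1 ∈ c.chart.source)
    (hp' : p.1 ∈ c'.chart.source) (hp0 : p ∈ nonzeroVectors m E) (α : Fin m) :
    c'.xT A F α p = ∑ β, c.trans c' β α p.1 • c.xT A F β p := by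
  have hfst : (c'.xT A F α p).1.1 = (∑ β, c.trans c' β α p.1 • c.xT A F β p : Prolongation A p).1.1
      := by
    simp only [Submodule.coe_sum, Submodule.coe_smul, c.xT_val hp, c'.xT_val hp', Prod.fst_sum,
      Prod.smul_fst]
    conv_lhs => rw [c.frame_eq_sum_trans c' hp α, map_sum]
    simp only [map_smul]
  have h1 : (∑ β, c.trans c' β α p.1 • c.xT A F β p : Prolongation A p).1.2 =
      ∑ β, c.trans c' β α p.1 • c.deltaA A F β p := by
    simp only [Submodule.coe_sum, Submodule.coe_smul, Prod.snd_sum, Prod.smul_snd]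
    rfl
  have h2 : hol (holCoeff (∑ β, c.trans c' β α p.1 • c.deltaA A F β p)) =
      ∑ β, c.trans c' β α p.1 • c.deltaA A F β p := by
    simp only [map_sum, map_smul, c.holCoeff_deltaA hp]
  refine Subtype.ext (Prod.ext hfst ?_)
  rw [h1]
  change c'.deltaA A F α p = _
  rw [← c'.holCoeff_deltaA hp', ← h2]
  congr 1
  refine c.eq_of_vecAct_dbarF hconv hp hp0 ?_ fun σ => ?_
  · have h3 := anchor_holCoeff (c'.xT A F α p)
    have h4 := anchor_holCoeff (∑ β, c.trans c' β α p.1 • c.xT A F β p : Prolongation A p)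
    rw [← hfst, h3, h1] at h4
    exact h4
  -- The functions of the chart `c` are rewritten through those of `c'`, which the left-hand vector
  -- annihilates.
  · rw [c'.vecAct_hol_dbarF c hF hp' hp hp0, c'.holCoeff_deltaA hp', h2, vecAct_sum]
    simp only [c'.vecAct_deltaA_dbarF hconv hp' hp0, vecAct_smul,
      c.vecAct_deltaA_dbarF hconv hp hp0, mul_zero, Finset.sum_const_zero]

theorem duV_trans (hp : p.1 ∈ c.chart.source) (hp' : p.1 ∈ c'.chart.source) (α : Fin m) :
    c'.duV α p = ∑ β, c.trans c' β α p.1 • c.duV β p := by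
  apply Subtype.ext
  simp only [Submodule.coe_sum, Submodule.coe_smul, c.duV_val hp, c'.duV_val hp',
    c.du_eq_sum c' hp hp' α]

theorem vT_trans (hp : p.1 ∈ c.chart.source) (hp' : p.1 ∈ c'.chart.source) (α : Fin m) :
    c'.vT A α p = ∑ β, c.trans c' β α p.1 • c.vT A β p := by
  simp only [vT, c.duV_trans c' hp hp', map_sum, map_smul]

end HolChart

/-! ### The adapted frames as block frames -/

section ChangeOfFrame

variable {ι ι' : Type} [Fintype ι] [Fintype ι'] {B B' : TotalSpace (Fin m → ℂ) E → Type*}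
  [∀ p, AddCommGroup (B p)] [∀ p, Module ℂ (B p)]
  [∀ p, AddCommGroup (B' p)] [∀ p, Module ℂ (B' p)]
  {f : HolChart n m M E → ι → ∀ p, B p} {g : HolChart n m M E → ι' → ∀ p, B' p}
  {p : TotalSpace (Fin m → ℂ) E}

/-- A bundle map which sends the vectors of a frame to smooth sections preserves smoothness. -/
theorem SmoothSectionAt.map (L : ∀ q, B q →ₗ[ℂ] B' q)
    (h : ∀ c : HolChart n m M E, p.1 ∈ c.chart.source → ∀ i,
      ∃ b : ι' → TotalSpace (Fin m → ℂ) E → ℂ, (∀ j, SmoothFunAt n (b j) p) ∧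
        ∀ᶠ q in 𝓝 p, L q (f c i q) = ∑ j, b j q • g c j q)
    {s : ∀ q, B q} (hs : SmoothSectionAt f s p) : SmoothSectionAt g (fun q => L q (s q)) p := by
  obtain ⟨c, hp, a, ha, hsa⟩ := hs
  choose b hb hbe using h c hp
  refine ⟨c, hp, fun j q => ∑ i, a i q * b i j q,
    fun j => SmoothFunAt.sum fun i _ => (ha i).mul (hb i j), ?_⟩
  filter_upwards [hsa, Filter.eventually_all.2 hbe] with q hq hbq
  rw [hq, map_sum]
  simp only [map_smul, hbq, Finset.smul_sum, Finset.sum_smul, smul_smul]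
  exact Finset.sum_comm

end ChangeOfFrame

variable (A : HolomorphicLieAlgebroid n m M E) (F : TotalSpace (Fin m → ℂ) E → ℝ)

/-- The frame `{∂̇_α, ∂̇_ᾱ}` of `VT_ℂE` in blocks, where the flag marks conjugation. -/
def vertFrame (c : HolChart n m M E) :
    Bool × Fin m → ∀ p : TotalSpace (Fin m → ℂ) E, VertC n p
  | (false, α) => c.duV α
  | (true, α) => fun p => conjV (c.duV α p)

/-- The adapted frame `{𝒳_α, 𝒱_α, 𝒳_ᾱ, 𝒱_ᾱ}` of `𝒯_ℂE` in blocks, where the first flag marks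
conjugation and the second one the vertical blocks. -/
def adaptedFrame (c : HolChart n m M E) :
    (Bool × Bool) × Fin m → ∀ p : TotalSpace (Fin m → ℂ) E, Prolongation A p
  | ((false, false), α) => c.xT A F α
  | ((false, true), α) => c.vT A α
  | ((true, false), α) => fun p => conjT (c.xT A F α p)
  | ((true, true), α) => fun p => conjT (c.vT A α p)

variable {A F}

namespace HolChart

variable (c c' : HolChart n m M E) {p : TotalSpace (Fin m → ℂ) E}

theorem linearIndependent_coordVec (hp : p.1 ∈ c.chart.source) :
    LinearIndependent ℂ (fun α : Fin m => c.coordVec p (0, Pi.single α 1)) := by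
  refine Fintype.linearIndependent_iff.2 fun a h i => ?_
  have h1 : c.coordVec p (0, a) = 0 := by
    rw [← h]
    have h2 : ((0, a) : (Fin n → ℂ) × (Fin m → ℂ)) =
        ∑ β, a β • ((0, Pi.single β 1) : (Fin n → ℂ) × (Fin m → ℂ)) := by
      ext i
      · simp [Prod.fst_sum]
      · simp [Prod.snd_sum, Finset.sum_apply, Pi.single_apply]
    rw [h2]
    simp only [coordVec_eq, map_sum, map_smul]
  have h3 := congrArg (c.coordDiff p) h1
  rw [c.coordDiff_coordVec hp, map_zero] at h3
  exact congrFun (congrArg Prod.snd h3) i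

theorem exists_sum_duV (hp : p.1 ∈ c.chart.source) (w : VertC n p) : ∃ a : Fin m → ℂ,
    (∑ α, a α • c.duV α p : VertC n p).1 = hol (holCoeff w.1) := by
  refine ⟨(c.coordDiff p (holCoeff w.1)).2, ?_⟩
  have h : projC n p w.1 = 0 := w.2
  have h1 := congrArg holCoeff h
  rw [projC, holCoeff_complexify, map_zero] at h1
  have h2 : (c.coordDiff p (holCoeff w.1)).1 = 0 := by
    rw [c.coordDiff_fst hp]
    exact (congrArg _ h1).trans (map_zero _)
  rw [c.hol_eq_sum hp, h2]
  simp only [Submodule.coe_sum, Submodule.coe_smul, c.duV_val hp, Pi.zero_apply, zero_smul,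
    Finset.sum_const_zero, zero_add]

theorem vertC_eq_sum (hp : p.1 ∈ c.chart.source) (w : VertC n p) :
    ∃ a b : Fin m → ℂ, w = ∑ α, a α • c.duV α p + conjV (∑ α, b α • c.duV α p) := by
  obtain ⟨a, ha⟩ := c.exists_sum_duV hp w
  obtain ⟨b, hb⟩ := c.exists_sum_duV hp (conjV w)
  refine ⟨a, b, Subtype.ext ?_⟩
  rw [Submodule.coe_add, ha]
  change _ = _ + conjC _
  rw [hb]
  exact (hol_add_conjC_hol w.1).symm

theorem zT_eq (α : Fin m) (p : TotalSpace (Fin m → ℂ) E) :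
    c.zT A α p = c.xT A F α p + ∑ β, c.NA A F β α p • c.vT A β p := by
  rw [xT, sub_add_cancel]

theorem sum_zT_eq (a b : Fin m → ℂ) :
    ∑ α, a α • c.zT A α p + ∑ α, b α • c.vT A α p = ∑ α, a α • c.xT A F α p +
      ∑ β, (∑ α, a α * c.NA A F β α p + b β) • c.vT A β p := by
  simp only [c.zT_eq (F := F), smul_add, Finset.sum_add_distrib, Finset.smul_sum, smul_smul,
    add_smul, Finset.sum_smul]
  rw [Finset.sum_comm, add_assoc]

theorem hol_holCoeff_eq_sum (hp : p.1 ∈ c.chart.source) (w : Prolongation A p) :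
    (hol (holCoeff w.1.1), hol (holCoeff w.1.2)) =
      (∑ α, c.isFrame.coeff α p.1 (holCoeff w.1.1) • c.zT A α p +
        ∑ β, (c.coordDiff p (holCoeff w.1.2)).2 β • c.vT A β p : Prolongation A p).1 := by
  simp only [Submodule.coe_add, Submodule.coe_sum, Submodule.coe_smul, c.zT_val hp, c.vT_val hp]
  ext1
  · simp only [Prod.fst_add, Prod.fst_sum, Prod.smul_fst, smul_zero, Finset.sum_const_zero,
      add_zero]
    conv_lhs => rw [← c.sum_coeff hp (holCoeff w.1.1)]
    rw [map_sum]
    simp only [map_smul]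
  · simp only [Prod.snd_add, Prod.snd_sum, Prod.smul_snd]
    exact c.hol_eq_sum_of_anchor hp (anchor_holCoeff w)

theorem exists_sum_xT_vT (hp : p.1 ∈ c.chart.source) (w : Prolongation A p) :
    ∃ a b : Fin m → ℂ, (∑ α, a α • c.xT A F α p + ∑ α, b α • c.vT A α p : Prolongation A p).1 =
      (hol (holCoeff w.1.1), hol (holCoeff w.1.2)) :=
  ⟨_, _, ((c.hol_holCoeff_eq_sum hp w).trans (congrArg Subtype.val (c.sum_zT_eq _ _))).symm⟩

theorem prolongation_eq_sum (hp : p.1 ∈ c.chart.source) (w : Prolongation A p) :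
    ∃ a b a' b' : Fin m → ℂ, w = ∑ α, a α • c.xT A F α p + ∑ α, b α • c.vT A α p +
      conjT (∑ α, a' α • c.xT A F α p + ∑ α, b' α • c.vT A α p) := by
  obtain ⟨a, b, h1⟩ := c.exists_sum_xT_vT (F := F) hp w
  obtain ⟨a', b', h2⟩ := c.exists_sum_xT_vT (F := F) hp (conjT w)
  refine ⟨a, b, a', b', Subtype.ext (Prod.ext ?_ ?_)⟩
  · rw [Submodule.coe_add, h1]
    change _ = _ + conjC ((∑ α, a' α • c.xT A F α p +
      ∑ α, b' α • c.vT A α p : Prolongation A p).1.1)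
    rw [h2]
    exact (hol_add_conjC_hol w.1.1).symm
  · rw [Submodule.coe_add, h1]
    change _ = _ + conjC ((∑ α, a' α • c.xT A F α p +
      ∑ α, b' α • c.vT A α p : Prolongation A p).1.2)
    rw [h2]
    exact (hol_add_conjC_hol w.1.2).symm

/-- The components in `E` see only the `𝒳_α` and form a frame, so `a = 0`. The remaining vectors
`∂̇_α` are independent in the tangent space. Both components are needed, because the anchor need not
be injective. -/
theorem linearIndependent_xT_vT (hp : p.1 ∈ c.chart.source) {a b : Fin m → ℂ}
    (h1 : ∑ α, a α • holCoeff (c.xT A F α p).1.1 + ∑ α, b α • holCoeff (c.vT A α p).1.1 = 0)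
    (h2 : ∑ α, a α • holCoeff (c.xT A F α p).1.2 + ∑ α, b α • holCoeff (c.vT A α p).1.2 = 0) :
    a = 0 ∧ b = 0 := by
  simp only [c.xT_val hp, c.vT_val hp, holCoeff_hol, map_zero, smul_zero, Finset.sum_const_zero,
    add_zero] at h1
  have ha : a = 0 :=
    funext fun i => Fintype.linearIndependent_iff.1 (c.isFrame.linearIndependent hp) a h1 i
  subst ha
  simp only [Pi.zero_apply, zero_smul, Finset.sum_const_zero, zero_add, c.vT_val hp, du,
    holCoeff_hol] at h2
  exact ⟨rfl, funext fun i =>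
    Fintype.linearIndependent_iff.1 (c.linearIndependent_coordVec hp) b h2 i⟩

end HolChart

theorem isBlockFrame_vertFrame :
    IsBlockFrame (fun b : Bool => b) (vertFrame : HolChart n m M E → _) where
  linearIndependent c p _ hp := by
    refine Fintype.linearIndependent_iff.2 fun g h => ?_
    rw [Fintype.sum_prod_type, Fintype.sum_bool, add_comm] at h
    have h1 := linearIndependent_conj (σ := conjV) (w := fun α => c.duV α p)
      conjV_add conjV_smul conjV_conjV (holCoeff ∘ₗ (VertC n p).subtype)
      (by simpa [c.duV_val hp, HolChart.du] using c.linearIndependent_coordVec hp)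
      (fun i => by
        change holCoeff (conjC (c.duV i p).1) = 0
        rw [c.duV_val hp, HolChart.du, holCoeff_conjC_hol]) h
    rintro ⟨b | b, α⟩
    · exact congrFun h1.1 α
    · exact congrFun h1.2 α
  span c p _ hp := by
    rintro w -
    obtain ⟨a, b, rfl⟩ := c.vertC_eq_sum hp w
    let φ : VertC n p →+ VertC n p := AddMonoidHom.mk' conjV conjV_add
    refine add_mem (Submodule.sum_mem _ fun α _ => Submodule.smul_mem _ _
      (Submodule.subset_span ⟨(false, α), rfl⟩)) ?_
    change φ _ ∈ _
    rw [map_sum]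
    refine Submodule.sum_mem _ fun α _ => ?_
    change conjV _ ∈ _
    rw [conjV_smul]
    exact Submodule.smul_mem _ _ (Submodule.subset_span ⟨(true, α), rfl⟩)
  trans c c' p _ hp hp' k α := by
    cases k
    · exact c.duV_trans c' hp hp' α
    · let φ : VertC n p →+ VertC n p := AddMonoidHom.mk' conjV conjV_add
      have h := congrArg φ (c.duV_trans c' hp hp' α)
      rw [map_sum] at h
      exact h.trans (Finset.sum_congr rfl fun β _ => conjV_smul _ _)

theorem isBlockFrame_adaptedFrame (hF : IsFinslerStructure n F) (hconv : IsConvex n F) :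
    IsBlockFrame (Prod.fst : Bool × Bool → Bool) (adaptedFrame A F) where
  linearIndependent c p _ hp := by
    refine Fintype.linearIndependent_iff.2 fun g h => ?_
    simp only [Fintype.sum_prod_type, Fintype.sum_bool] at h
    let w : Bool × Fin m → Prolongation A p := fun i => adaptedFrame A F c ((false, i.1), i.2) p
    -- The (1,0)-components of both entries: this map kills the two conjugate blocks.
    let l : Prolongation A p →ₗ[ℂ] E p.1 × TangentSpace (IE n m) p :=
      LinearMap.prodMap holCoeff holCoeff ∘ₗ (Prolongation A p).subtype
    have hli : LinearIndependent ℂ (fun i => l (w i)) := by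
      refine Fintype.linearIndependent_iff.2 fun a h => ?_
      rw [Fintype.sum_prod_type, Fintype.sum_bool, add_comm] at h
      have h1 := congrArg Prod.fst h
      have h2 := congrArg Prod.snd h
      simp only [Prod.fst_add, Prod.snd_add, Prod.fst_sum, Prod.snd_sum] at h1 h2
      have h3 := c.linearIndependent_xT_vT (A := A) (F := F) hp (a := fun α => a (false, α))
        (b := fun α => a (true, α)) h1 h2
      rintro ⟨b | b, α⟩
      · exact congrFun h3.1 α
      · exact congrFun h3.2 α
    have h0 : ∀ i, l (conjT (w i)) = 0 := by
      rintro ⟨b | b, α⟩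
      · refine Prod.ext ?_ ?_
        · change holCoeff (conjC (c.xT A F α p).1.1) = 0
          rw [c.xT_val hp, holCoeff_conjC_hol]
        · change holCoeff (conjC (c.deltaA A F α p)) = 0
          rw [← c.holCoeff_deltaA hp, holCoeff_conjC_hol]
      · refine Prod.ext ?_ ?_
        · change holCoeff (conjC (c.vT A α p).1.1) = 0
          rw [c.vT_val hp, map_zero, map_zero]
        · change holCoeff (conjC (c.vT A α p).1.2) = 0
          rw [c.vT_val hp, HolChart.du, holCoeff_conjC_hol]
    have h1 := linearIndependent_conj (σ := conjT) conjT_add conjT_smul conjT_conjT l hli h0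
      (a := fun i => g ((false, i.1), i.2)) (b := fun i => g ((true, i.1), i.2)) (by
        simp only [Fintype.sum_prod_type, Fintype.sum_bool]
        rw [add_comm]
        exact h)
    rintro ⟨⟨b | b, v⟩, α⟩
    · exact congrFun h1.1 (v, α)
    · exact congrFun h1.2 (v, α)
  span c p _ hp := by
    rintro w -
    obtain ⟨a, b, a', b', rfl⟩ := c.prolongation_eq_sum (F := F) hp w
    let φ : Prolongation A p →+ Prolongation A p := AddMonoidHom.mk' conjT conjT_add
    refine add_mem (add_mem ?_ ?_) ?_
    · exact Submodule.sum_mem _ fun α _ => Submodule.smul_mem _ _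
        (Submodule.subset_span ⟨((false, false), α), rfl⟩)
    · exact Submodule.sum_mem _ fun α _ => Submodule.smul_mem _ _
        (Submodule.subset_span ⟨((false, true), α), rfl⟩)
    · change φ _ ∈ _
      rw [map_add, map_sum, map_sum]
      refine add_mem (Submodule.sum_mem _ fun α _ => ?_) (Submodule.sum_mem _ fun α _ => ?_)
      · change conjT _ ∈ _
        rw [conjT_smul]
        exact Submodule.smul_mem _ _ (Submodule.subset_span ⟨((true, false), α), rfl⟩)
      · change conjT _ ∈ _
        rw [conjT_smul]
        exact Submodule.smul_mem _ _ (Submodule.subset_span ⟨((true, true), α), rfl⟩)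
  trans c c' p hp0 hp hp' k α := by
    let φ : Prolongation A p →+ Prolongation A p := AddMonoidHom.mk' conjT conjT_add
    have hX := c.xT_trans c' (A := A) hF hconv hp hp' hp0 α
    have hV := c.vT_trans c' (A := A) hp hp' α
    obtain ⟨b | b, v | v⟩ := k
    · exact hX
    · exact hV
    · have h := congrArg φ hX
      rw [map_sum] at h
      exact h.trans (Finset.sum_congr rfl fun β _ => conjT_smul _ _)
    · have h := congrArg φ hV
      rw [map_sum] at h
      exact h.trans (Finset.sum_congr rfl fun β _ => conjT_smul _ _)

/-! ### Smooth sections in the adapted frames -/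

section Smooth

variable {p : TotalSpace (Fin m → ℂ) E}

theorem smoothV_iff (s : ∀ q : TotalSpace (Fin m → ℂ) E, VertC n q) :
    SmoothV s p ↔ SmoothSectionAt vertFrame s p := by
  classical
  constructor
  · refine SmoothSectionAt.map (fun q => LinearMap.id) fun c hp i => ?_
    let j : Bool × Fin m := Sum.elim (fun α => (false, α)) (fun α => (true, α)) i
    refine ⟨fun k _ => if k = j then 1 else 0, fun k => smoothFunAt_const _,
      Filter.Eventually.of_forall fun q => ?_⟩
    simp only [ite_smul, one_smul, zero_smul, Finset.sum_ite_eq', Finset.mem_univ, if_true]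
    rcases i with α | α <;> rfl
  · refine SmoothSectionAt.map (fun q => LinearMap.id) fun c hp i => ?_
    let j : Fin m ⊕ Fin m := if i.1 then Sum.inr i.2 else Sum.inl i.2
    refine ⟨fun k _ => if k = j then 1 else 0, fun k => smoothFunAt_const _,
      Filter.Eventually.of_forall fun q => ?_⟩
    simp only [ite_smul, one_smul, zero_smul, Finset.sum_ite_eq', Finset.mem_univ, if_true]
    rcases i with ⟨b | b, α⟩ <;> rfl

theorem conjT_sum {ι : Type*} (t : Finset ι) (b : ι → ℂ) (w : ι → Prolongation A p) :
    conjT (∑ i ∈ t, b i • w i) = ∑ i ∈ t, star (b i) • conjT (w i) := by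
  let φ : Prolongation A p →+ Prolongation A p := AddMonoidHom.mk' conjT conjT_add
  change φ _ = _
  rw [map_sum]
  exact Finset.sum_congr rfl fun i _ => conjT_smul _ _

theorem sum_adaptedFrame (c : HolChart n m M E) (b : (Bool × Bool) × Fin m → ℂ) :
    ∑ j, b j • adaptedFrame A F c j p =
      (∑ β, b ((false, false), β) • c.xT A F β p + ∑ β, b ((false, true), β) • c.vT A β p) +
      (∑ β, b ((true, false), β) • conjT (c.xT A F β p) +
        ∑ β, b ((true, true), β) • conjT (c.vT A β p)) := by
  simp only [Fintype.sum_prod_type, Fintype.sum_bool, adaptedFrame]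
  abel

theorem sum_prolongationFrame (c : HolChart n m M E)
    (b : (Fin m ⊕ Fin m) ⊕ (Fin m ⊕ Fin m) → ℂ) :
    ∑ j, b j • c.prolongationFrame A j p =
      (∑ β, b (Sum.inl (Sum.inl β)) • c.zT A β p + ∑ β, b (Sum.inl (Sum.inr β)) • c.vT A β p) +
      (∑ β, b (Sum.inr (Sum.inl β)) • conjT (c.zT A β p) +
        ∑ β, b (Sum.inr (Sum.inr β)) • conjT (c.vT A β p)) := by
  simp only [Fintype.sum_sum_type, HolChart.prolongationFrame, Sum.elim_inl, Sum.elim_inr]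

theorem sum_tangentFrame (c : HolChart n m M E) (b : (Fin n ⊕ Fin m) ⊕ (Fin n ⊕ Fin m) → ℂ) :
    ∑ j, b j • c.tangentFrame j p =
      (∑ k, b (Sum.inl (Sum.inl k)) • c.dz k p + ∑ β, b (Sum.inl (Sum.inr β)) • c.du β p) +
      (∑ k, b (Sum.inr (Sum.inl k)) • conjC (c.dz k p) +
        ∑ β, b (Sum.inr (Sum.inr β)) • conjC (c.du β p)) := by
  simp only [Fintype.sum_sum_type, HolChart.tangentFrame, Sum.elim_inl, Sum.elim_inr]

theorem smoothFunAt_delta (α β : Fin m) :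
    SmoothFunAt n (fun _ : TotalSpace (Fin m → ℂ) E => if α = β then (1 : ℂ) else 0) p :=
  smoothFunAt_const _

theorem smoothFunAt_zero : SmoothFunAt n (fun _ : TotalSpace (Fin m → ℂ) E => (0 : ℂ)) p :=
  smoothFunAt_const 0

/-- Passing from `𝒵_α` to `𝒳_α` is a triangular change of frame with the smooth coefficients
`N^β_α`, and it is conjugated on the conjugate blocks. -/
theorem SmoothP.adaptedFrame (hF : IsFinslerStructure n F) (hconv : IsConvex n F)
    (hp0 : p ∈ nonzeroVectors m E) {s : ∀ q : TotalSpace (Fin m → ℂ) E, Prolongation A q}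
    (hs : SmoothP A s p) : SmoothSectionAt (FinslerAlgebroid.adaptedFrame A F) s p := by
  refine SmoothSectionAt.map (fun q => LinearMap.id) (fun c hp i => ?_) hs
  have hN := c.smoothFunAt_NA (A := A) hF hconv hp hp0
  rcases i with (α | α) | (α | α)
  · refine ⟨fun
      | ((false, false), β) => fun _ => if α = β then 1 else 0
      | ((false, true), β) => c.NA A F β α
      | ((true, _), _) => fun _ => 0, ?_, Filter.Eventually.of_forall fun q => ?_⟩
    · rintro ⟨⟨b | b, v | v⟩, β⟩
      exacts [smoothFunAt_delta α β, hN β α, smoothFunAt_zero, smoothFunAt_zero]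
    · rw [sum_adaptedFrame]
      simp only [zero_smul, Finset.sum_const_zero, add_zero, ite_smul, one_smul,
        Finset.sum_ite_eq, Finset.mem_univ, if_true]
      exact c.zT_eq α q
  · refine ⟨fun
      | ((false, true), β) => fun _ => if α = β then 1 else 0
      | ((false, false), _) => fun _ => 0
      | ((true, _), _) => fun _ => 0, ?_, Filter.Eventually.of_forall fun q => ?_⟩
    · rintro ⟨⟨b | b, v | v⟩, β⟩
      exacts [smoothFunAt_zero, smoothFunAt_delta α β, smoothFunAt_zero, smoothFunAt_zero]
    · rw [sum_adaptedFrame]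
      simp only [zero_smul, Finset.sum_const_zero, add_zero, zero_add, ite_smul, one_smul,
        Finset.sum_ite_eq, Finset.mem_univ, if_true]
      rfl
  · refine ⟨fun
      | ((true, false), β) => fun _ => if α = β then 1 else 0
      | ((true, true), β) => fun q => star (c.NA A F β α q)
      | ((false, _), _) => fun _ => 0, ?_, Filter.Eventually.of_forall fun q => ?_⟩
    · rintro ⟨⟨b | b, v | v⟩, β⟩
      exacts [smoothFunAt_zero, smoothFunAt_zero, smoothFunAt_delta α β, (hN β α).star]
    · have h := congrArg conjT (c.zT_eq (A := A) (F := F) α q)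
      rw [conjT_add, conjT_sum] at h
      rw [sum_adaptedFrame]
      simp only [zero_smul, Finset.sum_const_zero, zero_add, ite_smul, one_smul,
        Finset.sum_ite_eq, Finset.mem_univ, if_true]
      exact h
  · refine ⟨fun
      | ((true, true), β) => fun _ => if α = β then 1 else 0
      | ((true, false), _) => fun _ => 0
      | ((false, _), _) => fun _ => 0, ?_, Filter.Eventually.of_forall fun q => ?_⟩
    · rintro ⟨⟨b | b, v | v⟩, β⟩
      exacts [smoothFunAt_zero, smoothFunAt_zero, smoothFunAt_zero, smoothFunAt_delta α β]
    · rw [sum_adaptedFrame]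
      simp only [zero_smul, Finset.sum_const_zero, zero_add, ite_smul, one_smul,
        Finset.sum_ite_eq, Finset.mem_univ, if_true]
      rfl

theorem smoothP_of_adaptedFrame (hF : IsFinslerStructure n F) (hconv : IsConvex n F)
    (hp0 : p ∈ nonzeroVectors m E) {s : ∀ q : TotalSpace (Fin m → ℂ) E, Prolongation A q}
    (hs : SmoothSectionAt (adaptedFrame A F) s p) : SmoothP A s p := by
  refine SmoothSectionAt.map (fun q => LinearMap.id) (fun c hp i => ?_) hs
  have hN := c.smoothFunAt_NA (A := A) hF hconv hp hp0
  have hx : ∀ α q, c.xT A F α q = c.zT A α q + ∑ β, (-c.NA A F β α q) • c.vT A β q := by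
    intro α q
    rw [HolChart.xT, sub_eq_add_neg, ← Finset.sum_neg_distrib]
    exact congrArg _ (Finset.sum_congr rfl fun β _ => (neg_smul _ _).symm)
  rcases i with ⟨⟨b | b, v | v⟩, α⟩
  · refine ⟨Sum.elim (Sum.elim (fun β _ => if α = β then 1 else 0) (fun β q => -c.NA A F β α q))
      (fun _ _ => 0), ?_, Filter.Eventually.of_forall fun q => ?_⟩
    · rintro ((β | β) | β)
      exacts [smoothFunAt_delta α β, (hN β α).neg, smoothFunAt_zero]
    · rw [sum_prolongationFrame]
      simp only [Sum.elim_inl, Sum.elim_inr, zero_smul, Finset.sum_const_zero, add_zero, ite_smul,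
        one_smul, Finset.sum_ite_eq, Finset.mem_univ, if_true]
      exact hx α q
  · refine ⟨Sum.elim (Sum.elim (fun _ _ => 0) (fun β _ => if α = β then 1 else 0))
      (fun _ _ => 0), ?_, Filter.Eventually.of_forall fun q => ?_⟩
    · rintro ((β | β) | β)
      exacts [smoothFunAt_zero, smoothFunAt_delta α β, smoothFunAt_zero]
    · rw [sum_prolongationFrame]
      simp only [Sum.elim_inl, Sum.elim_inr, zero_smul, Finset.sum_const_zero, add_zero, zero_add,
        ite_smul, one_smul, Finset.sum_ite_eq, Finset.mem_univ, if_true]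
      rfl
  · refine ⟨Sum.elim (fun _ _ => 0) (Sum.elim (fun β _ => if α = β then 1 else 0)
      (fun β q => star (-c.NA A F β α q))), ?_, Filter.Eventually.of_forall fun q => ?_⟩
    · rintro (β | (β | β))
      exacts [smoothFunAt_zero, smoothFunAt_delta α β, (hN β α).neg.star]
    · have h := congrArg conjT (hx α q)
      rw [conjT_add, conjT_sum] at h
      rw [sum_prolongationFrame]
      simp only [Sum.elim_inl, Sum.elim_inr, zero_smul, Finset.sum_const_zero, zero_add, ite_smul,
        one_smul, Finset.sum_ite_eq, Finset.mem_univ, if_true]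
      exact h
  · refine ⟨Sum.elim (fun _ _ => 0) (Sum.elim (fun _ _ => 0)
      (fun β _ => if α = β then 1 else 0)), ?_, Filter.Eventually.of_forall fun q => ?_⟩
    · rintro (β | (β | β))
      exacts [smoothFunAt_zero, smoothFunAt_zero, smoothFunAt_delta α β]
    · rw [sum_prolongationFrame]
      simp only [Sum.elim_inl, Sum.elim_inr, zero_smul, Finset.sum_const_zero, zero_add, ite_smul,
        one_smul, Finset.sum_ite_eq, Finset.mem_univ, if_true]
      rfl

theorem smoothP_iff (hF : IsFinslerStructure n F) (hconv : IsConvex n F)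
    (hp0 : p ∈ nonzeroVectors m E) (s : ∀ q : TotalSpace (Fin m → ℂ) E, Prolongation A q) :
    SmoothP A s p ↔ SmoothSectionAt (adaptedFrame A F) s p :=
  ⟨fun hs => hs.adaptedFrame hF hconv hp0, smoothP_of_adaptedFrame hF hconv hp0⟩

theorem SmoothP.anchorT {X : ∀ q : TotalSpace (Fin m → ℂ) E, Prolongation A q}
    (hX : SmoothP A X p) : SmoothT (fun q => FinslerAlgebroid.anchorT A q (X q)) p := by
  refine SmoothSectionAt.map (fun q => FinslerAlgebroid.anchorT A q) (fun c hp i => ?_) hX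
  have hr := fun k α => c.smoothFunAt_rho (A := A) hp k α
  have hz : ∀ q : TotalSpace (Fin m → ℂ) E, q.1 ∈ c.chart.source → ∀ α,
      FinslerAlgebroid.anchorT A q (c.zT A α q) = c.dA A α q :=
    fun q hq α => congrArg Prod.snd (c.zT_val hq α)
  have hv : ∀ q : TotalSpace (Fin m → ℂ) E, q.1 ∈ c.chart.source → ∀ α,
      FinslerAlgebroid.anchorT A q (c.vT A α q) = c.du α q :=
    fun q hq α => congrArg Prod.snd (c.vT_val (A := A) hq α)
  rcases i with (α | α) | (α | α)
  · refine ⟨Sum.elim (Sum.elim (fun k q => c.rho A k α q.1) (fun _ _ => 0)) (fun _ _ => 0), ?_, ?_⟩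
    · rintro ((k | β) | β)
      exacts [hr k α, smoothFunAt_zero, smoothFunAt_zero]
    · filter_upwards [eventually_mem_base c.chart.open_source hp] with q hq
      rw [sum_tangentFrame]
      simp only [Sum.elim_inl, Sum.elim_inr, zero_smul, Finset.sum_const_zero, add_zero]
      exact hz q hq α
  · refine ⟨Sum.elim (Sum.elim (fun _ _ => 0) (fun β _ => if α = β then 1 else 0))
      (fun _ _ => 0), ?_, ?_⟩
    · rintro ((k | β) | β)
      exacts [smoothFunAt_zero, smoothFunAt_delta α β, smoothFunAt_zero]
    · filter_upwards [eventually_mem_base c.chart.open_source hp] with q hq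
      rw [sum_tangentFrame]
      simp only [Sum.elim_inl, Sum.elim_inr, zero_smul, Finset.sum_const_zero, add_zero, zero_add,
        ite_smul, one_smul, Finset.sum_ite_eq, Finset.mem_univ, if_true]
      exact hv q hq α
  · refine ⟨Sum.elim (fun _ _ => 0) (Sum.elim (fun k q => star (c.rho A k α q.1)) (fun _ _ => 0)),
      ?_, ?_⟩
    · rintro (β | (k | β))
      exacts [smoothFunAt_zero, (hr k α).star, smoothFunAt_zero]
    · filter_upwards [eventually_mem_base c.chart.open_source hp] with q hq
      have h := congrArg conjC (hz q hq α)
      simp only [HolChart.dA, map_sum, conjC_smul] at h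
      rw [sum_tangentFrame]
      simp only [Sum.elim_inl, Sum.elim_inr, zero_smul, Finset.sum_const_zero, add_zero, zero_add]
      exact h
  · refine ⟨Sum.elim (fun _ _ => 0) (Sum.elim (fun _ _ => 0)
      (fun β _ => if α = β then 1 else 0)), ?_, ?_⟩
    · rintro (β | (k | β))
      exacts [smoothFunAt_zero, smoothFunAt_zero, smoothFunAt_delta α β]
    · filter_upwards [eventually_mem_base c.chart.open_source hp] with q hq
      rw [sum_tangentFrame]
      simp only [Sum.elim_inl, Sum.elim_inr, zero_smul, Finset.sum_const_zero, add_zero, zero_add,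
        ite_smul, one_smul, Finset.sum_ite_eq, Finset.mem_univ, if_true]
      exact congrArg conjC (hv q hq α)

end Smooth

/-! ### Spans of blocks -/

section Blocks

variable {Q B : TotalSpace (Fin m → ℂ) E → Type*}
  [∀ p, AddCommGroup (Q p)] [∀ p, Module ℂ (Q p)]
  [∀ p, AddCommGroup (B p)] [∀ p, Module ℂ (B p)]
  {κ : Type} [Fintype κ] {bar : κ → Bool} {f : HolChart n m M E → κ × Fin m → ∀ p, B p}
  {F : TotalSpace (Fin m → ℂ) E → ℝ} {p : TotalSpace (Fin m → ℂ) E}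

namespace IsBlockFrame

variable (hf : IsBlockFrame bar f) (c c' : HolChart n m M E)

/-- Describes each distribution as the vanishing of coefficients, the form in which a block-diagonal
connection visibly preserves it. -/
theorem mem_span_block_iff (hp0 : p ∈ nonzeroVectors m E) (hp : p.1 ∈ c.chart.source) (k : κ)
    (w : B p) : w ∈ Submodule.span ℂ (Set.range fun α => f c (k, α) p) ↔
      ∀ k', k' ≠ k → ∀ α, hf.coef c (k', α) p w = 0 := by
  classical
  constructor
  · intro hw k' hk' α
    induction hw using Submodule.span_induction with
    | mem x hx =>
      obtain ⟨β, rfl⟩ := hx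
      rw [hf.coef_frame c hp0 hp, if_neg]
      exact fun h => hk' (congrArg Prod.fst h)
    | zero => exact map_zero _
    | add x y _ _ hx hy => rw [map_add, hx, hy, add_zero]
    | smul z x _ hx => rw [map_smul, hx, smul_zero]
  · intro h
    rw [← hf.sum_coef c hp0 hp w]
    refine Submodule.sum_mem _ ?_
    rintro ⟨k', α⟩ -
    by_cases hk : k' = k
    · subst hk
      exact Submodule.smul_mem _ _ (Submodule.subset_span ⟨α, rfl⟩)
    · rw [h k' hk α, zero_smul]
      exact zero_mem _

theorem span_block_le (hf : IsBlockFrame bar f) (hp0 : p ∈ nonzeroVectors m E) (hp : p.1 ∈ c.chart.source)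
    (hp' : p.1 ∈ c'.chart.source) (k : κ) :
    Submodule.span ℂ (Set.range fun α => f c' (k, α) p) ≤
      Submodule.span ℂ (Set.range fun α => f c (k, α) p) := by
  rw [Submodule.span_le]
  rintro _ ⟨α, rfl⟩
  change f c' (k, α) p ∈ _
  rw [hf.trans c c' p hp0 hp hp']
  exact Submodule.sum_mem _ fun β _ =>
    Submodule.smul_mem _ _ (Submodule.subset_span ⟨β, rfl⟩)

/-- The connection preserves the distributions on which the coefficients of some of the blocks
vanish. -/
theorem preserves_conn (hF : IsFinslerStructure n F) (hconv : IsConvex n F)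
    {a : ∀ p, Q p →ₗ[ℂ] ℂ ⊗[ℝ] TangentSpace (IE n m) p}
    {smoothB : (∀ p, B p) → TotalSpace (Fin m → ℂ) E → Prop}
    (hB : ∀ p ∈ nonzeroVectors m E, ∀ s, smoothB s p ↔ SmoothSectionAt f s p)
    {W : ∀ p, Set (B p)} (N : κ → Prop)
    (hW : ∀ c, ∀ p ∈ nonzeroVectors m E, p.1 ∈ c.chart.source → ∀ w,
      w ∈ W p ↔ ∀ k, N k → ∀ α, hf.coef c (k, α) p w = 0) :
    Preserves (nonzeroVectors m E) smoothB (fun p X s => hf.conn F p (a p X) s) W := by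
  intro p hp0 X s hs hsW
  have hp := mem_holChartAt (n := n) (m := m) (E := E) p.1
  rw [hW _ p hp0 hp]
  intro k hk α
  refine hf.coef_conn_eq_zero _ hF hconv hp0 hp _ ((hB p hp0 s).1 hs) k ?_ α
  filter_upwards [hsW, HolChart.eventually_nonzero_base _ hp hp0] with q hq hq0
  exact (hW _ q hq0.1 hq0.2 _).1 hq k hk

/-- The conjugate of a distribution given by vanishing blocks is again of this form, with the blocks
permuted; the barred distributions thus need no separate argument. -/
theorem conj_mem_iff (τ : Equiv.Perm κ) (conjB : ∀ p, B p → B p)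
    (hadd : ∀ p v w, conjB p (v + w) = conjB p v + conjB p w)
    (hsmul : ∀ p (z : ℂ) v, conjB p (z • v) = star z • conjB p v)
    (hframe : ∀ c, ∀ p ∈ nonzeroVectors m E, p.1 ∈ c.chart.source → ∀ k α,
      conjB p (f c (k, α) p) = f c (τ k, α) p)
    {W : ∀ p, Set (B p)} {N : κ → Prop}
    (hW : ∀ c, ∀ p ∈ nonzeroVectors m E, p.1 ∈ c.chart.source → ∀ w,
      w ∈ W p ↔ ∀ k, N k → ∀ α, hf.coef c (k, α) p w = 0) :
    ∀ c, ∀ p ∈ nonzeroVectors m E, p.1 ∈ c.chart.source → ∀ w,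
      w ∈ {w | conjB p w ∈ W p} ↔ ∀ k, N (τ k) → ∀ α, hf.coef c (k, α) p w = 0 := by
  intro c p hp0 hp w
  rw [Set.mem_ofPred_eq, hW c p hp0 hp, ← τ.forall_congr_right]
  simp only [hf.coef_conj c τ conjB hadd hsmul hframe hp0 hp, star_eq_zero]

end IsBlockFrame

/-- A connection which commutes with conjugation is determined by the derivatives of the vectors of
a frame in directions which span the bundle of directions together with their conjugates. -/
theorem IsConnectionOn.eq_of_conj {a : ∀ p, Q p →ₗ[ℂ] ℂ ⊗[ℝ] TangentSpace (IE n m) p}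
    {smoothQ : (∀ p, Q p) → TotalSpace (Fin m → ℂ) E → Prop}
    {smoothB : (∀ p, B p) → TotalSpace (Fin m → ℂ) E → Prop}
    {D D' : ∀ p, Q p → (∀ q, B q) → B p} (hf : IsBlockFrame bar f)
    (hD : IsConnectionOn (nonzeroVectors m E) a smoothQ smoothB D)
    (hD' : IsConnectionOn (nonzeroVectors m E) a smoothQ smoothB D')
    (hB : ∀ p ∈ nonzeroVectors m E, ∀ s, smoothB s p ↔ SmoothSectionAt f s p)
    (c : HolChart n m M E) (hp0 : p ∈ nonzeroVectors m E) (hp : p.1 ∈ c.chart.source)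
    (τ : Equiv.Perm κ) {conjB : ∀ p, B p → B p}
    (hframe : ∀ k α, (fun q => conjB q (f c (k, α) q)) = f c (τ k, α)) {conjQ : Q p → Q p}
    (hreal : ∀ X s, smoothB s p → D p (conjQ X) (fun q => conjB q (s q)) = conjB p (D p X s))
    (hreal' : ∀ X s, smoothB s p → D' p (conjQ X) (fun q => conjB q (s q)) = conjB p (D' p X s))
    {G : Set (Q p)} (hG : ∀ X ∈ G, ∀ k α, D p X (f c (k, α)) = D' p X (f c (k, α)))
    (hspan : ∀ X, ∃ Y ∈ Submodule.span ℂ G, ∃ Z ∈ Submodule.span ℂ G, X = Y + conjQ Z)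
    (X : Q p) {s : ∀ q, B q} (hs : smoothB s p) : D p X s = D' p X s := by
  have hsm : ∀ i, smoothB (f c i) p := fun i => (hB p hp0 _).2 (smoothSectionAt_frame c hp i)
  have h1 : ∀ Y ∈ Submodule.span ℂ G, ∀ k α, D p Y (f c (k, α)) = D' p Y (f c (k, α)) := by
    intro Y hY k α
    induction hY using Submodule.span_induction with
    | mem Y hY => exact hG Y hY k α
    | zero =>
      have h := hD.smul_direction p hp0 0 0 _ (hsm (k, α))
      have h' := hD'.smul_direction p hp0 0 0 _ (hsm (k, α))
      rw [zero_smul, zero_smul] at h h'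
      rw [h, h']
    | add Y Z _ _ hY hZ =>
      rw [hD.add_direction p hp0 _ _ _ (hsm _), hD'.add_direction p hp0 _ _ _ (hsm _), hY, hZ]
    | smul z Y _ hY =>
      rw [hD.smul_direction p hp0 _ _ _ (hsm _), hD'.smul_direction p hp0 _ _ _ (hsm _), hY]
  refine hD.eq_of_frame c hf hD' hB hp0 hp X ?_ hs
  rintro ⟨k, α⟩
  obtain ⟨Y, hY, Z, hZ, rfl⟩ := hspan X
  rw [hD.add_direction p hp0 _ _ _ (hsm _), hD'.add_direction p hp0 _ _ _ (hsm _), h1 Y hY]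
  congr 1
  -- In a conjugate direction, write the frame vector as the conjugate of another one; reality then
  -- brings the derivative back to the direction `Z` in the span.
  obtain ⟨k, rfl⟩ := τ.surjective k
  rw [← hframe, hreal _ _ (hsm _), hreal' _ _ (hsm _), h1 Z hZ]

end Blocks

/-! ### The Chern-Finsler connections -/

section ChernFinsler

variable (A : HolomorphicLieAlgebroid n m M E) (F : TotalSpace (Fin m → ℂ) E → ℝ)

/-- The Chern-Finsler nonlinear connection. -/
def horizontal (p : TotalSpace (Fin m → ℂ) E) : Submodule ℂ (Prolongation A p) :=
  Submodule.span ℂ (Set.range fun α => (holChartAt p.1).xT A F α p)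

variable {A F}

theorem conjV_vertFrame (c : HolChart n m M E) (b : Bool) (α : Fin m) :
    (fun q => conjV (vertFrame c (b, α) q)) = vertFrame c (Equiv.boolNot b, α) := by
  cases b
  · rfl
  · exact funext fun q => conjV_conjV _

theorem conjT_adaptedFrame (c : HolChart n m M E) (k : Bool × Bool) (α : Fin m) :
    (fun q => conjT (adaptedFrame A F c (k, α) q)) =
      adaptedFrame A F c (Equiv.boolNot.prodCongr (Equiv.refl Bool) k, α) := by
  rcases k with ⟨b | b, v | v⟩
  · rfl
  · rfl
  · exact funext fun q => conjT_conjT _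
  · exact funext fun q => conjT_conjT _

theorem vertIncl_vertFrame (c : HolChart n m M E) (b : Bool) (α : Fin m)
    (p : TotalSpace (Fin m → ℂ) E) :
    vertIncl A p (vertFrame c (b, α) p) = adaptedFrame A F c ((b, true), α) p := by
  cases b
  · rfl
  · exact vertIncl_conjV _

/-! ### The distributions and the connection form at a point, in an arbitrary chart. -/

section Pointwise

variable (c : HolChart n m M E) {p : TotalSpace (Fin m → ℂ) E}

theorem horizontal_eq_span (hF : IsFinslerStructure n F) (hconv : IsConvex n F)
    (hp0 : p ∈ nonzeroVectors m E) (hp : p.1 ∈ c.chart.source) :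
    horizontal A F p = Submodule.span ℂ (Set.range fun α => c.xT A F α p) :=
  have h := isBlockFrame_adaptedFrame (A := A) hF hconv
  le_antisymm (h.span_block_le c _ hp0 hp (mem_holChartAt p.1) (false, false))
    (h.span_block_le _ c hp0 (mem_holChartAt p.1) hp (false, false))

theorem HolChart.holVertical_eq_span (hp : p.1 ∈ c.chart.source) :
    holVertical A p = Submodule.span ℂ (Set.range fun α => c.vT A α p) := by
  refine le_antisymm (fun w hw => ?_) (Submodule.span_le.2 ?_)
  · obtain ⟨h1 : w.1.1 = 0, v, h2 : hol v = w.1.2⟩ := hw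
    have h := c.hol_holCoeff_eq_sum hp w
    have h3 : (hol (holCoeff w.1.1), hol (holCoeff w.1.2)) = w.1 := by
      rw [h1, ← h2, holCoeff_hol, map_zero, map_zero, h2]
      exact Prod.ext h1.symm rfl
    rw [h3, h1] at h
    rw [Subtype.ext h]
    simp only [map_zero, zero_smul, Finset.sum_const_zero, zero_add]
    exact Submodule.sum_mem _ fun β _ =>
      Submodule.smul_mem _ _ (Submodule.subset_span ⟨β, rfl⟩)
  · rintro _ ⟨α, rfl⟩
    have h := c.vT_val (A := A) hp α
    exact ⟨congrArg Prod.fst h, _, (congrArg Prod.snd h).symm⟩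

theorem HolChart.holProlongation_eq_sup (hp : p.1 ∈ c.chart.source) :
    holProlongation A p = Submodule.span ℂ (Set.range fun α => c.xT A F α p) ⊔
      Submodule.span ℂ (Set.range fun α => c.vT A α p) := by
  refine le_antisymm (fun w hw => ?_) (sup_le (Submodule.span_le.2 ?_) (Submodule.span_le.2 ?_))
  · obtain ⟨⟨e, h1 : hol e = w.1.1⟩, v, h2 : hol v = w.1.2⟩ := hw
    obtain ⟨a, b, h⟩ := c.exists_sum_xT_vT (F := F) hp w
    have h3 : (hol (holCoeff w.1.1), hol (holCoeff w.1.2)) = w.1 := by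
      rw [← h1, ← h2, holCoeff_hol, holCoeff_hol, h1, h2]
    rw [← Subtype.ext (h.trans h3)]
    exact Submodule.add_mem_sup
      (Submodule.sum_mem _ fun β _ => Submodule.smul_mem _ _ (Submodule.subset_span ⟨β, rfl⟩))
      (Submodule.sum_mem _ fun β _ => Submodule.smul_mem _ _ (Submodule.subset_span ⟨β, rfl⟩))
  · rintro _ ⟨α, rfl⟩
    exact ⟨⟨_, (congrArg Prod.fst (c.xT_val hp α)).symm⟩, _, c.holCoeff_deltaA hp α⟩
  · rintro _ ⟨α, rfl⟩
    have h := c.vT_val (A := A) hp α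
    exact ⟨⟨0, (map_zero hol).trans (congrArg Prod.fst h).symm⟩, _, (congrArg Prod.snd h).symm⟩

theorem HolChart.mem_holPart_iff_mem_span (hp : p.1 ∈ c.chart.source) (w : VertC n p) :
    w.1 ∈ holPart (TangentSpace (IE n m) p) ↔
      w ∈ Submodule.span ℂ (Set.range fun α => c.duV α p) := by
  constructor
  · rintro ⟨v, h1⟩
    obtain ⟨a, h⟩ := c.exists_sum_duV hp w
    rw [← h1, holCoeff_hol, h1] at h
    rw [← Subtype.ext h]
    exact Submodule.sum_mem _ fun β _ => Submodule.smul_mem _ _ (Submodule.subset_span ⟨β, rfl⟩)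
  · intro hw
    have h : Submodule.span ℂ (Set.range fun α => c.duV α p) ≤
        (holPart (TangentSpace (IE n m) p)).comap (VertC n p).subtype := by
      rw [Submodule.span_le]
      rintro _ ⟨α, rfl⟩
      exact ⟨_, (c.duV_val hp α).symm⟩
    exact h hw

theorem mem_antiPart_iff_conjC {V : Type*} [AddCommGroup V] [Module ℂ V] {x : ℂ ⊗[ℝ] V} :
    x ∈ antiPart V ↔ conjC x ∈ holPart V := by
  rw [mem_antiPart_iff, mem_holPart_iff, conjC_conjC]

theorem HolChart.blockForm_false {X : ℂ ⊗[ℝ] TangentSpace (IE n m) p}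
    (h : hol (holCoeff X) = X) (γ α : Fin m) : c.blockForm F false p X γ α =
      ∑ σ, c.hInv F σ γ p * vecAct X (fun q => c.h F q α σ) := by
  simp [blockForm, chernForm, h]

/-- The conjugate of a (1,0)-vector has no (1,0)-component, so the Chern form vanishes on it. This
is why the connection has type (1,0). -/
theorem HolChart.blockForm_true {X : ℂ ⊗[ℝ] TangentSpace (IE n m) p}
    (h : hol (holCoeff X) = X) (γ α : Fin m) : c.blockForm F true p X γ α = 0 := by
  rw [← h]
  simp [blockForm, chernForm, holCoeff_conjC_hol, vecAct_zero]

end Pointwise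

/-! ### Existence: the nonlinear connection, the two Chern-Finsler connections and their
coefficients. -/

theorem isNonlinearConnection_horizontal (hF : IsFinslerStructure n F) (hconv : IsConvex n F) :
    IsNonlinearConnection A (nonzeroVectors m E) (horizontal A F) where
  sup_vertical p _ := by
    have hp := mem_holChartAt (n := n) (m := m) (E := E) p.1
    rw [HolChart.holVertical_eq_span _ hp, HolChart.holProlongation_eq_sup (F := F) _ hp,
      horizontal]
  disjoint_vertical p hp0 := by
    have hp := mem_holChartAt (n := n) (m := m) (E := E) p.1
    have hf := isBlockFrame_adaptedFrame (A := A) hF hconv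
    rw [HolChart.holVertical_eq_span _ hp, horizontal, Submodule.disjoint_def]
    intro w h1 h2
    replace h1 := (hf.mem_span_block_iff _ hp0 hp (false, false) w).1 h1
    replace h2 := (hf.mem_span_block_iff _ hp0 hp (false, true) w).1 h2
    refine hf.eq_of_coef _ hp0 hp ?_
    rintro ⟨k, α⟩
    rw [map_zero]
    by_cases hk : k = (false, false)
    · exact h2 k (by rw [hk]; decide) α
    · exact h1 k hk α
  smooth p hp0 := by
    have hp := mem_holChartAt (n := n) (m := m) (E := E) p.1
    refine ⟨(holChartAt p.1).xT A F, fun i => (smoothP_iff hF hconv hp0 _).2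
      (smoothSectionAt_frame (f := adaptedFrame A F) _ hp ((false, false), i)), ?_⟩
    filter_upwards [HolChart.eventually_nonzero_base _ hp hp0] with q hq
    exact horizontal_eq_span _ hF hconv hq.1 hq.2

variable (A) in
/-- The Chern-Finsler connection of a holomorphic Lie algebroid. -/
def chernFinsler (hF : IsFinslerStructure n F) (hconv : IsConvex n F)
    (p : TotalSpace (Fin m → ℂ) E) (X : Prolongation A p)
    (s : ∀ q : TotalSpace (Fin m → ℂ) E, Prolongation A q) : Prolongation A p :=
  (isBlockFrame_adaptedFrame hF hconv).conn F p (anchorT A p X) s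

variable (F) in
/-- The vertical Chern-Finsler connection. -/
def verticalChernFinsler (p : TotalSpace (Fin m → ℂ) E) (X : ℂ ⊗[ℝ] TangentSpace (IE n m) p)
    (s : ∀ q : TotalSpace (Fin m → ℂ) E, VertC n q) : VertC n p :=
  isBlockFrame_vertFrame.conn F p X s

theorem isLinearConnectionP_chernFinsler (hF : IsFinslerStructure n F) (hconv : IsConvex n F) :
    IsLinearConnectionP A (nonzeroVectors m E) (horizontal A F) (chernFinsler A hF hconv) := by
  have hf := isBlockFrame_adaptedFrame (A := A) hF hconv
  have hB : ∀ p ∈ nonzeroVectors m E, ∀ s, SmoothP A s p ↔ SmoothSectionAt (adaptedFrame A F) s p :=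
    fun p hp0 s => smoothP_iff hF hconv hp0 s
  have hframe : ∀ c : HolChart n m M E, ∀ p ∈ nonzeroVectors m E, p.1 ∈ c.chart.source → ∀ k α,
      conjT (adaptedFrame A F c (k, α) p) =
        adaptedFrame A F c (Equiv.boolNot.prodCongr (Equiv.refl Bool) k, α) p :=
    fun c p _ _ k α => congrFun (conjT_adaptedFrame c k α) p
  -- The horizontal and the vertical distribution are the loci where all but one block of
  -- coefficients vanish.
  have hH : ∀ c : HolChart n m M E, ∀ p ∈ nonzeroVectors m E, p.1 ∈ c.chart.source → ∀ w,
      w ∈ (horizontal A F p : Set (Prolongation A p)) ↔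
        ∀ k, k ≠ (false, false) → ∀ α, hf.coef c (k, α) p w = 0 := by
    intro c p hp0 hp w
    rw [horizontal_eq_span c hF hconv hp0 hp]
    exact hf.mem_span_block_iff c hp0 hp (false, false) w
  have hV : ∀ c : HolChart n m M E, ∀ p ∈ nonzeroVectors m E, p.1 ∈ c.chart.source → ∀ w,
      w ∈ (holVertical A p : Set (Prolongation A p)) ↔
        ∀ k, k ≠ (false, true) → ∀ α, hf.coef c (k, α) p w = 0 := by
    intro c p hp0 hp w
    rw [c.holVertical_eq_span hp]
    exact hf.mem_span_block_iff c hp0 hp (false, true) w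
  exact
    { connection := hf.isConnectionOn_conn hF hconv (fun p _ X hX => hX.anchorT) hB
      real := fun p hp0 X s hs =>
        hf.conn_conj (Equiv.boolNot.prodCongr (Equiv.refl Bool)) (fun k => rfl)
          (fun _ => conjT) (fun _ => conjT_add) (fun _ => conjT_smul) hframe hp0 _
          ((hB p hp0 s).1 hs)
      horizontal := hf.preserves_conn hF hconv hB _ hH
      vertical := hf.preserves_conn hF hconv hB _ hV
      horizontal_bar := hf.preserves_conn hF hconv hB _ (hf.conj_mem_iff _ (fun _ => conjT)
        (fun _ => conjT_add) (fun _ => conjT_smul) hframe hH)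
      vertical_bar := hf.preserves_conn hF hconv hB _ (hf.conj_mem_iff _ (fun _ => conjT)
        (fun _ => conjT_add) (fun _ => conjT_smul) hframe hV) }

theorem isVerticalConnection_verticalChernFinsler (hF : IsFinslerStructure n F)
    (hconv : IsConvex n F) :
    IsVerticalConnection (nonzeroVectors m E) (verticalChernFinsler (n := n) F) := by
  have hf : IsBlockFrame (fun b : Bool => b) (vertFrame : HolChart n m M E → _) :=
    isBlockFrame_vertFrame
  have hB : ∀ p ∈ nonzeroVectors m E, ∀ s : ∀ q : TotalSpace (Fin m → ℂ) E, VertC n q,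
      SmoothV s p ↔ SmoothSectionAt vertFrame s p :=
    fun p _ s => smoothV_iff s
  have hframe : ∀ c : HolChart n m M E, ∀ p ∈ nonzeroVectors m E, p.1 ∈ c.chart.source → ∀ k α,
      conjV (vertFrame c (k, α) p) = vertFrame c (Equiv.boolNot k, α) p :=
    fun c p _ _ k α => congrFun (conjV_vertFrame c k α) p
  have hV : ∀ c : HolChart n m M E, ∀ p ∈ nonzeroVectors m E, p.1 ∈ c.chart.source → ∀ w,
      w ∈ {w : VertC n p | w.1 ∈ holPart (TangentSpace (IE n m) p)} ↔
        ∀ k, k ≠ false → ∀ α, hf.coef c (k, α) p w = 0 := by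
    intro c p hp0 hp w
    rw [Set.mem_ofPred_eq, c.mem_holPart_iff_mem_span hp]
    exact hf.mem_span_block_iff c hp0 hp false w
  refine
    { connection := hf.isConnectionOn_conn hF hconv (fun p _ X hX => hX) hB
      real := fun p hp0 X s hs =>
        hf.conn_conj Equiv.boolNot (fun k => rfl) (fun _ => conjV) (fun _ => conjV_add)
          (fun _ => conjV_smul) hframe hp0 _ ((hB p hp0 s).1 hs)
      vertical := hf.preserves_conn (a := fun _ => LinearMap.id) hF hconv hB _ hV
      vertical_bar := ?_ }
  -- The (0,1)-part is the conjugate of the (1,0)-part, so its invariance follows by permuting the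
  -- blocks.
  have h := hf.preserves_conn (a := fun _ => LinearMap.id) hF hconv hB _
    (hf.conj_mem_iff _ (fun _ => conjV) (fun _ => conjV_add) (fun _ => conjV_smul) hframe hV)
  simp only [mem_antiPart_iff_conjC]
  exact h

theorem hasCoefficientsP_chernFinsler (hF : IsFinslerStructure n F) (hconv : IsConvex n F) :
    HasCoefficientsP A F (nonzeroVectors m E) (chernFinsler A hF hconv)
      (fun c => c.LA A F) (fun c => c.C F) 0 0 := by
  have key : ∀ c : HolChart n m M E, ∀ p ∈ nonzeroVectors m E, p.1 ∈ c.chart.source →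
      ∀ (X : Prolongation A p) k α, chernFinsler A hF hconv p X (adaptedFrame A F c (k, α)) =
        ∑ γ, c.blockForm F k.1 p (anchorT A p X) γ α • adaptedFrame A F c (k, γ) p :=
    fun c p hp0 hp X k α =>
      (isBlockFrame_adaptedFrame hF hconv).conn_frame c hF hconv hp0 hp _ k α
  have hL : ∀ c : HolChart n m M E, ∀ p, p.1 ∈ c.chart.source → ∀ β γ α,
      c.blockForm F false p (anchorT A p (c.xT A F β p)) γ α = c.LA A F γ α β p :=
    fun c p hp β γ α => (c.blockForm_false (c.holCoeff_deltaA hp β) γ α).trans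
      (c.LA_eq_sum hp α β γ).symm
  have hL' : ∀ c : HolChart n m M E, ∀ p, p.1 ∈ c.chart.source → ∀ β γ α,
      c.blockForm F true p (anchorT A p (c.xT A F β p)) γ α = 0 :=
    fun c p hp β γ α => c.blockForm_true (c.holCoeff_deltaA hp β) γ α
  have hv : ∀ c : HolChart n m M E, ∀ p, p.1 ∈ c.chart.source → ∀ β,
      anchorT A p (c.vT A β p) = c.du β p :=
    fun c p hp β => congrArg Prod.snd (c.vT_val (A := A) hp β)
  have hC : ∀ c : HolChart n m M E, ∀ p, p.1 ∈ c.chart.source → ∀ β γ α,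
      c.blockForm F false p (anchorT A p (c.vT A β p)) γ α = c.C F γ α β p :=
    fun c p hp β γ α => by
      rw [hv c p hp]
      exact c.blockForm_false (c.holCoeff_du β) γ α
  have hC' : ∀ c : HolChart n m M E, ∀ p, p.1 ∈ c.chart.source → ∀ β γ α,
      c.blockForm F true p (anchorT A p (c.vT A β p)) γ α = 0 :=
    fun c p hp β γ α => by
      rw [hv c p hp]
      exact c.blockForm_true (c.holCoeff_du β) γ α
  constructor
  all_goals intro c p hp0 hp α β
  · refine (key c p hp0 hp _ (false, true) α).trans ?_
    simp only [hL c p hp]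
    rfl
  · refine (key c p hp0 hp _ (false, true) α).trans ?_
    simp only [hC c p hp]
    rfl
  · refine (key c p hp0 hp _ (false, false) α).trans ?_
    simp only [hL c p hp]
    rfl
  · refine (key c p hp0 hp _ (false, false) α).trans ?_
    simp only [hC c p hp]
    rfl
  · refine (key c p hp0 hp _ (true, true) α).trans ?_
    simp only [hL' c p hp]
    rfl
  · refine (key c p hp0 hp _ (true, true) α).trans ?_
    simp only [hC' c p hp]
    rfl
  · refine (key c p hp0 hp _ (true, false) α).trans ?_
    simp only [hL' c p hp]
    rfl
  · refine (key c p hp0 hp _ (true, false) α).trans ?_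
    simp only [hC' c p hp]
    rfl

theorem hasCoefficientsV_verticalChernFinsler (hF : IsFinslerStructure n F)
    (hconv : IsConvex n F) :
    HasCoefficientsV F (nonzeroVectors m E) (verticalChernFinsler (n := n) F)
      (fun c => c.Lz F) (fun c => c.C F) 0 0 := by
  have key : ∀ c : HolChart n m M E, ∀ p ∈ nonzeroVectors m E, p.1 ∈ c.chart.source →
      ∀ X k α, verticalChernFinsler F p X (vertFrame c (k, α)) =
        ∑ γ, c.blockForm F k p X γ α • vertFrame c (k, γ) p :=
    fun c p hp0 hp X k α => isBlockFrame_vertFrame.conn_frame c hF hconv hp0 hp _ k α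
  constructor
  all_goals intro c p hp0 hp α β
  · refine (key c p hp0 hp _ false α).trans ?_
    simp only [c.blockForm_false (c.holCoeff_deltaz β)]
    rfl
  · refine (key c p hp0 hp _ false α).trans ?_
    simp only [c.blockForm_false (c.holCoeff_du β)]
    rfl
  · refine (key c p hp0 hp _ true α).trans ?_
    simp only [c.blockForm_true (c.holCoeff_deltaz β)]
    rfl
  · refine (key c p hp0 hp _ true α).trans ?_
    simp only [c.blockForm_true (c.holCoeff_du β)]
    rfl

/-! ### Uniqueness of the two connections. -/

theorem IsLinearConnectionP.eq_of_hasCoefficientsP (hF : IsFinslerStructure n F)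
    (hconv : IsConvex n F) {H : ∀ p : TotalSpace (Fin m → ℂ) E, Submodule ℂ (Prolongation A p)}
    {D D' : ∀ p : TotalSpace (Fin m → ℂ) E, Prolongation A p →
      (∀ q : TotalSpace (Fin m → ℂ) E, Prolongation A q) → Prolongation A p}
    (hD : IsLinearConnectionP A (nonzeroVectors m E) H D)
    (hD' : IsLinearConnectionP A (nonzeroVectors m E) H D')
    {L C L' C' : HolChart n m M E → Fin m → Fin m → Fin m → TotalSpace (Fin m → ℂ) E → ℂ}
    (hc : HasCoefficientsP A F (nonzeroVectors m E) D L C L' C')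
    (hc' : HasCoefficientsP A F (nonzeroVectors m E) D' L C L' C')
    {p : TotalSpace (Fin m → ℂ) E} (hp0 : p ∈ nonzeroVectors m E) (X : Prolongation A p)
    {s : ∀ q : TotalSpace (Fin m → ℂ) E, Prolongation A q} (hs : SmoothP A s p) :
    D p X s = D' p X s := by
  obtain ⟨c, hp⟩ := exists_holChart (n := n) (m := m) (E := E) p.1
  refine hD.connection.eq_of_conj (isBlockFrame_adaptedFrame hF hconv) hD'.connection
    (fun p hp0 s => smoothP_iff hF hconv hp0 s) c hp0 hp (Equiv.boolNot.prodCongr (Equiv.refl Bool))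
    (conjT_adaptedFrame c) (hD.real p hp0) (hD'.real p hp0)
    (G := (Set.range fun α => c.xT A F α p) ∪ Set.range fun α => c.vT A α p) ?_ ?_ X hs
  -- Two types of direction and four blocks of frame vectors: one case for each prescribed formula.
  · rintro _ (⟨β, rfl⟩ | ⟨β, rfl⟩) ⟨b | b, v | v⟩ α
    · exact (hc.horizontal_horizontal c p hp0 hp α β).trans
        (hc'.horizontal_horizontal c p hp0 hp α β).symm
    · exact (hc.horizontal_vertical c p hp0 hp α β).trans
        (hc'.horizontal_vertical c p hp0 hp α β).symm
    · exact (hc.horizontal_horizontal_bar c p hp0 hp α β).trans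
        (hc'.horizontal_horizontal_bar c p hp0 hp α β).symm
    · exact (hc.horizontal_vertical_bar c p hp0 hp α β).trans
        (hc'.horizontal_vertical_bar c p hp0 hp α β).symm
    · exact (hc.vertical_horizontal c p hp0 hp α β).trans
        (hc'.vertical_horizontal c p hp0 hp α β).symm
    · exact (hc.vertical_vertical c p hp0 hp α β).trans
        (hc'.vertical_vertical c p hp0 hp α β).symm
    · exact (hc.vertical_horizontal_bar c p hp0 hp α β).trans
        (hc'.vertical_horizontal_bar c p hp0 hp α β).symm
    · exact (hc.vertical_vertical_bar c p hp0 hp α β).trans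
        (hc'.vertical_vertical_bar c p hp0 hp α β).symm
  · intro X
    obtain ⟨a, b, a', b', h⟩ := c.prolongation_eq_sum (F := F) hp X
    have key : ∀ a b : Fin m → ℂ, ∑ α, a α • c.xT A F α p + ∑ α, b α • c.vT A α p ∈
        Submodule.span ℂ ((Set.range fun α => c.xT A F α p) ∪ Set.range fun α => c.vT A α p) :=
      fun a b => add_mem
        (Submodule.sum_mem _ fun α _ => Submodule.smul_mem _ _
          (Submodule.subset_span (Or.inl ⟨α, rfl⟩)))
        (Submodule.sum_mem _ fun α _ => Submodule.smul_mem _ _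
          (Submodule.subset_span (Or.inr ⟨α, rfl⟩)))
    exact ⟨_, key a b, _, key a' b', h⟩

theorem IsVerticalConnection.eq_of_hasCoefficientsV
    {D D' : ∀ p : TotalSpace (Fin m → ℂ) E, (ℂ ⊗[ℝ] TangentSpace (IE n m) p) →
      (∀ q : TotalSpace (Fin m → ℂ) E, VertC n q) → VertC n p}
    (hD : IsVerticalConnection (nonzeroVectors m E) D)
    (hD' : IsVerticalConnection (nonzeroVectors m E) D')
    {L L' : HolChart n m M E → Fin m → Fin m → Fin n → TotalSpace (Fin m → ℂ) E → ℂ}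
    {C C' : HolChart n m M E → Fin m → Fin m → Fin m → TotalSpace (Fin m → ℂ) E → ℂ}
    (hc : HasCoefficientsV F (nonzeroVectors m E) D L C L' C')
    (hc' : HasCoefficientsV F (nonzeroVectors m E) D' L C L' C')
    {p : TotalSpace (Fin m → ℂ) E} (hp0 : p ∈ nonzeroVectors m E)
    (X : ℂ ⊗[ℝ] TangentSpace (IE n m) p)
    {s : ∀ q : TotalSpace (Fin m → ℂ) E, VertC n q} (hs : SmoothV s p) :
    D p X s = D' p X s := by
  obtain ⟨c, hp⟩ := exists_holChart (n := n) (m := m) (E := E) p.1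
  refine hD.connection.eq_of_conj isBlockFrame_vertFrame hD'.connection
    (fun p _ s => smoothV_iff s) c hp0 hp Equiv.boolNot
    (conjV_vertFrame c) (hD.real p hp0) (hD'.real p hp0)
    (G := (Set.range fun k => c.deltaz F k p) ∪ Set.range fun α => c.du α p) ?_ ?_ X hs
  · rintro _ (⟨β, rfl⟩ | ⟨β, rfl⟩) (b | b) α
    · exact (hc.horizontal c p hp0 hp α β).trans (hc'.horizontal c p hp0 hp α β).symm
    · exact (hc.horizontal_bar c p hp0 hp α β).trans (hc'.horizontal_bar c p hp0 hp α β).symm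
    · exact (hc.vertical c p hp0 hp α β).trans (hc'.vertical c p hp0 hp α β).symm
    · exact (hc.vertical_bar c p hp0 hp α β).trans (hc'.vertical_bar c p hp0 hp α β).symm
  · intro X
    have hdu : ∀ α, c.du α p ∈ Submodule.span ℂ
        ((Set.range fun k => c.deltaz F k p) ∪ Set.range fun α => c.du α p) :=
      fun α => Submodule.subset_span (Or.inr ⟨α, rfl⟩)
    -- The `δ_k` and `∂̇_α` span the same space as the natural (1,0)-frame, so they and their
    -- conjugates give all directions.
    have hdz : ∀ k, c.dz k p ∈ Submodule.span ℂ
        ((Set.range fun k => c.deltaz F k p) ∪ Set.range fun α => c.du α p) := by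
      intro k
      have h : c.dz k p = c.deltaz F k p + ∑ β, c.Nz F β k p • c.du β p := by
        rw [HolChart.deltaz, sub_add_cancel]
      rw [h]
      exact add_mem (Submodule.subset_span (Or.inl ⟨k, rfl⟩))
        (Submodule.sum_mem _ fun β _ => Submodule.smul_mem _ _ (hdu β))
    have key : ∀ v : TangentSpace (IE n m) p, hol v ∈ Submodule.span ℂ
        ((Set.range fun k => c.deltaz F k p) ∪ Set.range fun α => c.du α p) := by
      intro v
      rw [c.hol_eq_sum hp]
      exact add_mem (Submodule.sum_mem _ fun k _ => Submodule.smul_mem _ _ (hdz k))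
        (Submodule.sum_mem _ fun β _ => Submodule.smul_mem _ _ (hdu β))
    exact ⟨_, key _, _, key _, (hol_add_conjC_hol X).symm⟩

/-! ### Compatibility of the two connections. -/

theorem coef_vertIncl (hF : IsFinslerStructure n F) (hconv : IsConvex n F) (c : HolChart n m M E)
    {p : TotalSpace (Fin m → ℂ) E} (hp0 : p ∈ nonzeroVectors m E) (hp : p.1 ∈ c.chart.source)
    (b v : Bool) (α : Fin m) (w : VertC n p) :
    (isBlockFrame_adaptedFrame (A := A) hF hconv).coef c ((b, v), α) p (vertIncl A p w) =
      if v then isBlockFrame_vertFrame.coef c (b, α) p w else 0 := by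
  have h : vertIncl A p w = ∑ j : (Bool × Bool) × Fin m,
      (if j.1.2 then isBlockFrame_vertFrame.coef c (j.1.1, j.2) p w else 0) •
        adaptedFrame A F c j p := by
    conv_lhs => rw [← isBlockFrame_vertFrame.sum_coef c hp0 hp w]
    rw [map_sum]
    simp only [map_smul, Fintype.sum_prod_type, Fintype.sum_bool, vertIncl_vertFrame (F := F),
      if_true, Bool.false_eq_true, if_false, zero_smul, Finset.sum_const_zero, add_zero]
  rw [h, IsBlockFrame.coef_sum _ c hp0 hp]

/-- The Chern-Finsler connection is induced by the vertical one. -/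
theorem chernFinsler_vertIncl (hF : IsFinslerStructure n F) (hconv : IsConvex n F)
    {p : TotalSpace (Fin m → ℂ) E} (hp0 : p ∈ nonzeroVectors m E) (X : Prolongation A p)
    (s : ∀ q : TotalSpace (Fin m → ℂ) E, VertC n q) :
    chernFinsler A hF hconv p X (fun q => vertIncl A q (s q)) =
      vertIncl A p (verticalChernFinsler F p (anchorT A p X) s) := by
  have hp := mem_holChartAt (n := n) (m := m) (E := E) p.1
  refine (isBlockFrame_adaptedFrame hF hconv).eq_of_coef _ hp0 hp ?_
  rintro ⟨⟨b, v⟩, α⟩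
  -- Both connections at `p` are computed in the same chart `holChartAt p.1`, so the coefficients
  -- are compared directly, without the chart-independence lemma.
  rw [coef_vertIncl hF hconv _ hp0 hp, chernFinsler, verticalChernFinsler, IsBlockFrame.conn,
    IsBlockFrame.conn, IsBlockFrame.coef_nabla _ _ hp0 hp, IsBlockFrame.coef_nabla _ _ hp0 hp]
  simp only [coef_vertIncl hF hconv _ hp0 hp]
  have h1 : (fun q => (isBlockFrame_adaptedFrame (A := A) hF hconv).coef (holChartAt p.1)
      ((b, v), α) q (vertIncl A q (s q))) =ᶠ[𝓝 p] fun q =>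
        if v then isBlockFrame_vertFrame.coef (holChartAt p.1) (b, α) q (s q) else 0 := by
    filter_upwards [HolChart.eventually_nonzero_base _ hp hp0] with q hq
    exact coef_vertIncl hF hconv _ hq.1 hq.2 b v α (s q)
  rw [vecAct_congr _ h1]
  cases v
  · simp [vecAct_const]
  · simp

end ChernFinsler

end Main

end FinslerAlgebroid

end

/-! ### The theorem on the Chern-Finsler connection. -/

theorem theorem2p1 {n m : ℕ}
    {M : Type*} [TopologicalSpace M] [ChartedSpace (Fin n → ℂ) M] [IsManifold (IM n) ω M]
    {E : M → Type*} [∀ x, AddCommGroup (E x)] [∀ x, Module ℂ (E x)]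
    [TopologicalSpace (TotalSpace (Fin m → ℂ) E)] [∀ x, TopologicalSpace (E x)]
    [FiberBundle (Fin m → ℂ) E] [VectorBundle ℂ (Fin m → ℂ) E]
    [ContMDiffVectorBundle ω (Fin m → ℂ) E (IM n)]
    (A : HolomorphicLieAlgebroid n m M E)
    (F : TotalSpace (Fin m → ℂ) E → ℝ) (hF : IsFinslerStructure n F) (hconv : IsConvex n F) :
    -- `ρ^k_β L^γ_{αk} = h^{σ̄γ} δ_β h_{ασ̄}`, with `δ_β = ρ_𝒯(𝒳_β) = ρ^k_β δ_k`
    (∀ c : HolChart n m M E, ∀ p ∈ nonzeroVectors m E, p.1 ∈ c.chart.source →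
      (∀ β, c.deltaA A F β p = ∑ k, c.rho A k β p.1 • c.deltaz F k p) ∧
      ∀ α β γ, c.LA A F γ α β p =
        ∑ σ, c.hInv F σ γ p * vecAct (c.deltaA A F β p) (fun q => c.h F q α σ)) ∧
    -- the Chern-Finsler nonlinear connection, with adapted frame `𝒳_α`
    ∃ H : ∀ p : TotalSpace (Fin m → ℂ) E, Submodule ℂ (Prolongation A p),
      IsNonlinearConnection A (nonzeroVectors m E) H ∧
      (∀ c : HolChart n m M E, ∀ p ∈ nonzeroVectors m E, p.1 ∈ c.chart.source →
        H p = Submodule.span ℂ (Set.range fun α => c.xT A F α p)) ∧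
    -- the Chern-Finsler linear connection on `𝒯_ℂE`, of type `(1,0)`
    ∃ D : ∀ p : TotalSpace (Fin m → ℂ) E, Prolongation A p →
        (∀ q : TotalSpace (Fin m → ℂ) E, Prolongation A q) → Prolongation A p,
      IsLinearConnectionP A (nonzeroVectors m E) H D ∧
      HasCoefficientsP A F (nonzeroVectors m E) D
        (fun c => c.LA A F) (fun c => c.C F) 0 0 ∧
      (∀ D' : ∀ p : TotalSpace (Fin m → ℂ) E, Prolongation A p →
          (∀ q : TotalSpace (Fin m → ℂ) E, Prolongation A q) → Prolongation A p,
        IsLinearConnectionP A (nonzeroVectors m E) H D' →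
        HasCoefficientsP A F (nonzeroVectors m E) D'
          (fun c => c.LA A F) (fun c => c.C F) 0 0 →
        ∀ p ∈ nonzeroVectors m E, ∀ X s, SmoothP A s p → D' p X s = D p X s) ∧
    -- it is induced by the vertical Chern-Finsler connection on `VT_ℂE`
    ∃ DV : ∀ p : TotalSpace (Fin m → ℂ) E, (TensorProduct ℝ ℂ (TangentSpace (IE n m) p)) →
        (∀ q : TotalSpace (Fin m → ℂ) E, VertC n q) → VertC n p,
      IsVerticalConnection (nonzeroVectors m E) DV ∧
      HasCoefficientsV F (nonzeroVectors m E) DV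
        (fun c => c.Lz F) (fun c => c.C F) 0 0 ∧
      (∀ DV' : ∀ p : TotalSpace (Fin m → ℂ) E, (TensorProduct ℝ ℂ (TangentSpace (IE n m) p)) →
          (∀ q : TotalSpace (Fin m → ℂ) E, VertC n q) → VertC n p,
        IsVerticalConnection (nonzeroVectors m E) DV' →
        HasCoefficientsV F (nonzeroVectors m E) DV'
          (fun c => c.Lz F) (fun c => c.C F) 0 0 →
        ∀ p ∈ nonzeroVectors m E, ∀ X s, SmoothV s p → DV' p X s = DV p X s) ∧
      ∀ p ∈ nonzeroVectors m E, ∀ (X : Prolongation A p)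
        (s : ∀ q : TotalSpace (Fin m → ℂ) E, VertC n q), SmoothV s p →
        D p X (fun q => vertIncl A q (s q)) = vertIncl A p (DV p (anchorT A p X) s) :=
  ⟨fun c _ _ hp => ⟨fun β => c.deltaA_eq_sum hp β, fun α β γ => c.LA_eq_sum hp α β γ⟩,
    horizontal A F, isNonlinearConnection_horizontal hF hconv,
    fun c _ hp0 hp => horizontal_eq_span c hF hconv hp0 hp,
    chernFinsler A hF hconv, isLinearConnectionP_chernFinsler hF hconv,
    hasCoefficientsP_chernFinsler hF hconv,
    fun _ hD hc _ hp0 X _ hs => hD.eq_of_hasCoefficientsP hF hconv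
      (isLinearConnectionP_chernFinsler hF hconv) hc (hasCoefficientsP_chernFinsler hF hconv)
      hp0 X hs,
    verticalChernFinsler F, isVerticalConnection_verticalChernFinsler hF hconv,
    hasCoefficientsV_verticalChernFinsler hF hconv,
    fun _ hD hc _ hp0 X _ hs => hD.eq_of_hasCoefficientsV
      (isVerticalConnection_verticalChernFinsler hF hconv) hc
      (hasCoefficientsV_verticalChernFinsler hF hconv) hp0 X hs,
    fun _ hp0 X s _ => chernFinsler_vertIncl hF hconv hp0 X s⟩
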